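/- Graphs are finite and undirected and may have parallel edges. Costs are nonnegative rationals, capacities are positive rationals, $k$ is a nonnegative integer, and all numbers in the input are written in binary. For an edge set $J$ and a vertex set $S$, $\delta_J(S)$ is the set of edges of $J$ with exactly one end in $S$, and $d_J(S)=|\delta_J(S)|$. A minimization problem admits approximation ratio $\rho$ (a function of the instance) if there is an algorithm that halts on every instance in time polynomial in the length of the input and, on every instance that has a feasible solution, outputs a feasible solution of cost at most $\rho$ times the cost of any feasible solution. Near Min-Cuts Cover: given a graph $G_0=(V,E_0)$, an edge set $E$ on $V$ with costs $\{c_e : e\in E\}$, and an integer $k$, find a set $J\subseteq E$ of minimum cost $\sum_{e\in J}c_e$ such that $d_J(S)\ge 1$ for every $\emptyset\ne S\subsetneq V$ with $d_{E_0}(S)<k$. Capacitated $k$-Edge Connected Spanning Subgraph (Cap-$k$-ECSS): given a graph $G=(V,E)$ with edge costs $\{c_e : e\in E\}$ and edge capacities $\{u_e : e\in E\}$, and an integer $k$, find a set $J\subseteq E$ of minimum cost $\sum_{e\in J}c_e$ such that $\sum_{e\in\delta_J(S)}u_e\ge k$ for every $\emptyset\ne S\subsetneq V$. Theorem. Near Min-Cuts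 Cover admits approximation ratio $10$. Cap-$k$-ECSS admits approximation ratio $10\cdot\lceil k/u_{\min}\rceil$, where $u_{\min}=\min_{e\in E}u_e$ is the minimum capacity of an edge. -/

import Mathlib

namespace NetDesign

/-! ### Machine model: a random access machine with logarithmic cost

Data are natural numbers, kept in scalar variables and in arrays of unbounded length (a program
mentions finitely many of each).  Every operation is charged the bit lengths of all numbers that
it reads, produces or uses as an address, so that running time is polynomially related to the
running time of a Turing machine. -/

/-- A memory configuration: the contents of the variables and of the arrays. -/
structure State where
  var : ℕ → ℕ
  arr : ℕ → ℕ → ℕ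

/-- Arithmetic expressions. `read a i` is the entry of array `a` at the position computed by `i`. -/
inductive Term where
  | const (c : ℕ)
  | var (x : ℕ)
  | read (a : ℕ) (i : Term)
  | add (e f : Term)
  | sub (e f : Term)
  | mul (e f : Term)
  | div (e f : Term)

/-- The value of an expression; subtraction is truncated at `0`, division is the integer quotient
(and `0` if the divisor is `0`). -/
def Term.eval (s : State) : Term → ℕ
  | .const c => c
  | .var x => s.var x
  | .read a i => s.arr a (i.eval s)
  | .add e f => e.eval s + f.eval s
  | .sub e f => e.eval s - f.eval s
  | .mul e f => e.eval s * f.eval s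
  | .div e f => e.eval s / f.eval s

/-- The time needed to evaluate an expression: `1` plus the bit length of the value, for the
expression itself and for each of its subexpressions. -/
def Term.time (s : State) : Term → ℕ
  | .const c => 1 + Nat.size c
  | .var x => 1 + Nat.size (s.var x)
  | .read a i => i.time s + (1 + Nat.size (s.arr a (i.eval s)))
  | .add e f => e.time s + f.time s + (1 + Nat.size (e.eval s + f.eval s))
  | .sub e f => e.time s + f.time s + (1 + Nat.size (e.eval s - f.eval s))
  | .mul e f => e.time s + f.time s + (1 + Nat.size (e.eval s * f.eval s))
  | .div e f => e.time s + f.time s + (1 + Nat.size (e.eval s / f.eval s))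

/-- Programs. Tests succeed when the tested expression is nonzero. -/
inductive Prog where
  | skip
  | assign (x : ℕ) (e : Term)
  | store (a : ℕ) (i e : Term)
  | seq (p q : Prog)
  | ite (e : Term) (p q : Prog)
  | loop (e : Term) (p : Prog)

/-- Write `v` into variable `x`. -/
def State.setVar (s : State) (x v : ℕ) : State :=
  { s with var := Function.update s.var x v }

/-- Write `v` into position `i` of array `a`. -/
def State.setArr (s : State) (a i v : ℕ) : State :=
  { s with arr := Function.update s.arr a (Function.update (s.arr a) i v) }

/-- `Run p s s' t`: program `p`, started in `s`, halts in `s'` after time exactly `t`. -/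
inductive Run : Prog → State → State → ℕ → Prop where
  | skip (s : State) : Run .skip s s 1
  | assign (s : State) (x : ℕ) (e : Term) :
      Run (.assign x e) s (s.setVar x (e.eval s)) (e.time s + 1)
  | store (s : State) (a : ℕ) (i e : Term) :
      Run (.store a i e) s (s.setArr a (i.eval s) (e.eval s)) (i.time s + e.time s + 1)
  | seq {p q : Prog} {s s' s'' : State} {t t' : ℕ} (hp : Run p s s' t) (hq : Run q s' s'' t') :
      Run (.seq p q) s s'' (t + t')
  | ite_true {e : Term} {p q : Prog} {s s' : State} {t : ℕ} (he : e.eval s ≠ 0)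
      (hp : Run p s s' t) : Run (.ite e p q) s s' (e.time s + 1 + t)
  | ite_false {e : Term} {p q : Prog} {s s' : State} {t : ℕ} (he : e.eval s = 0)
      (hq : Run q s s' t) : Run (.ite e p q) s s' (e.time s + 1 + t)
  | loop_step {e : Term} {p : Prog} {s s' s'' : State} {t t' : ℕ} (he : e.eval s ≠ 0)
      (hp : Run p s s' t) (hl : Run (.loop e p) s' s'' t') :
      Run (.loop e p) s s'' (e.time s + 1 + t + t')
  | loop_exit {e : Term} {p : Prog} {s : State} (he : e.eval s = 0) :
      Run (.loop e p) s s (e.time s + 1)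

/-- The machine is deterministic: final memory and running time are determined by the program
and the initial memory. -/
theorem Run.deterministic {p : Prog} {s s₁ s₂ : State} {t₁ t₂ : ℕ}
    (h₁ : Run p s s₁ t₁) (h₂ : Run p s s₂ t₂) : s₁ = s₂ ∧ t₁ = t₂ := by
  induction h₁ generalizing s₂ t₂ with
  | skip s => cases h₂; exact ⟨rfl, rfl⟩
  | assign s x e => cases h₂; exact ⟨rfl, rfl⟩
  | store s a i e => cases h₂; exact ⟨rfl, rfl⟩
  | seq _ _ ihp ihq =>
    cases h₂ with
    | seq hp hq =>
      obtain ⟨rfl, rfl⟩ := ihp hp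
      obtain ⟨rfl, rfl⟩ := ihq hq
      exact ⟨rfl, rfl⟩
  | ite_true he _ ihp =>
    cases h₂ with
    | ite_true _ hp => obtain ⟨rfl, rfl⟩ := ihp hp; exact ⟨rfl, rfl⟩
    | ite_false he' _ => exact absurd he' he
  | ite_false he _ ihq =>
    cases h₂ with
    | ite_true he' _ => exact absurd he he'
    | ite_false _ hq => obtain ⟨rfl, rfl⟩ := ihq hq; exact ⟨rfl, rfl⟩
  | loop_step he _ _ ihp ihl =>
    cases h₂ with
    | loop_step _ hp hl =>
      obtain ⟨rfl, rfl⟩ := ihp hp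
      obtain ⟨rfl, rfl⟩ := ihl hl
      exact ⟨rfl, rfl⟩
    | loop_exit he' => exact absurd he' he
  | loop_exit he =>
    cases h₂ with
    | loop_step he' _ _ => exact absurd he he'
    | loop_exit _ => exact ⟨rfl, rfl⟩

/-- An input is a finite sequence of lists of numbers. Initially the `j`-th list (counted from
`0`) is in array `j + 1`; array `0`, which is used for the output, all variables and all other
positions are `0`. -/
def initial (input : List (List ℕ)) : State where
  var := fun _ => 0
  arr := fun a i =>
    match a with
    | 0 => 0
    | j + 1 => (input.getD j []).getD i 0

/-- The length of an input: each number is written in binary, followed by a separator. -/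
def inputLength (input : List (List ℕ)) : ℕ :=
  (input.map fun l => (l.map fun x => Nat.size x + 1).sum).sum

/-! ### Approximation algorithms -/

/-- A minimization problem whose solutions are sets of edges: each instance `I` has a list of
`numEdges I` edges, the feasible solutions are certain subsets of it, and each set of edges
has a nonnegative cost. -/
structure EdgeProblem where
  Instance : Type
  encode : Instance → List (List ℕ)
  numEdges : Instance → ℕ
  Feasible : (I : Instance) → Finset (Fin (numEdges I)) → Prop
  cost : (I : Instance) → Finset (Fin (numEdges I)) → ℚ≥0

/-- The edge set described by a final memory: the edges with a nonzero entry in array `0`. -/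
def outputSet (m : ℕ) (s : State) : Finset (Fin m) :=
  Finset.univ.filter fun e => s.arr 0 e ≠ 0

/-- `P` admits approximation ratio `ρ` (which may depend on the instance): one program halts on
every instance in time polynomial in the length of the input, and on every instance that
has a feasible solution it outputs a feasible one of cost at most `ρ` times that of any other. -/
def EdgeProblem.AdmitsRatio (P : EdgeProblem) (ρ : P.Instance → ℚ≥0) : Prop :=
  ∃ (prog : Prog) (bound : Polynomial ℕ), ∀ I : P.Instance, ∃ (s : State) (t : ℕ),
    Run prog (initial (P.encode I)) s t ∧ t ≤ bound.eval (inputLength (P.encode I)) ∧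
    ((∃ J, P.Feasible I J) →
      P.Feasible I (outputSet (P.numEdges I) s) ∧
      ∀ J, P.Feasible I J → P.cost I (outputSet (P.numEdges I) s) ≤ ρ I * P.cost I J)

/-! ### Graphs and cuts -/

/-- A list of `m` undirected edges on the vertex set `Fin n`, each given by its two ends;
parallel edges (and loops, which belong to no cut) are allowed. -/
abbrev EdgeList (n m : ℕ) := Fin m → Fin n × Fin n

/-- `δ_J(S)`: the edges of `J` with exactly one end in `S`. -/
def cut {n m : ℕ} (E : EdgeList n m) (J : Finset (Fin m)) (S : Finset (Fin n)) :
    Finset (Fin m) :=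
  J.filter fun e => ¬((E e).1 ∈ S ↔ (E e).2 ∈ S)

/-- `J` covers the set family `F`: `d_J(S) ≥ 1` for each `S ∈ F`. -/
def Covers {n m : ℕ} (E : EdgeList n m) (J : Finset (Fin m)) (F : Set (Finset (Fin n))) : Prop :=
  ∀ S ∈ F, 1 ≤ (cut E J S).card

/-- The first ends and the second ends of the edges, as two lists. -/
def encodeEdges {n m : ℕ} (E : EdgeList n m) : List (List ℕ) :=
  [List.ofFn fun e => ((E e).1 : ℕ), List.ofFn fun e => ((E e).2 : ℕ)]

/-- The numerators and the denominators of the entries of a vector, as two lists. -/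
def encodeVector {m : ℕ} (c : Fin m → ℚ≥0) : List (List ℕ) :=
  [List.ofFn fun e => (c e).num, List.ofFn fun e => (c e).den]

/-! ### Near Min-Cuts Cover -/

/-- A graph `(V, E₀)`, an edge set `E` on `V` with costs, and an integer `k`. -/
structure NearMinCutsInstance where
  /-- the number of vertices -/
  n : ℕ
  /-- the number of edges of the given graph -/
  m₀ : ℕ
  /-- the number of edges that can be bought -/
  m : ℕ
  k : ℕ
  E₀ : EdgeList n m₀
  E : EdgeList n m
  cost : Fin m → ℚ≥0

/-- The family of all nonempty proper vertex subsets `S` with `d_{E₀}(S) < k`. -/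
def NearMinCutsInstance.family (I : NearMinCutsInstance) : Set (Finset (Fin I.n)) :=
  {S | S.Nonempty ∧ S ≠ Finset.univ ∧ (cut I.E₀ Finset.univ S).card < I.k}

/-- The problem Near Min-Cuts Cover. An instance is written as `n, m₀, m, k`, the list of
vertices, the ends of the edges of `E₀` and of `E`, and the costs. -/
def nearMinCutsCover : EdgeProblem where
  Instance := NearMinCutsInstance
  encode I := [[I.n, I.m₀, I.m, I.k], List.range I.n] ++ encodeEdges I.E₀ ++ encodeEdges I.E ++
    encodeVector I.cost
  numEdges I := I.m
  Feasible I J := Covers I.E J I.family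
  cost I J := ∑ e ∈ J, I.cost e

/-! ### Capacitated `k`-Edge Connected Spanning Subgraph -/

/-- A graph `(V, E)` with edge costs and positive edge capacities, and an integer `k`. -/
structure CapInstance where
  /-- the number of vertices -/
  n : ℕ
  /-- the number of edges -/
  m : ℕ
  k : ℕ
  E : EdgeList n m
  cost : Fin m → ℚ≥0
  cap : Fin m → ℚ≥0
  cap_pos : ∀ e, 0 < cap e

/-- The minimum capacity of an edge (`1` if there are no edges). -/
def CapInstance.uMin (I : CapInstance) : ℚ≥0 :=
  if h : (Finset.univ : Finset (Fin I.m)).Nonempty then Finset.univ.inf' h I.cap else 1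

/-- The problem Cap-`k`-ECSS. An instance is written as `n, m, k`, the list of vertices, the
ends of the edges, the costs and the capacities. -/
def capKECSS : EdgeProblem where
  Instance := CapInstance
  encode I := [[I.n, I.m, I.k], List.range I.n] ++ encodeEdges I.E ++ encodeVector I.cost ++
    encodeVector I.cap
  numEdges I := I.m
  Feasible I J := ∀ S : Finset (Fin I.n), S.Nonempty → S ≠ Finset.univ →
    (I.k : ℚ≥0) ≤ ∑ e ∈ cut I.E J S, I.cap e
  cost I J := ∑ e ∈ J, I.cost e

end NetDesign

/-! Near Min-Cuts Cover is solved by a primal-dual algorithm with a local ratio analysis. The sets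
to be covered are the small sets of a symmetric submodular cut function. Giving every bought edge
weight `k` yields `residual`, again symmetric submodular, whose small sets are those still
uncovered, so the same structure is present at every step. A step lowers each edge cost in
proportion to the number of cores (inclusion-minimal uncovered sets) that the edge leaves, until
some edge is free, and buys it; afterwards superfluous edges are dropped in reverse order. Backward
induction (`reverse_delete_step`) reduces the ratio to one inequality: a minimal cover of the
residual family leaves the cores at most ten times per core (`sum_card_cut_cores_le`), while any
cover leaves each core at least once.

The ten rests on two facts. A minimal cover has a laminar family of witness sets, each crossed by a
single edge (`exists_laminar_witness`). And a core that crosses a nested pair of small sets leaves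
the rest of their difference empty or small (`small_sdiff_of_core`). Each core pays ten, and
`count_step` moves the surplus up the laminar forest. The only lossy configuration is a set with a
single child where one core threads through both; `not_threaded` shows that it never occurs twice in
a row.

The cores are found without enumerating cuts. In a contracted graph, removing vertices of minimum
degree down to the last two gives a flat pair (`Flat.of_erase`): a set separating it has at least
the weight of some single class inside it. Hence once the small classes are labelled, no unlabelled
core separates the pair, and it can be merged (`Pending.merge`). An edge leaves at most two cores,
so doubling the costs in each step keeps all numbers integral. Polynomial time follows from writing
the algorithm with loops bounded by input sizes and with operations that enlarge bit lengths only
additively (`Cmd.run_compile`).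

For Cap-`k`-ECSS, the cuts of capacity below `k` are covered again and again by edges not yet
bought. Every deficient cut gains at least `uMin` per round, so none is left after `⌈k / uMin⌉`
rounds, and each round costs at most ten times the optimum (`Progress.succ`). -/

namespace NetDesign

/-! ### Small sets of a symmetric submodular function: cores, uncrossing, laminar witnesses. -/

open Finset

/-! ### Symmetric submodular functions and their small sets -/

variable {n m : ℕ}

/-- A symmetric submodular set function. -/
structure SymSubmodular (d : Finset (Fin n) → ℕ) : Prop where
  compl : ∀ S, d Sᶜ = d S
  submod : ∀ A B, d (A ∩ B) + d (A ∪ B) ≤ d A + d B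

/-- A nonempty proper vertex set with value less than `k`. -/
def Small (d : Finset (Fin n) → ℕ) (k : ℕ) (S : Finset (Fin n)) : Prop :=
  S.Nonempty ∧ S ≠ univ ∧ d S < k

open Classical in
/-- The inclusion-minimal small sets. -/
noncomputable def cores (d : Finset (Fin n) → ℕ) (k : ℕ) : Finset (Finset (Fin n)) :=
  univ.filter fun C => Small d k C ∧ ∀ S, S ⊆ C → Small d k S → S = C

section Small

variable {d : Finset (Fin n) → ℕ} {k : ℕ} {A B C S : Finset (Fin n)}

theorem mem_cores : C ∈ cores d k ↔ Small d k C ∧ ∀ S, S ⊆ C → Small d k S → S = C := by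
  simp [cores]

/-- Submodularity for `A` and `Bᶜ`, whose union is the complement of `B \ A`. -/
theorem SymSubmodular.posimodular (hd : SymSubmodular d) (A B : Finset (Fin n)) :
    d (A \ B) + d (B \ A) ≤ d A + d B := by
  have h := hd.submod A Bᶜ
  rw [hd.compl B] at h
  have h1 : A ∩ Bᶜ = A \ B := by ext; simp
  have h2 : A ∪ Bᶜ = (B \ A)ᶜ := by ext; simp; tauto
  rwa [h1, h2, hd.compl] at h

theorem Small.exists_core (hS : Small d k S) : ∃ C ∈ cores d k, C ⊆ S := by
  induction S using Finset.strongInduction with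
  | H S ih =>
    by_cases h : ∃ T, T ⊂ S ∧ Small d k T
    · obtain ⟨T, hT, hs⟩ := h
      obtain ⟨C, hC, hCT⟩ := ih T hT hs
      exact ⟨C, hC, hCT.trans hT.1⟩
    · push Not at h
      refine ⟨S, mem_cores.2 ⟨hS, fun T hT hs => ?_⟩, subset_rfl⟩
      by_contra hne
      exact h T (hT.ssubset_of_ne hne) hs

theorem le_of_ssubset_core (hC : C ∈ cores d k) (hS : S ⊂ C) (hne : S.Nonempty) : k ≤ d S := by
  by_contra h
  have := (mem_cores.1 hC).2 S hS.1 ⟨hne, fun h' => ?_, by omega⟩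
  · exact hS.ne this
  · subst h'
    exact hS.2 (subset_univ _)

theorem core_nonempty (hC : C ∈ cores d k) : C.Nonempty := (mem_cores.1 hC).1.1

theorem core_eq_of_subset (hC : C ∈ cores d k) (hB : B ∈ cores d k) (h : C ⊆ B) : C = B :=
  (mem_cores.1 hB).2 C h (mem_cores.1 hC).1

/-- If two distinct cores met, both differences would be nonempty proper subsets of cores, hence of
value at least `k`, while posimodularity bounds their sum by less than `2 * k`. -/
theorem cores_disjoint (hd : SymSubmodular d) (hA : A ∈ cores d k) (hB : B ∈ cores d k)
    (hne : A ≠ B) : Disjoint A B := by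
  by_contra h
  rw [disjoint_iff_inter_eq_empty, ← Ne, ← nonempty_iff_ne_empty] at h
  have h1 : (A \ B).Nonempty := by
    rw [sdiff_nonempty]
    exact fun h' => hne (core_eq_of_subset hA hB h')
  have h2 : (B \ A).Nonempty := by
    rw [sdiff_nonempty]
    exact fun h' => hne (core_eq_of_subset hB hA h').symm
  have h3 : A \ B ⊂ A := by
    refine sdiff_subset.ssubset_of_ne fun h' => ?_
    rw [Finset.sdiff_eq_self_iff_disjoint, disjoint_iff_inter_eq_empty] at h'
    simp [h'] at h
  have h4 : B \ A ⊂ B := by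
    refine sdiff_subset.ssubset_of_ne fun h' => ?_
    rw [Finset.sdiff_eq_self_iff_disjoint, disjoint_iff_inter_eq_empty, inter_comm] at h'
    simp [h'] at h
  have := le_of_ssubset_core hA h3 h1
  have := le_of_ssubset_core hB h4 h2
  have := hd.posimodular A B
  have := (mem_cores.1 hA).1.2.2
  have := (mem_cores.1 hB).1.2.2
  omega

theorem eq_of_mem_cores (hd : SymSubmodular d) (hA : A ∈ cores d k) (hB : B ∈ cores d k)
    {v : Fin n} (h1 : v ∈ A) (h2 : v ∈ B) : A = B := by
  by_contra h
  exact disjoint_left.1 (cores_disjoint hd hA hB h) h1 h2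

/-- If a core crosses two nested small sets, the part of their difference outside
the core is empty or small. -/
theorem small_sdiff_of_core (hd : SymSubmodular d) (hC : C ∈ cores d k) (hA : Small d k A)
    (hB : Small d k B) (hAB : A ⊆ B) (h1 : (A ∩ C).Nonempty) (h2 : ¬ C ⊆ B)
    (h3 : (B \ (A ∪ C)).Nonempty) : Small d k (B \ (A ∪ C)) := by
  -- Both `A ∩ C` and `C \ B` are nonempty proper parts of the core, so their values are at least
  -- `k`. Submodularity for `A, C` and posimodularity for `B, A ∪ C` then bound the value of `B \ (A
  -- ∪ C)` by `d A + d B + d C - 2 * k`, which is less than `k`.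
  have hCA : A ∩ C ⊂ C :=
    inter_subset_right.ssubset_of_ne fun h => h2 ((inter_eq_right.1 h).trans hAB)
  have e1 := le_of_ssubset_core hC hCA h1
  have hCB : C \ B ⊂ C := by
    refine sdiff_subset.ssubset_of_ne fun h' => ?_
    rw [Finset.sdiff_eq_self_iff_disjoint] at h'
    obtain ⟨v, hv⟩ := h1
    rw [mem_inter] at hv
    exact disjoint_left.1 h' hv.2 (hAB hv.1)
  have e2 := le_of_ssubset_core hC hCB (sdiff_nonempty.2 h2)
  have e3 := hd.submod A C
  have e4 := hd.posimodular B (A ∪ C)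
  have e5 : (A ∪ C) \ B = C \ B := by
    ext v; simp only [mem_sdiff, mem_union]
    have := @hAB v; tauto
  rw [e5] at e4
  have := (mem_cores.1 hC).1.2.2
  have := hA.2.2
  have := hB.2.2
  refine ⟨h3, fun h => ?_, by omega⟩
  obtain ⟨v, hv⟩ := h1
  have := h ▸ mem_univ v
  simp only [mem_sdiff, mem_union] at this
  exact this.2 (Or.inl (mem_inter.1 hv).1)

end Small

/-! ### Cuts -/

theorem mem_cut {E : EdgeList n m} {J : Finset (Fin m)} {S : Finset (Fin n)} {e : Fin m} :
    e ∈ cut E J S ↔ e ∈ J ∧ ¬((E e).1 ∈ S ↔ (E e).2 ∈ S) := by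
  simp [cut]

theorem cut_compl (E : EdgeList n m) (J : Finset (Fin m)) (S : Finset (Fin n)) :
    cut E J Sᶜ = cut E J S := by
  ext e; simp only [mem_cut, mem_compl]; tauto

theorem covers_iff {E : EdgeList n m} {J : Finset (Fin m)} {F : Set (Finset (Fin n))} :
    Covers E J F ↔ ∀ S ∈ F, (cut E J S).Nonempty := by
  simp [Covers, Nat.one_le_iff_ne_zero, nonempty_iff_ne_empty]

/-! ### Laminar witness families -/

section Witness

variable {E : EdgeList n m} {J : Finset (Fin m)} {d : Finset (Fin n) → ℕ} {k : ℕ}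

/-- `W` minimizes `d` among all sets that are crossed by `e` and no other edge of `J`. -/
def IsWitness (E : EdgeList n m) (J : Finset (Fin m)) (d : Finset (Fin n) → ℕ) (e : Fin m)
    (W : Finset (Fin n)) : Prop :=
  cut E J W = {e} ∧ ∀ S, cut E J S = {e} → d W ≤ d S

theorem IsWitness.compl (hd : ∀ S, d Sᶜ = d S) {e : Fin m} {W : Finset (Fin n)}
    (h : IsWitness E J d e W) : IsWitness E J d e Wᶜ :=
  ⟨by rw [cut_compl]; exact h.1, fun S hS => by rw [hd]; exact h.2 S hS⟩

/-- The differences `A \ B` and `B \ A` are again crossed by `e` alone and by `f` alone, so by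
minimality they have together at least the value of `A` and `B`. -/
theorem IsWitness.not_crossing_aux {A B : Finset (Fin n)} {e f : Fin m}
    (hd : d (A \ B) + d (B \ A) < d A + d B)
    (hA : IsWitness E J d e A) (hB : IsWitness E J d f B)
    (h1 : (E e).1 ∉ B) (h2 : (E e).2 ∉ B) (h3 : (E f).1 ∉ A) (h4 : (E f).2 ∉ A) : False := by
  have key : ∀ {A B : Finset (Fin n)} {e f : Fin m}, cut E J A = {e} → cut E J B = {f} →
      (E e).1 ∉ B → (E e).2 ∉ B → (E f).1 ∉ A → (E f).2 ∉ A → cut E J (A \ B) = {e} := by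
    intro A B e f hA hB h1 h2 h3 h4
    ext g
    have a1 : g ∈ cut E J A ↔ g = e := by rw [hA, mem_singleton]
    have a2 : g ∈ cut E J B ↔ g = f := by rw [hB, mem_singleton]
    rw [mem_cut] at a1 a2
    rw [mem_cut, mem_singleton, mem_sdiff, mem_sdiff]
    by_cases hge : g = e
    · subst hge; tauto
    by_cases hgf : g = f
    · subst hgf; tauto
    tauto
  have := hA.2 _ (key hA.1 hB.1 h1 h2 h3 h4)
  have := hB.2 _ (key hB.1 hA.1 h3 h4 h1 h2)
  omega

/-- Witness sets of distinct edges do not cross if `d` is symmetric and strictly submodular on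
crossing pairs. -/
theorem IsWitness.not_crossing (hc : ∀ S, d Sᶜ = d S)
    (hs : ∀ A B, (A ∩ B).Nonempty → (A \ B).Nonempty → (B \ A).Nonempty → ((A ∪ B)ᶜ).Nonempty →
      d (A \ B) + d (B \ A) < d A + d B)
    {A B : Finset (Fin n)} {e f : Fin m} (hef : e ≠ f)
    (hA : IsWitness E J d e A) (hB : IsWitness E J d f B)
    (h1 : (A ∩ B).Nonempty) (h2 : (A \ B).Nonempty) (h3 : (B \ A).Nonempty)
    (h4 : ((A ∪ B)ᶜ).Nonempty) : False := by
  have eJ : e ∈ J := (mem_cut.1 (hA.1 ▸ mem_singleton_self e)).1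
  have fJ : f ∈ J := (mem_cut.1 (hB.1 ▸ mem_singleton_self f)).1
  have he : (E e).1 ∈ B ↔ (E e).2 ∈ B := by
    by_contra h
    have : e ∈ cut E J B := mem_cut.2 ⟨eJ, h⟩
    rw [hB.1, mem_singleton] at this
    exact hef this
  have hf : (E f).1 ∈ A ↔ (E f).2 ∈ A := by
    by_contra h
    have : f ∈ cut E J A := mem_cut.2 ⟨fJ, h⟩
    rw [hA.1, mem_singleton] at this
    exact hef this.symm
  have i1 : A \ Bᶜ = A ∩ B := by ext; simp
  have i2 : B \ Aᶜ = A ∩ B := by ext; simp [and_comm]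
  have i3 : Aᶜ \ B = (A ∪ B)ᶜ := by ext; simp
  have i4 : Bᶜ \ A = (A ∪ B)ᶜ := by ext; simp [and_comm]
  have i5 : Aᶜ \ Bᶜ = B \ A := by ext; simp [and_comm]
  have i6 : Bᶜ \ Aᶜ = A \ B := by ext; simp [and_comm]
  have j1 : A ∩ Bᶜ = A \ B := by ext; simp
  have j2 : Aᶜ ∩ B = B \ A := by ext; simp [and_comm]
  have j3 : (A ∪ Bᶜ)ᶜ = B \ A := by ext; simp [and_comm]
  have j4 : (Aᶜ ∪ B)ᶜ = A \ B := by ext; simp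
  have j5 : Aᶜ ∩ Bᶜ = (A ∪ B)ᶜ := by ext; simp
  have j6 : (Aᶜ ∪ Bᶜ)ᶜ = A ∩ B := by ext; simp
  -- Since `e` does not cross `B` and `f` does not cross `A`, complementing `B` or `A` where
  -- necessary puts both ends of `e` outside `B` and both ends of `f` outside `A`. Complements of
  -- witnesses are witnesses, and crossing pairs stay crossing.
  by_cases heB : (E e).1 ∈ B <;> by_cases hfA : (E f).1 ∈ A
  · refine IsWitness.not_crossing_aux (hs Aᶜ Bᶜ ?_ ?_ ?_ ?_) (hA.compl hc) (hB.compl hc) ?_ ?_ ?_ ?_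
    all_goals first | (rw [i5]; assumption) | (rw [i6]; assumption) | (rw [j5]; assumption) |
      (rw [j6]; assumption) | (rw [mem_compl]; tauto)
  · refine IsWitness.not_crossing_aux (hs A Bᶜ ?_ ?_ ?_ ?_) hA (hB.compl hc) ?_ ?_ ?_ ?_
    all_goals first | (rw [j1]; assumption) | (rw [i1]; assumption) | (rw [i4]; assumption) |
      (rw [j3]; assumption) | (rw [mem_compl]; tauto) | tauto
  · refine IsWitness.not_crossing_aux (hs Aᶜ B ?_ ?_ ?_ ?_) (hA.compl hc) hB ?_ ?_ ?_ ?_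
    all_goals first | (rw [j2]; assumption) | (rw [i3]; assumption) | (rw [i2]; assumption) |
      (rw [j4]; assumption) | (rw [mem_compl]; tauto) | tauto
  · exact IsWitness.not_crossing_aux (hs A B h1 h2 h3 h4) hA hB heB (by tauto) hfA (by tauto)

/-- Each edge of an inclusion-minimal cover `J` of the small sets has a small set that is crossed
by no other edge of `J`; these sets can be chosen laminar and disjoint from a given vertex. -/
theorem exists_laminar_witness (hd : SymSubmodular d)
    (hmin : ∀ e ∈ J, ∃ S, Small d k S ∧ cut E J S = {e}) (r : Fin n) :
    ∃ W : Fin m → Finset (Fin n), (∀ e ∈ J, Small d k (W e) ∧ cut E J (W e) = {e} ∧ r ∉ W e) ∧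
      ∀ e ∈ J, ∀ f ∈ J, e ≠ f → Disjoint (W e) (W f) ∨ W e ⊆ W f ∨ W f ⊆ W e := by
  classical
  -- Posimodularity of `d` need not be strict, so ties are broken by `g`. The factor `n * n + 1`
  -- exceeds every value of `g`, which makes the comparison by `D` lexicographic.
  set g : Finset (Fin n) → ℕ := fun S => S.card * Sᶜ.card with hg
  set D : Finset (Fin n) → ℕ := fun S => (n * n + 1) * d S + g S with hD
  have gle : ∀ S, g S ≤ n * n := fun S =>
    Nat.mul_le_mul ((card_le_univ S).trans (by simp)) ((card_le_univ _).trans (by simp))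
  have Dc : ∀ S, D Sᶜ = D S := fun S => by
    simp only [hD, hg, hd.compl, compl_compl, Nat.mul_comm]
  have Ds : ∀ A B, (A ∩ B).Nonempty → (A \ B).Nonempty → (B \ A).Nonempty →
      ((A ∪ B)ᶜ).Nonempty → D (A \ B) + D (B \ A) < D A + D B := by
    intro A B h1 h2 h3 h4
    have hp := hd.posimodular A B
    have hlt : g (A \ B) + g (B \ A) < g A + g B := by
      have hA : A.card = (A \ B).card + (A ∩ B).card := (card_sdiff_add_card_inter A B).symm
      have hB : B.card = (B \ A).card + (A ∩ B).card := by
        rw [inter_comm]; exact (card_sdiff_add_card_inter B A).symm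
      have hAc : Aᶜ.card = (B \ A).card + ((A ∪ B)ᶜ).card := by
        rw [← card_union_of_disjoint]
        · congr 1; ext; simp; tauto
        · rw [disjoint_left]; intro x; simp; tauto
      have hBc : Bᶜ.card = (A \ B).card + ((A ∪ B)ᶜ).card := by
        rw [← card_union_of_disjoint]
        · congr 1; ext; simp; tauto
        · rw [disjoint_left]; intro x; simp; tauto
      have hABc : (A \ B)ᶜ.card = (B \ A).card + (A ∩ B).card + ((A ∪ B)ᶜ).card := by
        rw [← hB, ← card_union_of_disjoint]
        · congr 1; ext; simp; tauto
        · rw [disjoint_left]; intro x; simp; tauto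
      have hBAc : (B \ A)ᶜ.card = (A \ B).card + (A ∩ B).card + ((A ∪ B)ᶜ).card := by
        rw [← hA, ← card_union_of_disjoint]
        · congr 1; ext; simp; tauto
        · rw [disjoint_left]; intro x; simp; tauto
      -- In terms of the four corners, the gap between the two sides is exactly twice `|A ∩ B| * |(A
      -- ∪ B)ᶜ|`.
      simp only [hg, hABc, hBAc, hAc, hBc, hA, hB]
      have := card_pos.2 h1
      have := card_pos.2 h4
      have := Nat.mul_pos (card_pos.2 h1) (card_pos.2 h4)
      nlinarith
    have := Nat.mul_le_mul_left (n * n + 1) hp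
    simp only [hD]
    linarith
  have ex : ∀ e ∈ J, ∃ W, IsWitness E J D e W ∧ Small d k W ∧ r ∉ W := by
    intro e he
    obtain ⟨S₀, hS₀, hc₀⟩ := hmin e he
    obtain ⟨W, hW, hWmin⟩ := exists_min_image (univ.filter fun S => cut E J S = {e}) D
      ⟨S₀, by simpa using hc₀⟩
    have hw : IsWitness E J D e W :=
      ⟨by simpa using hW, fun S hS => hWmin S (by simpa using hS)⟩
    -- The minimum of `D` ranges over all sets crossed by `e` alone, small or not. Comparison with
    -- the small set `S₀` gives `d W ≤ d S₀`, so every minimizer is small.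
    have main : ∀ W, IsWitness E J D e W → Small d k W := by
      intro W hw
      have hmem : e ∈ cut E J W := hw.1 ▸ mem_singleton_self e
      rw [mem_cut] at hmem
      refine ⟨?_, ?_, ?_⟩
      · rw [nonempty_iff_ne_empty]; rintro rfl; simp at hmem
      · rintro rfl; simp at hmem
      · refine lt_of_le_of_lt ?_ hS₀.2.2
        by_contra hlt
        have h1 := hw.2 S₀ hc₀
        have h2 := gle S₀
        have h3 : (n * n + 1) * (d S₀ + 1) ≤ (n * n + 1) * d W :=
          Nat.mul_le_mul_left _ (by omega)
        simp only [hD] at h1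
        nlinarith
    -- Passing to the complement makes every witness avoid `r`. Then `r` lies outside the union of
    -- any two of them, and sets that do not cross must be disjoint or nested.
    by_cases hr : r ∈ W
    · exact ⟨Wᶜ, hw.compl Dc, main _ (hw.compl Dc), by simpa using hr⟩
    · exact ⟨W, hw, main _ hw, hr⟩
  choose! W hW using ex
  refine ⟨W, fun e he => ⟨(hW e he).2.1, (hW e he).1.1, (hW e he).2.2⟩, ?_⟩
  intro e he f hf hef
  by_contra hcon
  push Not at hcon
  obtain ⟨h1, h2, h3⟩ := hcon
  rw [disjoint_iff_inter_eq_empty, ← Ne, ← nonempty_iff_ne_empty] at h1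
  refine IsWitness.not_crossing Dc Ds hef (hW e he).1 (hW f hf).1 h1 (sdiff_nonempty.2 h2)
    (sdiff_nonempty.2 h3) ⟨r, ?_⟩
  simp [(hW e he).2.2, (hW f hf).2.2]

end Witness

end NetDesign

/-! ### The charging argument: ten edge ends per core. -/

namespace NetDesign

open Finset

variable {n m : ℕ}

/-! ### Counting the edges of a minimal cover at the minimal small sets -/

/-- A laminar family of small sets `W e`, one for each `e ∈ J`, such that `e` is the only edge of
`J` that crosses `W e`; moreover each edge of `J` leaves a core. -/
structure LaminarCover (E : EdgeList n m) (J : Finset (Fin m)) (d : Finset (Fin n) → ℕ) (k : ℕ)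
    (W : Fin m → Finset (Fin n)) : Prop where
  symm : SymSubmodular d
  small : ∀ e ∈ J, Small d k (W e)
  cut_eq : ∀ e ∈ J, cut E J (W e) = {e}
  laminar : ∀ e ∈ J, ∀ f ∈ J, Disjoint (W e) (W f) ∨ W e ⊆ W f ∨ W f ⊆ W e
  leaves : ∀ e ∈ J, ∃ C ∈ cores d k, e ∈ cut E J C

/-- The maximal sets of the family strictly inside `A`. -/
def children (J : Finset (Fin m)) (W : Fin m → Finset (Fin n)) (A : Finset (Fin n)) :
    Finset (Fin m) :=
  J.filter fun f => W f ⊂ A ∧ ∀ g ∈ J, W g ⊂ A → ¬ W f ⊂ W g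

/-- The part of `A` outside the maximal sets of the family strictly inside `A`. -/
def ownPart (J : Finset (Fin m)) (W : Fin m → Finset (Fin n)) (A : Finset (Fin n)) :
    Finset (Fin n) :=
  A \ (children J W A).biUnion W

open Classical in
/-- The number of ends at `v` of edges in `J`, counted only if `v` lies in a core. -/
noncomputable def endCount (E : EdgeList n m) (J : Finset (Fin m)) (d : Finset (Fin n) → ℕ)
    (k : ℕ) (v : Fin n) : ℕ :=
  if ∃ C ∈ cores d k, v ∈ C then
    ∑ e ∈ J, ((if (E e).1 = v then 1 else 0) + (if (E e).2 = v then 1 else 0)) else 0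

/-- The number of cores inside `A`. -/
noncomputable def coreCount (d : Finset (Fin n) → ℕ) (k : ℕ) (A : Finset (Fin n)) : ℕ :=
  ((cores d k).filter fun C => C ⊆ A).card

namespace LaminarCover

variable {E : EdgeList n m} {J : Finset (Fin m)} {d : Finset (Fin n) → ℕ} {k : ℕ}
  {W : Fin m → Finset (Fin n)}

theorem injOn (h : LaminarCover E J d k W) {e f : Fin m} (he : e ∈ J) (hf : f ∈ J)
    (hef : W e = W f) : e = f := by
  have := h.cut_eq e he
  rw [hef, h.cut_eq f hf] at this
  exact (singleton_injective this).symm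

theorem mem_children {A : Finset (Fin n)} {f : Fin m} :
    f ∈ children J W A ↔ f ∈ J ∧ W f ⊂ A ∧ ∀ g ∈ J, W g ⊂ A → ¬ W f ⊂ W g := by
  simp [children]

theorem exists_child {A : Finset (Fin n)} {g : Fin m} (hg : g ∈ J) (hA : W g ⊂ A) :
    ∃ f ∈ children J W A, W g ⊆ W f := by
  obtain ⟨f, hf, hmax⟩ := exists_max_image (J.filter fun f => W f ⊂ A ∧ W g ⊆ W f)
    (fun f => (W f).card) ⟨g, by simp [hg, hA]⟩
  simp only [mem_filter] at hf hmax
  refine ⟨f, mem_children.2 ⟨hf.1, hf.2.1, fun g' hg' hA' hlt => ?_⟩, hf.2.2⟩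
  have := hmax g' ⟨hg', hA', hf.2.2.trans hlt.1⟩
  have := card_lt_card hlt
  omega

theorem children_disjoint (h : LaminarCover E J d k W) {A : Finset (Fin n)} {f g : Fin m}
    (hf : f ∈ children J W A) (hg : g ∈ children J W A) (hfg : f ≠ g) :
    Disjoint (W f) (W g) := by
  rw [mem_children] at hf hg
  have hne : W f ≠ W g := fun h' => hfg (h.injOn hf.1 hg.1 h')
  rcases h.laminar f hf.1 g hg.1 with h' | h' | h'
  · exact h'
  · exact absurd (h'.ssubset_of_ne hne) (hf.2.2 g hg.1 hg.2.1)
  · exact absurd (h'.ssubset_of_ne hne.symm) (hg.2.2 f hf.1 hf.2.1)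

theorem sum_split (h : LaminarCover E J d k W) (A : Finset (Fin n)) (g : Fin n → ℕ) :
    ∑ v ∈ A, g v = ∑ f ∈ children J W A, ∑ v ∈ W f, g v + ∑ v ∈ ownPart J W A, g v := by
  have hsub : (children J W A).biUnion W ⊆ A := by
    intro v hv
    obtain ⟨f, hf, hv⟩ := mem_biUnion.1 hv
    exact (mem_children.1 hf).2.1.1 hv
  rw [← sum_sdiff hsub, add_comm, ownPart, sum_biUnion]
  intro f hf g hg hfg
  exact h.children_disjoint hf hg hfg

theorem not_mem_child_of_mem_ownPart {A : Finset (Fin n)} {v : Fin n} (hv : v ∈ ownPart J W A)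
    {f : Fin m} (hf : f ∈ children J W A) : v ∉ W f := fun h' =>
  (mem_sdiff.1 hv).2 (mem_biUnion.2 ⟨f, hf, h'⟩)

/-- If `e` does not cross `A`, both of its ends lie in `A`; as `W e` separates them, it lies
strictly inside `A` and hence in some child `W f`. One end of `e` is outside all children and the
other is in `W e ⊆ W f`, so `e` crosses `W f`, which forces `f = e`. -/
theorem mem_of_end_mem_ownPart (h : LaminarCover E J d k W) {A : Finset (Fin n)}
    (hA : ∀ g ∈ J, Disjoint (W g) A ∨ W g ⊆ A ∨ A ⊆ W g) {e : Fin m} (he : e ∈ J)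
    (hv : (E e).1 ∈ ownPart J W A ∨ (E e).2 ∈ ownPart J W A) :
    e ∈ children J W A ∪ cut E J A := by
  rw [mem_union]
  by_contra hcon
  push Not at hcon
  obtain ⟨hc, hcut⟩ := hcon
  have hends : (E e).1 ∈ A ↔ (E e).2 ∈ A := by
    by_contra h'; exact hcut (mem_cut.2 ⟨he, h'⟩)
  have hW := (mem_cut.1 ((h.cut_eq e he).symm ▸ mem_singleton_self e)).2
  have hmem : (E e).1 ∈ A ∧ (E e).2 ∈ A := by
    rcases hv with hv | hv
    · have := (mem_sdiff.1 hv).1; tauto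
    · have := (mem_sdiff.1 hv).1; tauto
  have hss : W e ⊂ A := by
    rcases hA e he with h' | h' | h'
    · have h1 : (E e).1 ∈ W e → (E e).1 ∉ A := fun x => disjoint_left.1 h' x
      have h2 : (E e).2 ∈ W e → (E e).2 ∉ A := fun x => disjoint_left.1 h' x
      tauto
    · refine h'.ssubset_of_ne fun heq => ?_
      rw [heq] at hW; tauto
    · have h1 := @h' (E e).1
      have h2 := @h' (E e).2
      tauto
  obtain ⟨f, hf, hef⟩ := exists_child he hss
  have hfJ := (mem_children.1 hf).1
  have hcutf : e ∈ cut E J (W f) := by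
    refine mem_cut.2 ⟨he, ?_⟩
    have h1 := @hef (E e).1
    have h2 := @hef (E e).2
    rcases hv with hv | hv
    · have := not_mem_child_of_mem_ownPart hv hf
      tauto
    · have := not_mem_child_of_mem_ownPart hv hf
      tauto
  rw [h.cut_eq f hfJ, mem_singleton] at hcutf
  subst hcutf
  exact hc hf

/-- An edge has at most one end in the own part: if its witness set is a child, one end is inside
that child, and if it crosses `A`, one end is outside `A`. By `mem_of_end_mem_ownPart` there are no
other edges to count. -/
theorem sum_endCount_ownPart_le (h : LaminarCover E J d k W) {A : Finset (Fin n)}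
    (hA : ∀ g ∈ J, Disjoint (W g) A ∨ W g ⊆ A ∨ A ⊆ W g) :
    ∑ v ∈ ownPart J W A, endCount E J d k v ≤ (children J W A).card + (cut E J A).card := by
  set P := ownPart J W A with hP
  calc ∑ v ∈ P, endCount E J d k v
      ≤ ∑ v ∈ P, ∑ e ∈ J, ((if (E e).1 = v then 1 else 0) + (if (E e).2 = v then 1 else 0)) := by
        refine sum_le_sum fun v _ => ?_
        unfold endCount
        split_ifs
        · exact le_rfl
        · exact Nat.zero_le _
    _ = ∑ e ∈ J, ((if (E e).1 ∈ P then 1 else 0) + (if (E e).2 ∈ P then 1 else 0)) := by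
        rw [sum_comm]
        refine sum_congr rfl fun e _ => ?_
        rw [sum_add_distrib, sum_ite_eq, sum_ite_eq]
    _ ≤ ∑ e ∈ J, (if e ∈ children J W A ∪ cut E J A then 1 else 0) := by
        refine sum_le_sum fun e he => ?_
        have h1 := h.mem_of_end_mem_ownPart hA he
        rw [← hP] at h1
        have h2 : ¬((E e).1 ∈ P ∧ (E e).2 ∈ P) := by
          rintro ⟨p1, p2⟩
          rcases mem_union.1 (h1 (Or.inl p1)) with h' | h'
          · have hW := (mem_cut.1 ((h.cut_eq e he).symm ▸ mem_singleton_self e)).2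
            have := not_mem_child_of_mem_ownPart p1 h'
            have := not_mem_child_of_mem_ownPart p2 h'
            tauto
          · have := (mem_cut.1 h').2
            have := (mem_sdiff.1 p1).1
            have := (mem_sdiff.1 p2).1
            tauto
        by_cases p1 : (E e).1 ∈ P <;> by_cases p2 : (E e).2 ∈ P
        · exact absurd ⟨p1, p2⟩ h2
        · simp only [p1, p2, if_true, if_false, h1 (Or.inl p1)]; rfl
        · simp only [p1, p2, if_true, if_false, h1 (Or.inr p2)]; rfl
        · simp [p1, p2]
    _ ≤ (children J W A ∪ cut E J A).card := by
        rw [← card_filter]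
        exact card_le_card fun e he => (mem_filter.1 he).2
    _ ≤ _ := card_union_le _ _

theorem sum_coreCount_add_le (h : LaminarCover E J d k W) (A : Finset (Fin n)) :
    ∑ f ∈ children J W A, coreCount d k (W f) +
      ((cores d k).filter fun C => C ⊆ A ∧ ∀ f ∈ children J W A, ¬ C ⊆ W f).card ≤
      coreCount d k A := by
  unfold coreCount
  rw [← card_biUnion, ← card_union_of_disjoint]
  · refine card_le_card fun C hC => ?_
    rw [mem_union, mem_biUnion, mem_filter] at hC
    rw [mem_filter]
    rcases hC with ⟨f, hf, hC⟩ | hC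
    · rw [mem_filter] at hC
      exact ⟨hC.1, hC.2.trans (mem_children.1 hf).2.1.1⟩
    · exact ⟨hC.1, hC.2.1⟩
  · rw [disjoint_left]
    intro C hC hC'
    obtain ⟨f, hf, hC⟩ := mem_biUnion.1 hC
    exact (mem_filter.1 hC').2.2 f hf (mem_filter.1 hC).2
  · intro f hf g hg hfg
    refine disjoint_left.2 fun C hC hC' => ?_
    rw [mem_filter] at hC hC'
    obtain ⟨v, hv⟩ := core_nonempty hC.1
    exact disjoint_left.1 (h.children_disjoint hf hg hfg) (hC.2 hv) (hC'.2 hv)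

/-- A core crosses `A`. -/
def Crossed (d : Finset (Fin n) → ℕ) (k : ℕ) (A : Finset (Fin n)) : Prop :=
  ∃ C ∈ cores d k, (C ∩ A).Nonempty ∧ ¬ C ⊆ A

/-- A core that leaves `A` contains the difference of `A` and a smaller set of the family. -/
def Threaded (J : Finset (Fin m)) (W : Fin m → Finset (Fin n)) (d : Finset (Fin n) → ℕ) (k : ℕ)
    (A : Finset (Fin n)) : Prop :=
  ∃ C ∈ cores d k, ¬ C ⊆ A ∧ ∃ f ∈ J, W f ⊂ A ∧ A \ W f ⊆ C

/-- If the core `C` contains the difference of the nested sets `W e ⊂ A`, where the edge `e`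
does not leave `A`, and crosses `W e`, then `W e` is not threaded. -/
theorem not_threaded (h : LaminarCover E J d k W) {A C : Finset (Fin n)} {e : Fin m}
    (he : e ∈ J) (hcut : e ∉ cut E J A) (hss : W e ⊂ A) (hC : C ∈ cores d k)
    (hAC : A \ W e ⊆ C) (hne : (C ∩ W e).Nonempty) (hnC : ¬ C ⊆ W e) :
    ¬ Threaded J W d k (W e) := by
  rintro ⟨C₁, hC₁, hC₁e, f, hf, hfe, hfC₁⟩
  have hends : (E e).1 ∈ A ↔ (E e).2 ∈ A := by
    by_contra h'; exact hcut (mem_cut.2 ⟨he, h'⟩)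
  have hecut := (mem_cut.1 ((h.cut_eq e he).symm ▸ mem_singleton_self e)).2
  have hfends : (E e).1 ∈ W f ↔ (E e).2 ∈ W f := by
    by_contra h'
    have : e ∈ cut E J (W f) := mem_cut.2 ⟨he, h'⟩
    rw [h.cut_eq f hf, mem_singleton] at this
    subst this
    exact hfe.2 subset_rfl
  -- The edge `e` crosses `W e` but neither `A` nor `W f`, so its ends lie in the two consecutive
  -- differences `W e \ W f` and `A \ W e`, and therefore in the cores `C₁` and `C`.
  obtain ⟨a, b, ha, hb, hab⟩ : ∃ a b, a ∈ W e \ W f ∧ b ∈ A \ W e ∧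
      ((E e = (a, b)) ∨ (E e = (b, a))) := by
    by_cases h1 : (E e).1 ∈ W e
    · have h2 : (E e).2 ∉ W e := fun h2 => hecut ⟨fun _ => h2, fun _ => h1⟩
      exact ⟨(E e).1, (E e).2, mem_sdiff.2 ⟨h1, fun h3 => h2 (hfe.1 (hfends.1 h3))⟩,
        mem_sdiff.2 ⟨hends.1 (hss.1 h1), h2⟩, Or.inl rfl⟩
    · have h2 : (E e).2 ∈ W e := by
        by_contra h2; exact hecut ⟨fun h => absurd h h1, fun h => absurd h h2⟩
      exact ⟨(E e).2, (E e).1, mem_sdiff.2 ⟨h2, fun h3 => h1 (hfe.1 (hfends.2 h3))⟩,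
        mem_sdiff.2 ⟨hends.2 (hss.1 h2), h1⟩, Or.inr rfl⟩
  have haC₁ := hfC₁ ha
  have hbC := hAC hb
  -- If one core contains both ends of `e`, then by disjointness `e` leaves no core at all, against
  -- `leaves`.
  by_cases hCC : C = C₁
  · subst hCC
    obtain ⟨C', hC', heC'⟩ := h.leaves e he
    rw [mem_cut] at heC'
    have : (E e).1 ∈ C ∧ (E e).2 ∈ C := by
      rcases hab with hab | hab <;> rw [hab] <;> exact ⟨by assumption, by assumption⟩
    by_cases hcc : C = C'
    · subst hcc; tauto
    · have h1 := disjoint_left.1 (cores_disjoint h.symm hC hC' hcc) this.1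
      have h2 := disjoint_left.1 (cores_disjoint h.symm hC hC' hcc) this.2
      tauto
  -- Disjoint from `C₁ ⊇ W e \ W f`, the core `C` can meet `W e` only inside `W f`. So the rest of
  -- `W e` outside `W f` and `C`, which contains `a`, is small; a core in it lies inside `C₁`, hence
  -- equals `C₁`, which would then be contained in `W e`.
  · have hdis := cores_disjoint h.symm hC hC₁ hCC
    have hanC : a ∉ C := fun h' => disjoint_left.1 hdis h' haC₁
    obtain ⟨v, hv⟩ := hne
    rw [mem_inter] at hv
    have hvf : v ∈ W f := by
      by_contra h'
      exact disjoint_left.1 hdis hv.1 (hfC₁ (mem_sdiff.2 ⟨hv.2, h'⟩))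
    have hsm := small_sdiff_of_core h.symm hC (h.small f hf) (h.small e he) hfe.1
      ⟨v, mem_inter.2 ⟨hvf, hv.1⟩⟩ hnC ⟨a, mem_sdiff.2 ⟨(mem_sdiff.1 ha).1, fun h' =>
        (mem_union.1 h').elim (mem_sdiff.1 ha).2 hanC⟩⟩
    obtain ⟨C₂, hC₂, hsub⟩ := hsm.exists_core
    have hC₂W : C₂ ⊆ W e \ W f := hsub.trans (sdiff_subset_sdiff subset_rfl subset_union_left)
    have := core_eq_of_subset hC₂ hC₁ (hC₂W.trans hfC₁)
    subst this
    exact hC₁e (hC₂W.trans sdiff_subset)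

/-- Each core inside `W e` supplies ten units and each counted edge end consumes one; the three
clauses state the surplus. It is always at least `5`, at least `7` if the set is not threaded, and
at least `9` if no core crosses it. The own part of a set with `p` children consumes at most `p +
1`, one for each child edge and one for `e`. The weakest surplus `5` arises only for a single
crossed child, and then that child is not threaded and brings `7`, so losses do not accumulate along
chains. -/
theorem count_step (h : LaminarCover E J d k W) : ∀ (N : ℕ) (e : Fin m), e ∈ J → (W e).card = N →
    (¬ Crossed d k (W e) → ∑ v ∈ W e, endCount E J d k v + 9 ≤ 10 * coreCount d k (W e)) ∧
    ∑ v ∈ W e, endCount E J d k v + 5 ≤ 10 * coreCount d k (W e) ∧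
    (¬ Threaded J W d k (W e) →
      ∑ v ∈ W e, endCount E J d k v + 7 ≤ 10 * coreCount d k (W e)) := by
  intro N
  induction N using Nat.strong_induction_on with
  | _ N ih =>
  intro e he hN
  set A := W e with hAdef
  set ch := children J W A with hch
  set g := endCount E J d k with hg
  have ihc : ∀ f ∈ ch, (¬ Crossed d k (W f) → ∑ v ∈ W f, g v + 9 ≤ 10 * coreCount d k (W f)) ∧
      ∑ v ∈ W f, g v + 5 ≤ 10 * coreCount d k (W f) ∧
      (¬ Threaded J W d k (W f) → ∑ v ∈ W f, g v + 7 ≤ 10 * coreCount d k (W f)) := by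
    intro f hf
    have hf' := mem_children.1 hf
    exact ih _ (hN ▸ card_lt_card hf'.2.1) f hf'.1 rfl
  have hsplit := h.sum_split A g
  have hown := h.sum_endCount_ownPart_le (A := A) (fun g hg => h.laminar g hg e he)
  rw [h.cut_eq e he, card_singleton] at hown
  change ∑ v ∈ ownPart J W A, g v ≤ _ at hown
  have hcc := h.sum_coreCount_add_le A
  rw [← hch] at hsplit hown hcc
  have h5 : ∑ f ∈ ch, (∑ v ∈ W f, g v + 5) ≤ ∑ f ∈ ch, 10 * coreCount d k (W f) :=
    sum_le_sum fun f hf => (ihc f hf).2.1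
  rw [sum_add_distrib, ← mul_sum, sum_const, smul_eq_mul] at h5
  -- A core inside no child brings ten new units. With surplus `5` at each of `p` children, `5 * p +
  -- 10 - (p + 1)` is at least `9`.
  by_cases hex : ∃ C ∈ cores d k, C ⊆ A ∧ ∀ f ∈ ch, ¬ C ⊆ W f
  · obtain ⟨C, hC, hCA, hCf⟩ := hex
    have : 0 < ((cores d k).filter fun C => C ⊆ A ∧ ∀ f ∈ ch, ¬ C ⊆ W f).card :=
      card_pos.2 ⟨C, by simp only [mem_filter]; exact ⟨hC, hCA, hCf⟩⟩
    refine ⟨fun _ => ?_, ?_, fun _ => ?_⟩ <;> omega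
  push Not at hex
  obtain ⟨C₀, hC₀, hC₀A⟩ := (h.small e he).exists_core
  obtain ⟨f₀, hf₀, hC₀f₀⟩ := hex C₀ hC₀ hC₀A
  have hpos : 0 < ch.card := card_pos.2 ⟨f₀, hf₀⟩
  -- From here on every core inside `A` lies in one child. Children are disjoint, so a core that
  -- crosses a child also leaves `A`.
  have hcr : ∀ f ∈ ch, ∀ C ∈ cores d k, (C ∩ W f).Nonempty → ¬ C ⊆ W f → ¬ C ⊆ A := by
    intro f hf C hC hne hnC hCA
    obtain ⟨f', hf', hCf'⟩ := hex C hC hCA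
    by_cases hff : f = f'
    · subst hff; exact hnC hCf'
    · obtain ⟨v, hv⟩ := hne
      rw [mem_inter] at hv
      exact disjoint_left.1 (h.children_disjoint hf hf' hff) hv.2 (hCf' hv.1)
  have hmeet : ∀ f ∈ ch, ∀ C : Finset (Fin n), (C ∩ W f).Nonempty → (C ∩ A).Nonempty :=
    fun f hf C hne => hne.mono (inter_subset_inter_left (mem_children.1 hf).2.1.1)
  by_cases hcross : Crossed d k A
  -- With at least two children the surplus `5 * p - (p + 1)` is at least `7`.
  · by_cases h2 : 2 ≤ ch.card
    · refine ⟨fun h' => absurd hcross h', ?_, fun _ => ?_⟩ <;> omega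
    · have hcard : ch.card = 1 := by omega
      obtain ⟨f, hf⟩ := card_eq_one.1 hcard
      have hfc : f ∈ ch := by rw [hf]; exact mem_singleton_self f
      have hf' := mem_children.1 hfc
      rw [hf, sum_singleton] at hsplit hcc
      by_cases hcf : Crossed d k (W f)
      · obtain ⟨C, hC, hne, hnC⟩ := hcf
        have hCA := hcr f hfc C hC hne hnC
        -- Otherwise the part of `A` outside `W f ∪ C` would be small and contain a core, which
        -- would have to lie in the only child `W f`.
        have hsub : A \ W f ⊆ C := by
          by_contra hns
          obtain ⟨x, hx, hxC⟩ := not_subset.1 hns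
          have hsm := small_sdiff_of_core h.symm hC (h.small f hf'.1) (h.small e he) hf'.2.1.1
            (by rwa [inter_comm]) hCA ⟨x, by
              rw [mem_sdiff] at hx
              simp only [mem_sdiff, mem_union]; tauto⟩
          obtain ⟨C₂, hC₂, hs⟩ := hsm.exists_core
          obtain ⟨f', hf'', hC₂f⟩ := hex C₂ hC₂ (hs.trans sdiff_subset)
          rw [hf, mem_singleton] at hf''
          subst hf''
          obtain ⟨y, hy⟩ := core_nonempty hC₂
          have := hs hy
          simp only [mem_sdiff, mem_union] at this
          exact this.2 (Or.inl (hC₂f hy))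
        have hT : Threaded J W d k A := ⟨C, hC, hCA, f, hf'.1, hf'.2.1, hsub⟩
        have hnT : ¬ Threaded J W d k (W f) := by
          refine h.not_threaded hf'.1 (fun hc => ?_) hf'.2.1 hC hsub hne hnC
          rw [h.cut_eq e he, mem_singleton] at hc
          subst hc
          exact hf'.2.1.2 subset_rfl
        -- Surplus `7` of the child minus the two ends consumed leaves `5`, which suffices because
        -- `A` is threaded.
        have := (ihc f hfc).2.2 hnT
        refine ⟨fun h' => absurd hcross h', by omega, fun h' => absurd hT h'⟩
      -- An uncrossed only child has surplus `9`, and `9 - 2 = 7`.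
      · have := (ihc f hfc).1 hcf
        refine ⟨fun h' => absurd hcross h', ?_, fun _ => ?_⟩ <;> omega
  -- If no core crosses `A`, a core meeting the own part would lie in `A` and hence in a child. So
  -- nothing is consumed here, and the uncrossed children pass on at least `9`.
  · have hzero : ∑ v ∈ ownPart J W A, g v = 0 := by
      refine sum_eq_zero fun v hv => ?_
      rw [hg, endCount, if_neg]
      rintro ⟨C, hC, hvC⟩
      have hvA := (mem_sdiff.1 hv).1
      have hCA : C ⊆ A := by
        by_contra h'
        exact hcross ⟨C, hC, ⟨v, mem_inter.2 ⟨hvC, hvA⟩⟩, h'⟩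
      obtain ⟨f, hf, hCf⟩ := hex C hC hCA
      exact not_mem_child_of_mem_ownPart hv hf (hCf hvC)
    have h9 : ∑ f ∈ ch, (∑ v ∈ W f, g v + 9) ≤ ∑ f ∈ ch, 10 * coreCount d k (W f) := by
      refine sum_le_sum fun f hf => (ihc f hf).1 ?_
      rintro ⟨C, hC, hne, hnC⟩
      exact hcross ⟨C, hC, hmeet f hf C hne, hcr f hf C hC hne hnC⟩
    rw [sum_add_distrib, ← mul_sum, sum_const, smul_eq_mul] at h9
    refine ⟨fun _ => ?_, ?_, fun _ => ?_⟩ <;> omega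

/-- At the top level no edge crosses the whole vertex set, so the ends outside the maximal sets are
at most as many as these sets, each of which has surplus at least `5`. -/
theorem sum_endCount_le (h : LaminarCover E J d k W) :
    ∑ v, endCount E J d k v ≤ 10 * (cores d k).card := by
  have hsplit := h.sum_split univ (endCount E J d k)
  have hown := h.sum_endCount_ownPart_le (A := univ) (fun g _ => Or.inr (Or.inl (subset_univ _)))
  have hcut : cut E J univ = ∅ := by ext; simp [mem_cut]
  rw [hcut, card_empty] at hown
  have hcc := h.sum_coreCount_add_le univ
  have h5 : ∑ f ∈ children J W univ, (∑ v ∈ W f, endCount E J d k v + 5) ≤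
      ∑ f ∈ children J W univ, 10 * coreCount d k (W f) :=
    sum_le_sum fun f hf => (h.count_step _ f (mem_children.1 hf).1 rfl).2.1
  rw [sum_add_distrib, ← mul_sum, sum_const, smul_eq_mul] at h5
  have huniv : coreCount d k univ = (cores d k).card := by simp [coreCount]
  omega

end LaminarCover

theorem sum_card_cut_le_endCount {E : EdgeList n m} {J : Finset (Fin m)}
    {d : Finset (Fin n) → ℕ} {k : ℕ} (hd : SymSubmodular d) :
    ∑ C ∈ cores d k, (cut E J C).card ≤ ∑ v, endCount E J d k v := by
  calc ∑ C ∈ cores d k, (cut E J C).card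
      ≤ ∑ C ∈ cores d k, ∑ v ∈ C, endCount E J d k v := by
        refine sum_le_sum fun C hC => ?_
        have : ∑ v ∈ C, endCount E J d k v = ∑ v ∈ C, ∑ e ∈ J,
            ((if (E e).1 = v then 1 else 0) + (if (E e).2 = v then 1 else 0)) :=
          sum_congr rfl fun v hv => by rw [endCount, if_pos ⟨C, hC, hv⟩]
        rw [this, sum_comm, cut, card_filter]
        refine sum_le_sum fun e _ => ?_
        rw [sum_add_distrib, sum_ite_eq, sum_ite_eq]
        by_cases h1 : (E e).1 ∈ C <;> by_cases h2 : (E e).2 ∈ C <;> simp [h1, h2]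
    _ = ∑ v ∈ (cores d k).biUnion id, endCount E J d k v := by
        rw [sum_biUnion]
        · rfl
        · intro A hA B hB hAB
          exact cores_disjoint hd hA hB hAB
    _ ≤ _ := sum_le_sum_of_subset (subset_univ _)

/-- In an inclusion-minimal cover of the small sets, a core is left by at most ten
edges on average. -/
theorem sum_card_cut_cores_le {E : EdgeList n m} {J : Finset (Fin m)} {d : Finset (Fin n) → ℕ}
    {k : ℕ} (hd : SymSubmodular d)
    (hmin : ∀ e ∈ J, ∃ S, Small d k S ∧ cut E J S = {e}) :
    ∑ C ∈ cores d k, (cut E J C).card ≤ 10 * (cores d k).card := by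
  classical
  rcases isEmpty_or_nonempty (Fin n) with hn | ⟨⟨r⟩⟩
  · have : cores d k = ∅ := by
      refine eq_empty_of_forall_notMem fun C hC => ?_
      obtain ⟨v, -⟩ := core_nonempty hC
      exact hn.elim v
    simp [this]
  obtain ⟨W, hW, hlam⟩ := exists_laminar_witness hd hmin r
  -- Edges that leave no core do not contribute to the sum. Discarding them together with their
  -- witness sets keeps the remaining sets laminar and crossed by one edge only, and secures
  -- `leaves`.
  set J' := J.filter fun e => ∃ C ∈ cores d k, e ∈ cut E J C with hJ'
  have hsub : J' ⊆ J := filter_subset _ _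
  have hL : LaminarCover E J' d k W := by
    refine ⟨hd, fun e he => (hW e (hsub he)).1, fun e he => ?_, fun e he f hf => ?_, fun e he => ?_⟩
    · have := (hW e (hsub he)).2.1
      ext g
      have hg : g ∈ cut E J (W e) ↔ g = e := by rw [this, mem_singleton]
      rw [mem_cut] at hg ⊢
      rw [mem_singleton]
      constructor
      · intro h'; exact hg.1 ⟨hsub h'.1, h'.2⟩
      · rintro rfl; exact ⟨he, (hg.2 rfl).2⟩
    · by_cases hef : e = f
      · subst hef; exact Or.inr (Or.inl subset_rfl)
      · exact hlam e (hsub he) f (hsub hf) hef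
    · obtain ⟨-, C, hC, hc⟩ := mem_filter.1 he
      exact ⟨C, hC, mem_cut.2 ⟨he, (mem_cut.1 hc).2⟩⟩
  have heq : ∀ C ∈ cores d k, cut E J C = cut E J' C := by
    intro C hC
    ext e
    constructor
    · intro he
      exact mem_cut.2 ⟨mem_filter.2 ⟨(mem_cut.1 he).1, C, hC, he⟩, (mem_cut.1 he).2⟩
    · intro he
      exact mem_cut.2 ⟨hsub (mem_cut.1 he).1, (mem_cut.1 he).2⟩
  rw [sum_congr rfl fun C hC => by rw [heq C hC]]
  exact (sum_card_cut_le_endCount hd).trans hL.sum_endCount_le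

end NetDesign

/-! ### Primal-dual analysis, flat pairs, and the correctness of labelling the cores. -/

namespace NetDesign

open Finset

variable {n m : ℕ}

/-! ### Residual families -/

/-- The total weight of the edges that cross `S`. -/
def cutWeight (E : EdgeList n m) (w : Fin m → ℕ) (S : Finset (Fin n)) : ℕ :=
  ∑ e ∈ cut E univ S, w e

theorem cutWeight_eq_sum (E : EdgeList n m) (w : Fin m → ℕ) (S : Finset (Fin n)) :
    cutWeight E w S = ∑ e, if ((E e).1 ∈ S ↔ (E e).2 ∈ S) then 0 else w e := by
  rw [cutWeight, cut, sum_filter]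
  refine sum_congr rfl fun e _ => ?_
  by_cases h : (E e).1 ∈ S ↔ (E e).2 ∈ S <;> simp [h]

theorem symSubmodular_cutWeight (E : EdgeList n m) (w : Fin m → ℕ) :
    SymSubmodular (cutWeight E w) := by
  refine ⟨fun S => by rw [cutWeight, cut_compl, cutWeight], fun A B => ?_⟩
  simp only [cutWeight_eq_sum, ← sum_add_distrib]
  refine sum_le_sum fun e _ => ?_
  simp only [mem_inter, mem_union]
  by_cases h1 : (E e).1 ∈ A <;> by_cases h2 : (E e).2 ∈ A <;> by_cases h3 : (E e).1 ∈ B <;>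
    by_cases h4 : (E e).2 ∈ B <;> simp [h1, h2, h3, h4]

theorem card_cut_eq_cutWeight (E : EdgeList n m) (J : Finset (Fin m)) (S : Finset (Fin n)) :
    (cut E J S).card = cutWeight E (fun e => if e ∈ J then 1 else 0) S := by
  rw [cutWeight, ← card_filter]
  congr 1
  ext e; simp only [mem_filter, mem_cut, mem_univ, true_and]; tauto

/-- The set function whose small sets are the small sets of `d` that `J` does not cover. -/
def residual (d : Finset (Fin n) → ℕ) (k : ℕ) (E : EdgeList n m) (J : Finset (Fin m))
    (S : Finset (Fin n)) : ℕ :=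
  d S + k * (cut E J S).card

theorem SymSubmodular.residual {d : Finset (Fin n) → ℕ} (hd : SymSubmodular d) (k : ℕ)
    (E : EdgeList n m) (J : Finset (Fin m)) : SymSubmodular (residual d k E J) := by
  refine ⟨fun S => by simp only [NetDesign.residual, hd.compl, cut_compl], fun A B => ?_⟩
  have h1 := hd.submod A B
  have h2 := (symSubmodular_cutWeight E (fun e => if e ∈ J then 1 else 0)).submod A B
  simp only [← card_cut_eq_cutWeight] at h2
  have := Nat.mul_le_mul_left k h2
  simp only [NetDesign.residual]
  linarith

section Residual

variable {d : Finset (Fin n) → ℕ} {k : ℕ} {E : EdgeList n m} {J J' : Finset (Fin m)}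
  {S : Finset (Fin n)}

theorem small_residual : Small (residual d k E J) k S ↔ Small d k S ∧ cut E J S = ∅ := by
  unfold Small residual
  constructor
  · rintro ⟨h1, h2, h3⟩
    have hz : (cut E J S).card = 0 := by
      by_contra h
      have : k * 1 ≤ k * (cut E J S).card := Nat.mul_le_mul_left k (by omega)
      omega
    exact ⟨⟨h1, h2, by omega⟩, card_eq_zero.1 hz⟩
  · rintro ⟨⟨h1, h2, h3⟩, h4⟩
    exact ⟨h1, h2, by simpa [h4] using h3⟩

theorem cut_mono (h : J ⊆ J') : cut E J S ⊆ cut E J' S := fun _ he =>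
  mem_cut.2 ⟨h (mem_cut.1 he).1, (mem_cut.1 he).2⟩

theorem Covers.mono {F : Set (Finset (Fin n))} (hJ : Covers E J F) (h : J ⊆ J') :
    Covers E J' F := fun S hS => (hJ S hS).trans (card_le_card (cut_mono h))

theorem cores_residual_eq_empty_iff :
    cores (residual d k E J) k = ∅ ↔ Covers E J {S | Small d k S} := by
  rw [covers_iff]
  constructor
  · intro h S hS
    by_contra hne
    rw [not_nonempty_iff_eq_empty] at hne
    obtain ⟨C, hC, -⟩ := (small_residual.2 ⟨hS, hne⟩).exists_core
    simp [h] at hC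
  · intro h
    refine eq_empty_of_forall_notMem fun C hC => ?_
    have := small_residual.1 (mem_cores.1 hC).1
    have h' := h C this.1
    simp [this.2] at h'

/-! ### Primal-dual selection with reverse deletion -/

/-- The number of minimal uncovered small sets that `g` leaves. -/
noncomputable def crossCount (d : Finset (Fin n) → ℕ) (k : ℕ) (E : EdgeList n m)
    (J : Finset (Fin m)) (g : Fin m) : ℕ :=
  ((cores (residual d k E J) k).filter fun C => g ∈ cut E univ C).card

theorem sum_crossCount (K : Finset (Fin m)) :
    ∑ g ∈ K, crossCount d k E J g = ∑ C ∈ cores (residual d k E J) k, (cut E K C).card := by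
  simp only [crossCount, card_filter]
  rw [sum_comm]
  refine sum_congr rfl fun C _ => ?_
  rw [← card_filter]
  congr 1
  ext e; simp only [mem_filter, mem_cut, mem_univ, true_and]

/-- The local ratio inequality. For the costs `crossCount`, a minimal cover of the residual family
costs at most ten per core, and any cover costs at least one per core. -/
theorem sum_crossCount_le (hd : SymSubmodular d) {K Jst : Finset (Fin m)}
    (hmin : ∀ e ∈ K, ∃ S, Small (residual d k E J) k S ∧ cut E K S = {e})
    (hst : Covers E Jst {S | Small d k S}) :
    ∑ g ∈ K, crossCount d k E J g ≤ 10 * ∑ g ∈ Jst, crossCount d k E J g := by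
  rw [sum_crossCount, sum_crossCount]
  refine (sum_card_cut_cores_le (hd.residual k E J) hmin).trans (Nat.mul_le_mul_left _ ?_)
  rw [card_eq_sum_ones]
  exact sum_le_sum fun C hC => hst C (small_residual.1 (mem_cores.1 hC).1).1

/-- One step of the selection: either no edge leaves a minimal uncovered set and nothing happens, or
an edge is selected whose reduced cost becomes `0`. -/
def SelectStep (d : Finset (Fin n) → ℕ) (k : ℕ) (E : EdgeList n m) (J J' : Finset (Fin m))
    (c c' : Fin m → ℕ) : Option (Fin m) → Prop
  | none => J' = J ∧ ∀ g, crossCount d k E J g = 0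
  | some e => J' = insert e J ∧ 0 < crossCount d k E J e ∧ c' e = 0 ∧
      ∃ ε, ∀ g, c' g + ε * crossCount d k E J g = 2 * c g

/-- One step of the deletion: a selected edge is removed if the rest is still a cover. -/
def DeleteStep (d : Finset (Fin n) → ℕ) (k : ℕ) (E : EdgeList n m) (K K' : Finset (Fin m)) :
    Option (Fin m) → Prop
  | none => K' = K
  | some e => (Covers E (K.erase e) {S | Small d k S} ∧ K' = K.erase e) ∨
      (¬ Covers E (K.erase e) {S | Small d k S} ∧ K' = K)

theorem not_mem_of_crossCount_pos {e : Fin m} (h : 0 < crossCount d k E J e) : e ∉ J := by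
  intro he
  obtain ⟨C, hC⟩ := card_pos.1 h
  rw [mem_filter] at hC
  have := (small_residual.1 (mem_cores.1 hC.1).1).2
  have h' : e ∈ cut E J C := mem_cut.2 ⟨he, (mem_cut.1 hC.2).2⟩
  simp [this] at h'

/-- The step of a backward induction, from the state after buying `e` to the state before. As `e`
has reduced cost `0`, the cost bound for `c₁` survives whether `e` is kept or not. Adding `ε` times
the inequality `sum_crossCount_le` gives the bound for `2 * c`; it applies because `K \ J` remains
minimal for the residual family of `J`. -/
theorem reverse_delete_step (hd : SymSubmodular d) {J₁ K K₁ : Finset (Fin m)} {c c₁ : Fin m → ℕ}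
    {o : Option (Fin m)} (hsel : SelectStep d k E J J₁ c c₁ o)
    (hdel : DeleteStep d k E K₁ K o) (hJK : J₁ ⊆ K₁) (hcov : Covers E K₁ {S | Small d k S})
    (hmin : ∀ e ∈ K₁ \ J₁, ∃ S, Small (residual d k E J₁) k S ∧ cut E (K₁ \ J₁) S = {e})
    (hcost : ∀ Jst, Covers E Jst {S | Small d k S} →
      ∑ e ∈ K₁ \ J₁, c₁ e ≤ 10 * ∑ e ∈ Jst, c₁ e) (hno : o ≠ none) :
    J ⊆ K ∧ Covers E K {S | Small d k S} ∧
    (∀ e ∈ K \ J, ∃ S, Small (residual d k E J) k S ∧ cut E (K \ J) S = {e}) ∧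
    ∀ Jst, Covers E Jst {S | Small d k S} → ∑ e ∈ K \ J, c e ≤ 10 * ∑ e ∈ Jst, c e := by
  obtain ⟨e, rfl⟩ := Option.ne_none_iff_exists'.1 hno
  obtain ⟨rfl, hpos, hzero, ε, hε⟩ := hsel
  have heJ := not_mem_of_crossCount_pos hpos
  have heK₁ : e ∈ K₁ := hJK (mem_insert_self _ _)
  have hJK₁ : J ⊆ K₁.erase e := fun x hx =>
    mem_erase.2 ⟨fun h => heJ (h ▸ hx), hJK (mem_insert_of_mem hx)⟩
  have hmono : ∀ {S}, Small (residual d k E (insert e J)) k S →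
      Small (residual d k E J) k S ∧ e ∉ cut E univ S := by
    intro S hS
    obtain ⟨h1, h2⟩ := small_residual.1 hS
    refine ⟨small_residual.2 ⟨h1, ?_⟩, fun h => ?_⟩
    · exact subset_empty.1 (h2 ▸ cut_mono (subset_insert _ _))
    · have : e ∈ cut E (insert e J) S := mem_cut.2 ⟨mem_insert_self _ _, (mem_cut.1 h).2⟩
      simp [h2] at this
  have structural : J ⊆ K ∧ Covers E K {S | Small d k S} ∧
      (∀ e ∈ K \ J, ∃ S, Small (residual d k E J) k S ∧ cut E (K \ J) S = {e}) ∧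
      ∑ g ∈ K \ J, c₁ g = ∑ g ∈ K₁ \ insert e J, c₁ g := by
    rcases hdel with ⟨hc, rfl⟩ | ⟨hc, rfl⟩
    · have heq : K₁.erase e \ J = K₁ \ insert e J := by
        ext x; simp only [mem_sdiff, mem_erase, mem_insert]; tauto
      rw [heq]
      refine ⟨hJK₁, hc, fun f hf => ?_, rfl⟩
      obtain ⟨S, hS, hcut⟩ := hmin f hf
      exact ⟨S, (hmono hS).1, hcut⟩
    · have heq : K \ J = insert e (K \ insert e J) := by
        ext x; simp only [mem_sdiff, mem_insert]
        by_cases hx : x = e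
        · subst hx; tauto
        · tauto
      refine ⟨(subset_insert _ _).trans hJK, hcov, fun f hf => ?_, ?_⟩
      · rw [heq, mem_insert] at hf
        by_cases hfe : f = e
        -- The deletion of `f` failed, so some small set is uncovered by `K` without `f`. In `K` it
        -- is crossed by `f` alone, and it is uncovered by `J` because `J ⊆ K.erase f`.
        · subst hfe
          rw [covers_iff] at hc
          push Not at hc
          obtain ⟨S, hS, hemp⟩ := hc
          refine ⟨S, small_residual.2 ⟨hS, subset_empty.1 (hemp ▸ cut_mono hJK₁)⟩, ?_⟩
          obtain ⟨g, hg⟩ := covers_iff.1 hcov S hS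
          have hall : ∀ g ∈ cut E K S, g = f := by
            intro g hg
            by_contra hgf
            have : g ∈ cut E (K.erase f) S :=
              mem_cut.2 ⟨mem_erase.2 ⟨hgf, (mem_cut.1 hg).1⟩, (mem_cut.1 hg).2⟩
            simp [hemp] at this
          have hfc : f ∈ cut E K S := (hall g hg) ▸ hg
          ext x
          rw [mem_singleton]
          constructor
          · intro hx
            exact hall x (cut_mono sdiff_subset hx)
          · rintro rfl
            exact mem_cut.2 ⟨mem_sdiff.2 ⟨heK₁, heJ⟩, (mem_cut.1 hfc).2⟩
        -- The old witness of `f` is uncovered by `insert e J`, hence not crossed by `e`; putting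
        -- `e` back does not spoil it.
        · obtain ⟨S, hS, hcut⟩ := hmin f (hf.resolve_left hfe)
          refine ⟨S, (hmono hS).1, ?_⟩
          rw [← hcut, heq]
          refine Subset.antisymm (fun x hx => ?_) (cut_mono (subset_insert _ _))
          rw [mem_cut, mem_insert] at hx
          refine mem_cut.2 ⟨hx.1.resolve_left ?_, hx.2⟩
          rintro rfl
          exact (hmono hS).2 (mem_cut.2 ⟨mem_univ _, hx.2⟩)
      · rw [heq, sum_insert (by simp), hzero, zero_add]
  obtain ⟨h1, h2, h3, h4⟩ := structural
  refine ⟨h1, h2, h3, fun Jst hst => ?_⟩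
  have hs : ∀ X : Finset (Fin m),
      ∑ g ∈ X, c₁ g + ε * ∑ g ∈ X, crossCount d k E J g = 2 * ∑ g ∈ X, c g := by
    intro X
    rw [mul_sum, mul_sum, ← sum_add_distrib]
    exact sum_congr rfl fun g _ => hε g
  have e1 := hs (K \ J)
  have e2 := hs Jst
  have e3 := hcost Jst hst
  have e4 := Nat.mul_le_mul_left ε (sum_crossCount_le hd h3 hst)
  rw [h4] at e1
  linarith

/-- The set obtained by primal-dual selection and reverse deletion is a cover of cost at most ten times
that of any cover. -/
theorem primal_dual (hd : SymSubmodular d) {Js Ks : ℕ → Finset (Fin m)} {c : ℕ → Fin m → ℕ}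
    {o : ℕ → Option (Fin m)} (h0 : Js 0 = ∅)
    (hsel : ∀ i < m, SelectStep d k E (Js i) (Js (i + 1)) (c i) (c (i + 1)) (o i))
    (hm : Ks m = Js m) (hdel : ∀ i < m, DeleteStep d k E (Ks (i + 1)) (Ks i) (o i))
    (hfeas : Covers E univ {S | Small d k S}) :
    Covers E (Ks 0) {S | Small d k S} ∧ ∀ Jst, Covers E Jst {S | Small d k S} →
      ∑ e ∈ Ks 0, c 0 e ≤ 10 * ∑ e ∈ Jst, c 0 e := by
  -- All edges together form a cover, so every core is left by some edge. If none leaves a core,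
  -- there are no cores and the selection is a cover.
  have hnone : ∀ i < m, o i = none → Covers E (Js i) {S | Small d k S} := by
    intro i hi ho
    have hs := hsel i hi
    rw [ho] at hs
    rw [← cores_residual_eq_empty_iff]
    refine eq_empty_of_forall_notMem fun C hC => ?_
    obtain ⟨g, hg⟩ := covers_iff.1 hfeas C (small_residual.1 (mem_cores.1 hC).1).1
    have h1 := hs.2 g
    rw [crossCount, card_eq_zero] at h1
    have : C ∈ (cores (residual d k E (Js i)) k).filter fun C => g ∈ cut E univ C :=
      mem_filter.2 ⟨hC, hg⟩
    simp [h1] at this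
  -- Each step short of a cover buys a new edge, so after `m` steps there is a cover or all edges
  -- have been bought.
  have hprog : ∀ i ≤ m, Covers E (Js i) {S | Small d k S} ∨ (Js i).card = i := by
    intro i
    induction i with
    | zero => intro _; right; simp [h0]
    | succ i ih =>
      intro hi
      have hs := hsel i hi
      cases ho : o i with
      | none =>
        rw [ho] at hs
        rw [hs.1]
        exact Or.inl (hnone i hi ho)
      | some e =>
        rw [ho] at hs
        obtain ⟨hJ, hpos, -⟩ := hs
        rw [hJ]
        rcases ih (by omega) with h | h
        · exact Or.inl (h.mono (subset_insert _ _))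
        · right
          rw [card_insert_of_notMem (not_mem_of_crossCount_pos hpos), h]
  have hJm : Covers E (Js m) {S | Small d k S} := by
    rcases hprog m le_rfl with h | h
    · exact h
    · have : Js m = univ := by rw [← card_eq_iff_eq_univ, h, Fintype.card_fin]
      rwa [this]
  -- Backward induction on `i`, with `j = m - i`. It starts from `Ks m \ Js m = ∅` and ends with `Ks
  -- 0 \ Js 0 = Ks 0`.
  have main : ∀ j ≤ m, ∀ i, i + j = m → Js i ⊆ Ks i ∧ Covers E (Ks i) {S | Small d k S} ∧
      (∀ e ∈ Ks i \ Js i, ∃ S, Small (residual d k E (Js i)) k S ∧ cut E (Ks i \ Js i) S = {e}) ∧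
      ∀ Jst, Covers E Jst {S | Small d k S} →
        ∑ e ∈ Ks i \ Js i, c i e ≤ 10 * ∑ e ∈ Jst, c i e := by
    intro j
    induction j with
    | zero =>
      rintro - i hi
      obtain rfl : i = m := by omega
      simp [hm, hJm]
    | succ j ih =>
      intro hj i hi
      obtain ⟨h1, h2, h3, h4⟩ := ih (by omega) (i + 1) (by omega)
      have hs := hsel i (by omega)
      have hd' := hdel i (by omega)
      cases ho : o i with
      | none =>
        have hJi := hnone i (by omega) ho
        rw [ho] at hs hd'
        have hK : Ks i = Ks (i + 1) := hd'
        -- An idle step means that `Js i` is already a cover. The residual family is then empty and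
        -- cannot contain a witness for a further edge.
        have hemp : Ks (i + 1) \ Js (i + 1) = ∅ := by
          refine eq_empty_of_forall_notMem fun e he => ?_
          obtain ⟨S, hS, -⟩ := h3 e he
          obtain ⟨hS, hcut⟩ := small_residual.1 hS
          have := covers_iff.1 hJi S hS
          rw [hs.1] at hcut
          simp [hcut] at this
        rw [hs.1] at hemp h1
        rw [hK]
        simp [h1, h2, hemp]
      | some e =>
        exact reverse_delete_step hd hs hd' h1 h2 h3 h4 (by simp [ho])
  obtain ⟨-, h2, -, h4⟩ := main m le_rfl 0 (by omega)
  rw [h0, sdiff_empty] at h4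
  exact ⟨h2, h4⟩

end Residual

/-! ### Flat pairs in minimum degree orderings -/

section Flat

/-- The weight between `S` and its complement. -/
def matrixCut (M : Fin n → Fin n → ℕ) (S : Finset (Fin n)) : ℕ :=
  ∑ i, ∑ j, if i ∈ S ∧ j ∉ S then M i j else 0

/-- The weight between `X` and its complement in the graph obtained by contracting each fibre
of `rep` and keeping the contracted vertices in `R`. -/
def cutIn (M : Fin n → Fin n → ℕ) (rep : Fin n → Fin n) (R X : Finset (Fin n)) : ℕ :=
  ∑ i, ∑ j, if (rep i ∈ R ∧ rep i ∈ X) ∧ rep j ∈ R ∧ rep j ∉ X then M i j else 0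

variable {M : Fin n → Fin n → ℕ} {rep : Fin n → Fin n} {R X : Finset (Fin n)} {s t v : Fin n}

/-- `s, t` is a flat pair of the graph on `R`: a set that separates `s` from `t` has weight at
least the degree of one of its members. -/
def Flat (M : Fin n → Fin n → ℕ) (rep : Fin n → Fin n) (R : Finset (Fin n)) (s t : Fin n) : Prop :=
  ∀ X : Finset (Fin n), (s ∈ X ↔ t ∉ X) → ∃ x ∈ R, x ∈ X ∧ cutIn M rep R {x} ≤ cutIn M rep R X

theorem cutIn_compl (hM : ∀ i j, M i j = M j i) : cutIn M rep R Xᶜ = cutIn M rep R X := by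
  unfold cutIn
  rw [sum_comm]
  refine sum_congr rfl fun i _ => sum_congr rfl fun j _ => ?_
  rw [hM j i]
  refine if_congr ?_ rfl rfl
  simp only [mem_compl]; tauto

/-- Putting `v` back adds to the degree of `x` the weight from `x` to `v`, and to the cut of `X ∋ x`
the weight from all of `X` to `v`, which is at least as large. -/
theorem cutIn_erase_le (hvX : v ∉ X) {x : Fin n} (hx : x ∈ X) :
    cutIn M rep R {x} + cutIn M rep (R.erase v) X ≤
      cutIn M rep R X + cutIn M rep (R.erase v) {x} := by
  unfold cutIn
  simp only [← sum_add_distrib]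
  refine sum_le_sum fun i _ => sum_le_sum fun j _ => ?_
  have hxv : x ≠ v := fun h => hvX (h ▸ hx)
  simp only [mem_singleton, mem_erase]
  by_cases hiR : rep i ∈ R; swap
  · simp [hiR]
  by_cases hjR : rep j ∈ R; swap
  · simp [hjR]
  by_cases hjv : rep j = v
  · have hjx : rep j ∉ X := hjv ▸ hvX
    by_cases hix : rep i = x
    · have : rep i ∈ X := hix ▸ hx
      simp [hjv, hix, hx, hxv.symm, hvX]
    · simp [hix, hjv]
  · by_cases hiv : rep i = v
    · simp [hiv, hvX, hxv.symm]
    · simp [hiv, hjv, hiR, hjR, add_comm]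

/-- If `v ∉ X`, the member of `X` found without `v` still works by `cutIn_erase_le`. If `v ∈ X`, the
complement of `X` has the same weight and contains a vertex of at most that degree; by minimality
the degree of `v` is no larger, and `v` is a member of `X`. -/
theorem Flat.of_erase (hM : ∀ i j, M i j = M j i) (hv : v ∈ R)
    (hmin : ∀ x ∈ R, cutIn M rep R {v} ≤ cutIn M rep R {x}) (h : Flat M rep (R.erase v) s t) :
    Flat M rep R s t := by
  have key : ∀ X : Finset (Fin n), (s ∈ X ↔ t ∉ X) → v ∉ X →
      ∃ x ∈ R, x ∈ X ∧ cutIn M rep R {x} ≤ cutIn M rep R X := by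
    intro X hX hvX
    obtain ⟨x, hxR, hxX, hle⟩ := h X hX
    have := cutIn_erase_le (M := M) (rep := rep) (R := R) hvX hxX
    exact ⟨x, mem_of_mem_erase hxR, hxX, by omega⟩
  intro X hX
  by_cases hvX : v ∈ X
  · obtain ⟨x, hxR, -, hle⟩ := key Xᶜ (by simp only [mem_compl]; tauto) (by simpa using hvX)
    rw [cutIn_compl hM] at hle
    exact ⟨v, hv, hvX, (hmin x hxR).trans hle⟩
  · exact key X hX hvX

theorem flat_pair (s t : Fin n) : Flat M rep {s, t} s t := by
  intro X hX
  by_cases hs : s ∈ X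
  · refine ⟨s, by simp, hs, le_of_eq ?_⟩
    refine sum_congr rfl fun i _ => sum_congr rfl fun j _ => if_congr ?_ rfl rfl
    have ht := hX.1 hs
    have hst : s ≠ t := fun h => ht (h ▸ hs)
    simp only [mem_insert, mem_singleton]
    grind
  · have ht : t ∈ X := by tauto
    refine ⟨t, by simp, ht, le_of_eq ?_⟩
    refine sum_congr rfl fun i _ => sum_congr rfl fun j _ => if_congr ?_ rfl rfl
    simp only [mem_insert, mem_singleton]
    grind

theorem cutIn_image (X : Finset (Fin n)) :
    cutIn M rep (univ.image rep) X = matrixCut M (univ.filter fun i => rep i ∈ X) := by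
  refine sum_congr rfl fun i _ => sum_congr rfl fun j _ => if_congr ?_ rfl rfl
  simp

end Flat

/-! ### Labelling the cores -/

section Label

/-- The vertices with label `l`. -/
def labelClass (L : Fin n → ℕ) (l : ℕ) : Finset (Fin n) := univ.filter fun u => L u = l

/-- The vertices represented by `v`. -/
def repClass (rep : Fin n → Fin n) (v : Fin n) : Finset (Fin n) := univ.filter fun u => rep u = v

/-- The nonzero labels mark cores. -/
def Sound (d : Finset (Fin n) → ℕ) (k : ℕ) (L : Fin n → ℕ) : Prop :=
  ∀ v, L v ≠ 0 → labelClass L (L v) ∈ cores d k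

/-- Each core is marked by a nonzero label. -/
def Complete (d : Finset (Fin n) → ℕ) (k : ℕ) (L : Fin n → ℕ) : Prop :=
  ∀ C ∈ cores d k, ∃ l ≠ 0, C = labelClass L l

/-- Each core that is not marked by a nonzero label is a union of classes of `rep`. -/
def Pending (d : Finset (Fin n) → ℕ) (k : ℕ) (rep : Fin n → Fin n) (L : Fin n → ℕ) : Prop :=
  ∀ C ∈ cores d k, (∃ l ≠ 0, C = labelClass L l) ∨ ∀ u v, rep u = rep v → u ∈ C → v ∈ C

variable {d : Finset (Fin n) → ℕ} {k : ℕ} {rep : Fin n → Fin n} {L : Fin n → ℕ}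

theorem mem_labelClass {l : ℕ} {u : Fin n} : u ∈ labelClass L l ↔ L u = l := by simp [labelClass]

theorem mem_repClass {v u : Fin n} : u ∈ repClass rep v ↔ rep u = v := by simp [repClass]

/-- The small class contains a core. That core carries no label, so it is a union of classes and
must be the whole class. -/
theorem Pending.repClass_mem_cores (h : Pending d k rep L) {v : Fin n}
    (hs : Small d k (repClass rep v)) (hL : ∀ u, rep u = v → L u = 0) :
    repClass rep v ∈ cores d k := by
  obtain ⟨C, hC, hCv⟩ := hs.exists_core
  obtain ⟨u, hu⟩ := core_nonempty hC
  have huv := mem_repClass.1 (hCv hu)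
  rcases h C hC with ⟨l, hl, rfl⟩ | hcl
  · exact absurd (mem_labelClass.1 hu ▸ hL u huv) hl
  · have : C = repClass rep v := by
      refine Subset.antisymm hCv fun w hw => hcl u w ?_ hu
      rw [huv, mem_repClass.1 hw]
    rwa [← this]

/-- The labels after the class of `v` is marked with `l`. -/
def mark (rep : Fin n → Fin n) (L : Fin n → ℕ) (v : Fin n) (l : ℕ) (u : Fin n) : ℕ :=
  if rep u = v then l else L u

theorem labelClass_mark_of_ne {v : Fin n} {l l' : ℕ} (hL : ∀ u, rep u = v → L u = 0)
    (hl' : l' ≠ 0) (hne : l' ≠ l) : labelClass (mark rep L v l) l' = labelClass L l' := by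
  ext u
  rw [mem_labelClass, mem_labelClass, mark]
  by_cases hu : rep u = v
  · simp [hu, hL u hu, hl'.symm, hne.symm]
  · simp [hu]

theorem Sound.mark (h : Sound d k L) {v : Fin n} {l : ℕ} (hv : repClass rep v ∈ cores d k)
    (hL : ∀ u, rep u = v → L u = 0) (hl : ∀ u, L u < l) : Sound d k (mark rep L v l) := by
  intro u hu
  by_cases huv : rep u = v
  · have h1 : NetDesign.mark rep L v l u = l := by simp [NetDesign.mark, huv]
    rw [h1]
    convert hv using 1
    ext w
    rw [mem_labelClass, mem_repClass, NetDesign.mark]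
    by_cases hw : rep w = v
    · simp [hw]
    · simp [hw, (hl w).ne]
  · have h1 : NetDesign.mark rep L v l u = L u := by simp [NetDesign.mark, huv]
    rw [h1] at hu ⊢
    rw [labelClass_mark_of_ne hL hu (hl u).ne]
    exact h u hu

theorem Pending.mark (h : Pending d k rep L) {v : Fin n} {l : ℕ}
    (hL : ∀ u, rep u = v → L u = 0) (hl : ∀ u, L u < l) :
    Pending d k rep (mark rep L v l) := by
  intro C hC
  rcases h C hC with ⟨l', hl', rfl⟩ | hcl
  · left
    obtain ⟨u, hu⟩ := core_nonempty hC
    refine ⟨l', hl', (labelClass_mark_of_ne hL hl' ?_).symm⟩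
    rw [← mem_labelClass.1 hu]
    exact (hl u).ne
  · exact Or.inr hcl

/-- The representatives after `t` is merged into `s`. -/
def mergeRep (rep : Fin n → Fin n) (s t u : Fin n) : Fin n := if rep u = t then s else rep u

/-- Suppose an unlabelled core `C` separates the flat pair. Then some class inside `C` has at most
the weight of `C`, so it is small and by `hchk` contains a labelled vertex. The core marked by this
label meets `C`, hence equals `C`, which is a contradiction. So merging the pair keeps every
unlabelled core a union of classes. -/
theorem Pending.merge {M : Fin n → Fin n → ℕ} (hd : SymSubmodular (matrixCut M))
    (hso : Sound (matrixCut M) k L) (h : Pending (matrixCut M) k rep L)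
    (hchk : ∀ v ∈ univ.image rep, matrixCut M (repClass rep v) < k → ∃ u, rep u = v ∧ L u ≠ 0)
    {s t : Fin n} (hflat : Flat M rep (univ.image rep) s t) :
    Pending (matrixCut M) k (mergeRep rep s t) L := by
  intro C hC
  rcases h C hC with h1 | hcl
  · exact Or.inl h1
  by_cases hlab : ∃ l ≠ 0, C = labelClass L l
  · exact Or.inl hlab
  right
  have hclX : ∀ u, u ∈ C ↔ rep u ∈ C.image rep := by
    intro u
    refine ⟨fun hu => mem_image_of_mem _ hu, fun hu => ?_⟩
    obtain ⟨w, hw, hwu⟩ := mem_image.1 hu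
    exact hcl w u hwu hw
  have hst : s ∈ C.image rep ↔ t ∈ C.image rep := by
    by_contra hsep
    obtain ⟨x, hxR, hxX, hle⟩ := hflat (C.image rep) (by tauto)
    rw [cutIn_image, cutIn_image] at hle
    have e1 : (univ.filter fun i => rep i ∈ C.image rep) = C := by
      ext u; rw [mem_filter, ← hclX]; simp
    have e2 : (univ.filter fun i => rep i ∈ ({x} : Finset (Fin n))) = repClass rep x := by
      ext u; simp [repClass]
    rw [e1, e2] at hle
    obtain ⟨u, hu, hLu⟩ := hchk x hxR (hle.trans_lt (mem_cores.1 hC).1.2.2)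
    have huC : u ∈ C := by rw [hclX, hu]; exact hxX
    exact hlab ⟨L u, hLu, eq_of_mem_cores hd hC (hso u hLu) huC (mem_labelClass.2 rfl)⟩
  intro u v huv hu
  rw [hclX] at hu ⊢
  unfold mergeRep at huv
  split_ifs at huv with h1 h2 h2
  · rwa [h2, ← h1]
  · rw [h1, ← hst, huv] at hu; exact hu
  · rw [h2, ← hst, ← huv]; exact hu
  · rwa [← huv]

/-- With a single class, the only nonempty union of classes is the whole vertex set, and that is not
small. -/
theorem Pending.complete (h : Pending d k rep L) (hrep : (univ.image rep).card ≤ 1) :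
    Complete d k L := by
  intro C hC
  rcases h C hC with h1 | hcl
  · exact h1
  exfalso
  obtain ⟨u, hu⟩ := core_nonempty hC
  refine (mem_cores.1 hC).1.2.1 (eq_univ_of_forall fun v => hcl u v ?_ hu)
  exact card_le_one.1 hrep _ (mem_image_of_mem _ (mem_univ _)) _ (mem_image_of_mem _ (mem_univ _))

theorem cores_eq_empty_iff_of_labels (hs : Sound d k L) (hc : Complete d k L) :
    cores d k = ∅ ↔ ∀ v, L v = 0 := by
  constructor
  · intro h v
    by_contra hv
    have := hs v hv
    simp [h] at this
  · intro h
    refine eq_empty_of_forall_notMem fun C hC => ?_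
    obtain ⟨l, hl, rfl⟩ := hc C hC
    obtain ⟨v, hv⟩ := core_nonempty hC
    exact hl ((mem_labelClass.1 hv).symm.trans (h v))

/-- Cores are label classes, so an edge can leave only the cores marked by the labels of its two
ends, and it leaves them exactly when the labels differ. In particular the count is at most two. -/
theorem card_cores_crossed (hs : Sound d k L) (hc : Complete d k L) {E : EdgeList n m}
    (g : Fin m) :
    ((cores d k).filter fun C => g ∈ cut E univ C).card =
      if L (E g).1 = L (E g).2 then 0 else
        (if L (E g).1 = 0 then 0 else 1) + (if L (E g).2 = 0 then 0 else 1) := by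
  set a := (E g).1 with ha
  set b := (E g).2 with hb
  have hmem : ∀ C ∈ cores d k, ∃ l ≠ 0, C = labelClass L l ∧ ∀ u, u ∈ C ↔ L u = l := by
    intro C hC
    obtain ⟨l, hl, rfl⟩ := hc C hC
    exact ⟨l, hl, rfl, fun u => mem_labelClass⟩
  split_ifs with h1 h2 h3 h3
  · rw [card_eq_zero]
    refine eq_empty_of_forall_notMem fun C hC => ?_
    obtain ⟨hC, hg⟩ := mem_filter.1 hC
    obtain ⟨l, -, -, hl⟩ := hmem C hC
    rw [mem_cut, ← ha, ← hb, hl, hl, h1] at hg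
    exact hg.2 Iff.rfl
  · exact absurd (h2.trans h3.symm) h1
  · rw [zero_add, card_eq_one]
    refine ⟨labelClass L (L b), ?_⟩
    ext C
    rw [mem_filter, mem_singleton, mem_cut, ← ha, ← hb]
    constructor
    · rintro ⟨hC, -, hg⟩
      obtain ⟨l, hl0, rfl, hl⟩ := hmem C hC
      rw [hl, hl] at hg
      have : L b = l := by
        by_contra h'
        exact hg ⟨fun h => absurd (h2 ▸ h).symm hl0, fun h => absurd h h'⟩
      rw [this]
    · rintro rfl
      refine ⟨hs b h3, mem_univ _, ?_⟩
      rw [mem_labelClass, mem_labelClass]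
      exact fun h => h1 (h.2 rfl)
  · rw [add_zero, card_eq_one]
    refine ⟨labelClass L (L a), ?_⟩
    ext C
    rw [mem_filter, mem_singleton, mem_cut, ← ha, ← hb]
    constructor
    · rintro ⟨hC, -, hg⟩
      obtain ⟨l, hl0, rfl, hl⟩ := hmem C hC
      rw [hl, hl] at hg
      have : L a = l := by
        by_contra h'
        exact hg ⟨fun h => absurd h h', fun h => absurd (h3 ▸ h).symm hl0⟩
      rw [this]
    · rintro rfl
      refine ⟨hs a h2, mem_univ _, ?_⟩
      rw [mem_labelClass, mem_labelClass]
      exact fun h => h1 (h.1 rfl).symm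
  · rw [show 1 + 1 = 2 from rfl, card_eq_two]
    refine ⟨labelClass L (L a), labelClass L (L b), fun h => ?_, ?_⟩
    · have : a ∈ labelClass L (L b) := h ▸ mem_labelClass.2 rfl
      exact h1 (mem_labelClass.1 this)
    ext C
    rw [mem_filter, mem_insert, mem_singleton, mem_cut, ← ha, ← hb]
    constructor
    · rintro ⟨hC, -, hg⟩
      obtain ⟨l, hl0, rfl, hl⟩ := hmem C hC
      rw [hl, hl] at hg
      by_cases h' : L a = l
      · left; rw [h']
      · right
        have : L b = l := by tauto
        rw [this]
    · rintro (rfl | rfl)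
      · refine ⟨hs a h2, mem_univ _, ?_⟩
        rw [mem_labelClass, mem_labelClass]
        exact fun h => h1 (h.1 rfl).symm
      · refine ⟨hs b h3, mem_univ _, ?_⟩
        rw [mem_labelClass, mem_labelClass]
        exact fun h => h1 (h.2 rfl)

end Label

end NetDesign

/-! ### A bounded-loop language and its polynomial running times. -/

namespace NetDesign

/-! ### Programs with bounded loops -/

/-- Programs in which each loop runs a variable from `0` up to an entry of array `1`. -/
inductive Cmd where
  | skip
  | assign (x : ℕ) (e : Term)
  | store (a : ℕ) (i e : Term)
  | seq (p q : Cmd)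
  | ite (e : Term) (p q : Cmd)
  | upto (x b : ℕ) (p : Cmd)

/-- The state after `i` rounds of a loop with variable `x` and body `f`. -/
def loopState (f : State → State) (x : ℕ) (s : State) : ℕ → State
  | 0 => s
  | i + 1 => f ((loopState f x s i).setVar x i)

/-- The final memory of a program. -/
def Cmd.exec : Cmd → State → State
  | .skip, s => s
  | .assign x e, s => s.setVar x (e.eval s)
  | .store a i e, s => s.setArr a (i.eval s) (e.eval s)
  | .seq p q, s => q.exec (p.exec s)
  | .ite e p q, s => if e.eval s ≠ 0 then p.exec s else q.exec s
  | .upto x b p, s => (loopState p.exec x s (s.arr 1 b)).setVar x (s.arr 1 b)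

/-- Translation into the machine language. -/
def Cmd.compile : Cmd → Prog
  | .skip => .skip
  | .assign x e => .assign x e
  | .store a i e => .store a i e
  | .seq p q => .seq p.compile q.compile
  | .ite e p q => .ite e p.compile q.compile
  | .upto x b p => .seq (.assign x (.const 0))
      (.loop (.sub (.read 1 (.const b)) (.var x))
        (.seq p.compile (.assign x (.add (.var x) (.const 1)))))

/-- A computable syntactic test, so that what a concrete program leaves unchanged can be settled by
`rfl`. -/
def Cmd.writesVar (x : ℕ) : Cmd → Bool
  | .skip => false
  | .assign y _ => x == y
  | .store _ _ _ => false
  | .seq p q => p.writesVar x || q.writesVar x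
  | .ite _ p q => p.writesVar x || q.writesVar x
  | .upto y _ p => x == y || p.writesVar x

def Cmd.writesArr (a : ℕ) : Cmd → Bool
  | .skip => false
  | .assign _ _ => false
  | .store b _ _ => a == b
  | .seq p q => p.writesArr a || q.writesArr a
  | .ite _ p q => p.writesArr a || q.writesArr a
  | .upto _ _ p => p.writesArr a

/-- In each product the right factor is an entry of one of the arrays `1`, …, `8`. -/
def Term.tame : Term → Bool
  | .const _ => true
  | .var _ => true
  | .read _ i => i.tame
  | .add e f => e.tame && f.tame
  | .sub e f => e.tame && f.tame
  | .mul e (.read a i) => e.tame && i.tame && decide (1 ≤ a) && decide (a ≤ 8)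
  | .mul _ _ => false
  | .div e f => e.tame && f.tame

/-- Loop variables are not changed by the loop body, loops are bounded by the first `h` entries of
array `1`, and the arrays `1`, …, `8` are not changed. -/
def Cmd.tame (h : ℕ) : Cmd → Bool
  | .skip => true
  | .assign _ e => e.tame
  | .store a i e => (a == 0 || decide (8 < a)) && i.tame && e.tame
  | .seq p q => p.tame h && q.tame h
  | .ite e p q => e.tame && p.tame h && q.tame h
  | .upto x b p => decide (b < h) && !p.writesVar x && p.tame h

section Frame

variable {s : State} {x y a b i v : ℕ}

@[simp] theorem setVar_var : (s.setVar x v).var y = if y = x then v else s.var y := by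
  simp [State.setVar, Function.update_apply]

@[simp] theorem setVar_arr : (s.setVar x v).arr = s.arr := rfl

@[simp] theorem setArr_var : (s.setArr a i v).var = s.var := rfl

@[simp] theorem setArr_arr {j : ℕ} :
    (s.setArr a i v).arr b j = if b = a then (if j = i then v else s.arr a j) else s.arr b j := by
  by_cases h1 : b = a
  · subst h1
    simp [State.setArr, Function.update_apply]
  · simp [State.setArr, h1]

theorem Cmd.exec_var : ∀ (p : Cmd) (s : State), p.writesVar x = false →
    (p.exec s).var x = s.var x
  | .skip, s, _ => rfl
  | .assign y e, s, h => by
    simp only [Cmd.writesVar, beq_eq_false_iff_ne] at h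
    simp [Cmd.exec, h]
  | .store _ _ _, s, _ => rfl
  | .seq p q, s, h => by
    simp only [Cmd.writesVar, Bool.or_eq_false_iff] at h
    rw [Cmd.exec, q.exec_var _ h.2, p.exec_var _ h.1]
  | .ite e p q, s, h => by
    simp only [Cmd.writesVar, Bool.or_eq_false_iff] at h
    rw [Cmd.exec]
    split_ifs
    · exact p.exec_var _ h.1
    · exact q.exec_var _ h.2
  | .upto y b p, s, h => by
    simp only [Cmd.writesVar, Bool.or_eq_false_iff, beq_eq_false_iff_ne] at h
    rw [Cmd.exec, setVar_var, if_neg h.1]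
    have : ∀ i, (loopState p.exec y s i).var x = s.var x := by
      intro i
      induction i with
      | zero => rfl
      | succ i ih => rw [loopState, p.exec_var _ h.2, setVar_var, if_neg h.1, ih]
    exact this _

theorem Cmd.exec_arr : ∀ (p : Cmd) (s : State), p.writesArr a = false →
    (p.exec s).arr a = s.arr a
  | .skip, s, _ => rfl
  | .assign y e, s, _ => rfl
  | .store b _ _, s, h => by
    simp only [Cmd.writesArr, beq_eq_false_iff_ne] at h
    funext j
    simp [Cmd.exec, h]
  | .seq p q, s, h => by
    simp only [Cmd.writesArr, Bool.or_eq_false_iff] at h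
    rw [Cmd.exec, q.exec_arr _ h.2, p.exec_arr _ h.1]
  | .ite e p q, s, h => by
    simp only [Cmd.writesArr, Bool.or_eq_false_iff] at h
    rw [Cmd.exec]
    split_ifs
    · exact p.exec_arr _ h.1
    · exact q.exec_arr _ h.2
  | .upto y b p, s, h => by
    simp only [Cmd.writesArr] at h
    rw [Cmd.exec, setVar_arr]
    have : ∀ i, (loopState p.exec y s i).arr a = s.arr a := by
      intro i
      induction i with
      | zero => rfl
      | succ i ih => rw [loopState, p.exec_arr _ h, setVar_arr, ih]
    exact this _

theorem loopState_var {p : Cmd} (h : p.writesVar y = false) (hx : y ≠ x) (i : ℕ) :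
    (loopState p.exec x s i).var y = s.var y := by
  induction i with
  | zero => rfl
  | succ i ih => rw [loopState, p.exec_var _ h, setVar_var, if_neg hx, ih]

theorem loopState_arr {p : Cmd} (h : p.writesArr a = false) (i : ℕ) :
    (loopState p.exec x s i).arr a = s.arr a := by
  induction i with
  | zero => rfl
  | succ i ih => rw [loopState, p.exec_arr _ h, setVar_arr, ih]

theorem Cmd.tame.writesArr_eq_false {h : ℕ} (ha1 : 1 ≤ a) (ha8 : a ≤ 8) :
    ∀ (p : Cmd), p.tame h = true → p.writesArr a = false
  | .skip, _ => rfl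
  | .assign _ _, _ => rfl
  | .store b _ _, hp => by
    simp only [Cmd.tame, Bool.and_eq_true, Bool.or_eq_true, beq_iff_eq, decide_eq_true_eq] at hp
    simp only [Cmd.writesArr, beq_eq_false_iff_ne]
    omega
  | .seq p q, hp => by
    simp only [Cmd.tame, Bool.and_eq_true] at hp
    simp only [Cmd.writesArr, Cmd.tame.writesArr_eq_false ha1 ha8 p hp.1,
      Cmd.tame.writesArr_eq_false ha1 ha8 q hp.2, Bool.or_self]
  | .ite _ p q, hp => by
    simp only [Cmd.tame, Bool.and_eq_true] at hp
    simp only [Cmd.writesArr, Cmd.tame.writesArr_eq_false ha1 ha8 p hp.1.2,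
      Cmd.tame.writesArr_eq_false ha1 ha8 q hp.2, Bool.or_self]
  | .upto _ _ p, hp => by
    simp only [Cmd.tame, Bool.and_eq_true] at hp
    exact Cmd.tame.writesArr_eq_false ha1 ha8 p hp.2

end Frame

/-! ### Running times of programs with bounded loops -/

/-- Number of nodes, plus the bits of the constants; with this weight, `len * (L + 1)` bounds the
bits gained by an evaluation. -/
def Term.len : Term → ℕ
  | .const c => 1 + Nat.size c
  | .var _ => 1
  | .read _ i => 1 + i.len
  | .add e f => 1 + e.len + f.len
  | .sub e f => 1 + e.len + f.len
  | .mul e f => 1 + e.len + f.len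
  | .div e f => 1 + e.len + f.len

/-- All numbers in the memory have at most `β` bits. -/
def Bounded (s : State) (β : ℕ) : Prop :=
  (∀ x, Nat.size (s.var x) ≤ β) ∧ ∀ a i, Nat.size (s.arr a i) ≤ β

/-- The entries of the arrays `1`, …, `8` have at most `L` bits, and the first `h` entries
of array `1` are at most `L`. -/
def InputBounded (s : State) (h L : ℕ) : Prop :=
  (∀ a i, 1 ≤ a → a ≤ 8 → Nat.size (s.arr a i) ≤ L) ∧ ∀ b < h, s.arr 1 b ≤ L

theorem Bounded.mono {s : State} {β β' : ℕ} (hs : Bounded s β) (h : β ≤ β') : Bounded s β' :=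
  ⟨fun x => (hs.1 x).trans h, fun a i => (hs.2 a i).trans h⟩

theorem size_add_le (a b : ℕ) : Nat.size (a + b) ≤ max (Nat.size a) (Nat.size b) + 1 := by
  rw [Nat.size_le, pow_succ]
  have h1 := (Nat.size_le (m := a)).1 (le_max_left (Nat.size a) (Nat.size b))
  have h2 := (Nat.size_le (m := b)).1 (le_max_right (Nat.size a) (Nat.size b))
  omega

theorem size_mul_le (a b : ℕ) : Nat.size (a * b) ≤ Nat.size a + Nat.size b := by
  rw [Nat.size_le, pow_add]
  exact Nat.mul_lt_mul'' (Nat.lt_size_self a) (Nat.lt_size_self b)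

theorem size_le_self (a : ℕ) : Nat.size a ≤ a := Nat.size_le.2 Nat.lt_two_pow_self

/-- The gain over `β` does not depend on `β`: a sum adds one bit, and a tame product adds the at
most `L` bits of its right factor, an input entry. Unrestricted products could double the bit length
in every round of a loop. -/
theorem Term.size_eval_le {s : State} {h L β : ℕ} (hs : Bounded s β) (hi : InputBounded s h L) :
    ∀ e : Term, e.tame = true → Nat.size (e.eval s) ≤ β + e.len * (L + 1)
  | .const c, _ => by
    simp only [Term.eval, Term.len]
    nlinarith [Nat.zero_le (Nat.size c * L)]
  | .var x, _ => (hs.1 x).trans (Nat.le_add_right _ _)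
  | .read a i, _ => (hs.2 a _).trans (Nat.le_add_right _ _)
  | .add e f, ht => by
    simp only [Term.tame, Bool.and_eq_true] at ht
    have h1 := Term.size_eval_le hs hi e ht.1
    have h2 := Term.size_eval_le hs hi f ht.2
    have h3 := size_add_le (e.eval s) (f.eval s)
    have h4 : max (Nat.size (e.eval s)) (Nat.size (f.eval s)) ≤
        β + e.len * (L + 1) + f.len * (L + 1) := max_le (by omega) (by omega)
    simp only [Term.eval, Term.len]
    nlinarith
  | .sub e f, ht => by
    simp only [Term.tame, Bool.and_eq_true] at ht
    have h1 := Term.size_eval_le hs hi e ht.1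
    have h2 : Nat.size (e.eval s - f.eval s) ≤ _ := Nat.size_le_size (Nat.sub_le _ _)
    simp only [Term.eval, Term.len]
    nlinarith [Nat.zero_le (f.len * (L + 1))]
  | .div e f, ht => by
    simp only [Term.tame, Bool.and_eq_true] at ht
    have h1 := Term.size_eval_le hs hi e ht.1
    have h2 : Nat.size (e.eval s / f.eval s) ≤ _ := Nat.size_le_size (Nat.div_le_self _ _)
    simp only [Term.eval, Term.len]
    nlinarith [Nat.zero_le (f.len * (L + 1))]
  | .mul e (.read a i), ht => by
    simp only [Term.tame, Bool.and_eq_true, decide_eq_true_eq] at ht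
    have h1 := Term.size_eval_le hs hi e ht.1.1.1
    have h2 := hi.1 a (i.eval s) ht.1.2 ht.2
    have h3 := size_mul_le (e.eval s) (s.arr a (i.eval s))
    simp only [Term.eval, Term.len]
    nlinarith [Nat.zero_le (i.len * (L + 1))]

theorem Term.time_le {s : State} {h L β B : ℕ} (hs : Bounded s β) (hi : InputBounded s h L) :
    ∀ e : Term, e.tame = true → β + e.len * (L + 1) ≤ B → e.time s ≤ e.len * (B + 1)
  | .const c, ht, hB => by
    have h0 := Term.size_eval_le hs hi (.const c) ht
    simp only [Term.eval, Term.len, Term.time] at *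
    nlinarith [Nat.zero_le (Nat.size c * (B + 1))]
  | .var x, ht, hB => by
    have h0 := Term.size_eval_le hs hi (.var x) ht
    simp only [Term.eval, Term.len, Term.time] at *
    omega
  | .read a i, ht, hB => by
    have h0 := Term.size_eval_le hs hi (.read a i) ht
    have h1 := Term.time_le hs hi (B := B) i ht (by simp only [Term.len] at hB; nlinarith)
    simp only [Term.eval, Term.len, Term.time] at *
    nlinarith
  | .add e f, ht, hB => by
    have h0 := Term.size_eval_le hs hi (.add e f) ht
    have ht' := ht
    simp only [Term.tame, Bool.and_eq_true] at ht'
    simp only [Term.len] at hB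
    have h1 := Term.time_le hs hi (B := B) e ht'.1 (by nlinarith [Nat.zero_le (f.len * (L + 1))])
    have h2 := Term.time_le hs hi (B := B) f ht'.2 (by nlinarith [Nat.zero_le (e.len * (L + 1))])
    simp only [Term.eval, Term.len, Term.time] at *
    nlinarith
  | .sub e f, ht, hB => by
    have h0 := Term.size_eval_le hs hi (.sub e f) ht
    have ht' := ht
    simp only [Term.tame, Bool.and_eq_true] at ht'
    simp only [Term.len] at hB
    have h1 := Term.time_le hs hi (B := B) e ht'.1 (by nlinarith [Nat.zero_le (f.len * (L + 1))])
    have h2 := Term.time_le hs hi (B := B) f ht'.2 (by nlinarith [Nat.zero_le (e.len * (L + 1))])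
    simp only [Term.eval, Term.len, Term.time] at *
    nlinarith
  | .div e f, ht, hB => by
    have h0 := Term.size_eval_le hs hi (.div e f) ht
    have ht' := ht
    simp only [Term.tame, Bool.and_eq_true] at ht'
    simp only [Term.len] at hB
    have h1 := Term.time_le hs hi (B := B) e ht'.1 (by nlinarith [Nat.zero_le (f.len * (L + 1))])
    have h2 := Term.time_le hs hi (B := B) f ht'.2 (by nlinarith [Nat.zero_le (e.len * (L + 1))])
    simp only [Term.eval, Term.len, Term.time] at *
    nlinarith
  | .mul e (.read a i), ht, hB => by
    have h0 := Term.size_eval_le hs hi (.mul e (.read a i)) ht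
    have ht' := ht
    simp only [Term.tame, Bool.and_eq_true] at ht'
    have hr : (Term.read a i).tame = true := ht'.1.1.2
    rw [Term.len] at hB
    have h1 := Term.time_le hs hi (B := B) e ht'.1.1.1
      (by nlinarith [Nat.zero_le ((Term.read a i).len * (L + 1))])
    have h2 := Term.time_le hs hi (B := B) (.read a i) hr
      (by nlinarith [Nat.zero_le (e.len * (L + 1))])
    rw [Term.time, Term.len]
    rw [Term.eval, Term.len] at h0
    nlinarith

/-- A bound on the growth of the bit lengths during the execution. -/
def Cmd.growth (L : ℕ) : Cmd → ℕ
  | .skip => 0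
  | .assign _ e => e.len * (L + 1)
  | .store _ _ e => e.len * (L + 1)
  | .seq p q => p.growth L + q.growth L
  | .ite _ p q => p.growth L + q.growth L
  | .upto _ _ p => L * p.growth L + L

def termCost (l L β : ℕ) : ℕ := l * (β + l * (L + 1) + 1)

/-- A bound on the running time. -/
def Cmd.cost (L : ℕ) : Cmd → ℕ → ℕ
  | .skip, _ => 1
  | .assign _ e, β => termCost e.len L β + 1
  | .store _ i e, β => termCost i.len L β + termCost e.len L β + 1
  | .seq p q, β => p.cost L β + q.cost L (β + p.growth L)
  | .ite e p q, β => termCost e.len L β + 1 + (p.cost L β + q.cost L β)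
  | .upto x b p, β => 2 + (L + 1) *
      (termCost (Term.sub (.read 1 (.const b)) (.var x)).len L (β + L * p.growth L + L) + 1 +
        (p.cost L (β + L * p.growth L + L) + (termCost (Term.add (.var x) (.const 1)).len L
          (β + L * p.growth L + L) + 1)))

theorem Bounded.setVar {s : State} {β x v : ℕ} (hs : Bounded s β) (hv : Nat.size v ≤ β) :
    Bounded (s.setVar x v) β := by
  refine ⟨fun y => ?_, hs.2⟩
  rw [setVar_var]
  split_ifs
  · exact hv
  · exact hs.1 y

theorem Bounded.setArr {s : State} {β a i v : ℕ} (hs : Bounded s β) (hv : Nat.size v ≤ β) :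
    Bounded (s.setArr a i v) β := by
  refine ⟨hs.1, fun b j => ?_⟩
  rw [setArr_arr]
  split_ifs
  · exact hv
  · exact hs.2 _ _
  · exact hs.2 _ _

theorem InputBounded.exec {s : State} {h L : ℕ} (hi : InputBounded s h L) {p : Cmd}
    (hp : p.tame h = true) : InputBounded (p.exec s) h L := by
  refine ⟨fun a i h1 h8 => ?_, fun b hb => ?_⟩
  · rw [p.exec_arr _ (Cmd.tame.writesArr_eq_false h1 h8 p hp)]
    exact hi.1 a i h1 h8
  · rw [p.exec_arr _ (Cmd.tame.writesArr_eq_false le_rfl (by norm_num) p hp)]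
    exact hi.2 b hb

theorem InputBounded.setVar {s : State} {h L x v : ℕ} (hi : InputBounded s h L) :
    InputBounded (s.setVar x v) h L := hi

/-- The translation of a program computes its final memory within the time bound. -/
theorem Cmd.run_compile {h L : ℕ} : ∀ (p : Cmd) (s : State) (β : ℕ), p.tame h = true →
    Bounded s β → InputBounded s h L →
    (∃ t, Run p.compile s (p.exec s) t ∧ t ≤ p.cost L β) ∧ Bounded (p.exec s) (β + p.growth L)
  | .skip, s, β, _, hs, _ => ⟨⟨1, Run.skip s, le_rfl⟩, hs⟩
  | .assign x e, s, β, hp, hs, hi => by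
    refine ⟨⟨_, Run.assign s x e, ?_⟩, ?_⟩
    · exact Nat.add_le_add_right (e.time_le hs hi hp le_rfl) 1
    · exact (hs.mono (Nat.le_add_right _ _)).setVar (e.size_eval_le hs hi hp)
  | .store a i e, s, β, hp, hs, hi => by
    simp only [Cmd.tame, Bool.and_eq_true] at hp
    refine ⟨⟨_, Run.store s a i e, ?_⟩, ?_⟩
    · exact Nat.add_le_add_right (Nat.add_le_add (i.time_le hs hi hp.1.2 le_rfl)
        (e.time_le hs hi hp.2 le_rfl)) 1
    · exact (hs.mono (Nat.le_add_right _ _)).setArr (e.size_eval_le hs hi hp.2)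
  | .seq p q, s, β, hp, hs, hi => by
    simp only [Cmd.tame, Bool.and_eq_true] at hp
    obtain ⟨⟨t, hr, ht⟩, hb⟩ := p.run_compile s β hp.1 hs hi
    obtain ⟨⟨t', hr', ht'⟩, hb'⟩ := q.run_compile (p.exec s) _ hp.2 hb (hi.exec hp.1)
    refine ⟨⟨_, Run.seq hr hr', Nat.add_le_add ht ht'⟩, ?_⟩
    rw [Cmd.growth, ← add_assoc]
    exact hb'
  | .ite e p q, s, β, hp, hs, hi => by
    simp only [Cmd.tame, Bool.and_eq_true] at hp
    have he := e.time_le hs hi hp.1.1 le_rfl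
    by_cases h0 : e.eval s = 0
    · obtain ⟨⟨t, hr, ht⟩, hb⟩ := q.run_compile s β hp.2 hs hi
      have hx : (Cmd.ite e p q).exec s = q.exec s := by simp [Cmd.exec, h0]
      rw [hx]
      refine ⟨⟨_, Run.ite_false h0 hr, ?_⟩, hb.mono ?_⟩
      · simp only [Cmd.cost, termCost]; omega
      · simp only [Cmd.growth]; omega
    · obtain ⟨⟨t, hr, ht⟩, hb⟩ := p.run_compile s β hp.1.2 hs hi
      have hx : (Cmd.ite e p q).exec s = p.exec s := by simp [Cmd.exec, h0]
      rw [hx]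
      refine ⟨⟨_, Run.ite_true h0 hr, ?_⟩, hb.mono ?_⟩
      · simp only [Cmd.cost, termCost]; omega
      · simp only [Cmd.growth]; omega
  | .upto x b p, s, β, hp, hs, hi => by
    simp only [Cmd.tame, Bool.and_eq_true, decide_eq_true_eq, Bool.not_eq_true'] at hp
    obtain ⟨⟨hbh, hwx⟩, hp⟩ := hp
    set N := s.arr 1 b with hN
    have hNL : N ≤ L := hi.2 b hbh
    set g := p.growth L with hg
    -- Each round adds at most `g` bits; the extra `L` makes room for the loop variable.
    have hst : ∀ i ≤ N, Bounded (loopState p.exec x s i) (β + i * g + L) ∧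
        InputBounded (loopState p.exec x s i) h L := by
      intro i
      induction i with
      | zero => intro _; exact ⟨hs.mono (by omega), hi⟩
      | succ i ih =>
        intro hiN
        obtain ⟨h1, h2⟩ := ih (by omega)
        have h3 := (p.run_compile ((loopState p.exec x s i).setVar x i) _ hp
          (h1.setVar ((size_le_self i).trans (by omega))) h2.setVar).2
        refine ⟨h3.mono (le_of_eq ?_), ?_⟩
        · rw [← hg]; ring
        · rw [loopState]; exact h2.setVar.exec hp
    -- A bound valid in all rounds at once, so that each round can be charged the same cost `C`.
    set β' := β + L * g + L with hβ'
    have hst' : ∀ i ≤ N, Bounded ((loopState p.exec x s i).setVar x i) β' := by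
      intro i hiN
      have : i * g ≤ L * g := Nat.mul_le_mul_right _ (by omega)
      exact ((hst i hiN).1.mono (by omega)).setVar ((size_le_self i).trans (by omega))
    have hNi : ∀ i, (loopState p.exec x s i).arr 1 b = N := fun i => by
      rw [loopState_arr (Cmd.tame.writesArr_eq_false le_rfl (by norm_num) p hp)]
    set e := Term.sub (.read 1 (.const b)) (.var x) with he
    set f := Term.add (.var x) (.const 1) with hf
    set C := termCost e.len L β' + 1 + (p.cost L β' + (termCost f.len L β' + 1)) with hC
    have het : e.tame = true := rfl
    have hft : f.tame = true := rfl
    have hloop : ∀ j i, i + j = N → ∃ t, t ≤ (j + 1) * C ∧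
        Run (.loop e (.seq p.compile (.assign x f))) ((loopState p.exec x s i).setVar x i)
          ((loopState p.exec x s N).setVar x N) t := by
      intro j
      induction j with
      | zero =>
        intro i hij
        obtain rfl : i = N := by omega
        refine ⟨_, ?_, Run.loop_exit ?_⟩
        · have := e.time_le (hst' _ le_rfl) ((hst _ le_rfl).2.setVar (x := x) (v := N)) het le_rfl
          simp only [hC, termCost]
          omega
        · simp [he, Term.eval, hNi]
      | succ j ih =>
        intro i hij
        have hbi := hst' i (by omega)
        have hii := (hst i (by omega)).2.setVar (x := x) (v := i)
        obtain ⟨⟨t₁, hr₁, ht₁⟩, -⟩ := p.run_compile ((loopState p.exec x s i).setVar x i) β' hp hbi hii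
        obtain ⟨t₂, ht₂, hr₂⟩ := ih (i + 1) (by omega)
        have hvx : (p.exec ((loopState p.exec x s i).setVar x i)).var x = i := by
          rw [p.exec_var _ hwx]; simp
        have hr₃ := Run.assign (p.exec ((loopState p.exec x s i).setVar x i)) x f
        have hfe : f.eval (p.exec ((loopState p.exec x s i).setVar x i)) = i + 1 := by
          simp [hf, Term.eval, hvx]
        have hft₃ : f.time (p.exec ((loopState p.exec x s i).setVar x i)) ≤ termCost f.len L β' := by
          have h3 : f.time (p.exec ((loopState p.exec x s i).setVar x i)) =
              f.time ((loopState p.exec x s i).setVar x i) := by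
            simp [hf, Term.time, Term.eval, hvx]
          rw [h3]
          exact f.time_le hbi hii hft le_rfl
        rw [hfe] at hr₃
        have hne : e.eval ((loopState p.exec x s i).setVar x i) ≠ 0 := by
          simp only [he, Term.eval, setVar_arr, hNi, setVar_var, if_true]
          omega
        refine ⟨_, ?_, Run.loop_step hne (Run.seq hr₁ hr₃) hr₂⟩
        have h4 : e.time ((loopState p.exec x s i).setVar x i) ≤ termCost e.len L β' :=
          e.time_le hbi hii het le_rfl
        have h5 : (j + 1 + 1) * C = C + (j + 1) * C := by ring
        rw [h5]
        refine Nat.add_le_add ?_ ht₂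
        omega
    obtain ⟨t, ht, hr⟩ := hloop N 0 (by omega)
    refine ⟨⟨_, Run.seq (Run.assign s x (.const 0)) hr, ?_⟩, ?_⟩
    · have h1 : (N + 1) * C ≤ (L + 1) * C := Nat.mul_le_mul_right _ (by omega)
      have h2 : (Term.const 0).time s + 1 = 2 := by simp [Term.time]
      rw [h2]
      simp only [Cmd.cost, ← hg, ← hβ', ← he, ← hf, ← hC]
      omega
    · rw [Cmd.exec, Cmd.growth, ← hg, ← add_assoc]
      exact hst' N le_rfl

/-- A function given by a polynomial. -/
def IsPoly (f : ℕ → ℕ) : Prop := ∃ P : Polynomial ℕ, ∀ x, f x = P.eval x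

theorem IsPoly.const (c : ℕ) : IsPoly fun _ => c := ⟨Polynomial.C c, by simp⟩

theorem IsPoly.id : IsPoly fun x => x := ⟨Polynomial.X, by simp⟩

theorem IsPoly.add {f g : ℕ → ℕ} (hf : IsPoly f) (hg : IsPoly g) : IsPoly fun x => f x + g x := by
  obtain ⟨P, hP⟩ := hf
  obtain ⟨Q, hQ⟩ := hg
  exact ⟨P + Q, fun x => by simp [hP, hQ]⟩

theorem IsPoly.mul {f g : ℕ → ℕ} (hf : IsPoly f) (hg : IsPoly g) : IsPoly fun x => f x * g x := by
  obtain ⟨P, hP⟩ := hf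
  obtain ⟨Q, hQ⟩ := hg
  exact ⟨P * Q, fun x => by simp [hP, hQ]⟩

theorem IsPoly.growth : ∀ p : Cmd, IsPoly fun L => p.growth L
  | .skip => .const 0
  | .assign _ e => (IsPoly.const e.len).mul (IsPoly.id.add (.const 1))
  | .store _ _ e => (IsPoly.const e.len).mul (IsPoly.id.add (.const 1))
  | .seq p q => (IsPoly.growth p).add (IsPoly.growth q)
  | .ite _ p q => (IsPoly.growth p).add (IsPoly.growth q)
  | .upto _ _ p => (IsPoly.id.mul (IsPoly.growth p)).add IsPoly.id

theorem IsPoly.termCost {b : ℕ → ℕ} (hb : IsPoly b) (l : ℕ) :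
    IsPoly fun L => termCost l L (b L) :=
  (IsPoly.const l).mul ((hb.add ((IsPoly.const l).mul (IsPoly.id.add (.const 1)))).add (.const 1))

/-- The growth is added to the size bound rather than iterated on it, so even nested loops only
produce sums and products of polynomials. -/
theorem IsPoly.cost : ∀ (p : Cmd) {b : ℕ → ℕ}, IsPoly b → IsPoly fun L => p.cost L (b L)
  | .skip, _, _ => .const 1
  | .assign _ e, _, hb => (hb.termCost _).add (.const 1)
  | .store _ i e, _, hb => ((hb.termCost _).add (hb.termCost _)).add (.const 1)
  | .seq p q, _, hb => (IsPoly.cost p hb).add (IsPoly.cost q (hb.add (IsPoly.growth p)))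
  | .ite e p q, _, hb =>
    ((hb.termCost _).add (.const 1)).add ((IsPoly.cost p hb).add (IsPoly.cost q hb))
  | .upto x b p, _, hb => by
    have hb' := (hb.add (IsPoly.id.mul (IsPoly.growth p))).add IsPoly.id
    exact (IsPoly.const 2).add ((IsPoly.id.add (.const 1)).mul (((hb'.termCost _).add (.const 1)).add
      ((IsPoly.cost p hb').add ((hb'.termCost _).add (.const 1)))))

theorem initial_bounded (input : List (List ℕ)) :
    Bounded (initial input) (inputLength input) := by
  have key : ∀ (l : List ℕ) (i : ℕ),
      Nat.size (l.getD i 0) ≤ (l.map fun x => Nat.size x + 1).sum := by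
    intro l
    induction l with
    | nil => intro i; simp
    | cons x l ih =>
      intro i
      cases i with
      | zero => simp; omega
      | succ i => have := ih i; simp at this ⊢; omega
  have key2 : ∀ (ls : List (List ℕ)) (j i : ℕ),
      Nat.size ((ls.getD j []).getD i 0) ≤ inputLength ls := by
    intro ls
    induction ls with
    | nil => intro j i; simp [inputLength]
    | cons l ls ih =>
      intro j i
      cases j with
      | zero =>
        have := key l i
        simp only [inputLength, List.map_cons, List.sum_cons, List.getD_cons_zero]
        omega
      | succ j =>
        have := ih j i
        simp only [inputLength, List.map_cons, List.sum_cons, List.getD_cons_succ] at this ⊢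
        omega
  refine ⟨fun x => by simp [initial], fun a i => ?_⟩
  cases a with
  | zero => simp [initial]
  | succ j => exact key2 input j i

/-- A problem admits a ratio if a tame program computes solutions of this ratio on all instances. -/
theorem EdgeProblem.admitsRatio_of_cmd {P : EdgeProblem} {ρ : P.Instance → ℚ≥0} (p : Cmd) (h : ℕ)
    (hp : p.tame h = true)
    (hlen : ∀ I, ∀ b < h, (initial (P.encode I)).arr 1 b ≤ inputLength (P.encode I))
    (hcorrect : ∀ I, (∃ J, P.Feasible I J) →
      P.Feasible I (outputSet (P.numEdges I) (p.exec (initial (P.encode I)))) ∧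
      ∀ J, P.Feasible I J →
        P.cost I (outputSet (P.numEdges I) (p.exec (initial (P.encode I)))) ≤ ρ I * P.cost I J) :
    P.AdmitsRatio ρ := by
  -- The input length serves both as the initial bound on the bit lengths and as the bound `L` on
  -- loops and input entries.
  obtain ⟨B, hB⟩ := IsPoly.cost p IsPoly.id
  refine ⟨p.compile, B, fun I => ?_⟩
  have hb := initial_bounded (P.encode I)
  obtain ⟨⟨t, hr, ht⟩, -⟩ := p.run_compile (initial (P.encode I)) _ hp hb
    ⟨fun a i _ _ => hb.2 a i, hlen I⟩
  exact ⟨_, t, hr, (hB _) ▸ ht, hcorrect I⟩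

end NetDesign

/-! ### Basic program rules and degrees in the contracted graph. -/

namespace NetDesign

open Finset

/-! ### Memory layout -/

notation "vThr" => 0
notation "vRound" => 1
notation "vI" => 2
notation "vJ" => 3
notation "vV" => 4
notation "vU" => 5
notation "vE" => 6
notation "vStep" => 7
notation "vS" => 8
notation "vT" => 9
notation "vDeg" => 10
notation "vSum" => 11
notation "vLbl" => 12
notation "vCnt" => 13
notation "vBest" => 14
notation "vMin" => 15
notation "vX" => 16
notation "vP" => 17
notation "vQ" => 18
notation "vOuter" => 19
notation "aEnd1" => 9
notation "aEnd2" => 10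
notation "aW" => 11
notation "aBase" => 12
notation "aSel" => 13
notation "aRed" => 14
notation "aCost" => 15
notation "aRep" => 16
notation "aRem" => 17
notation "aLab" => 18
notation "aOrd" => 19
notation "aCap" => 20

infixr:60 " ;; " => Cmd.seq

namespace Term

/-- Nonzero if and only if the values are equal. -/
def eqT (e f : Term) : Term := .sub (.const 1) (.add (.sub e f) (.sub f e))

/-- Nonzero if and only if the values differ. -/
def neT (e f : Term) : Term := .add (.sub e f) (.sub f e)

/-- The position of an entry of a square matrix. -/
def idx (e f : Term) : Term := .add (.mul e (.read 1 (.const 0))) f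

variable {s : State} {e f : Term}

theorem eqT_eval : (eqT e f).eval s ≠ 0 ↔ e.eval s = f.eval s := by
  simp only [eqT, Term.eval]; omega

theorem neT_eval : (neT e f).eval s ≠ 0 ↔ e.eval s ≠ f.eval s := by
  simp only [neT, Term.eval]; omega

theorem idx_eval : (idx e f).eval s = e.eval s * s.arr 1 0 + f.eval s := rfl

end Term

section Rules

variable {s : State} {x b N : ℕ} {p q : Cmd}

theorem exec_ite {e : Term} : (Cmd.ite e p q).exec s = if e.eval s ≠ 0 then p.exec s else q.exec s :=
  rfl

theorem exec_seq : (Cmd.seq p q).exec s = q.exec (p.exec s) := rfl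

theorem exec_skip : Cmd.skip.exec s = s := rfl

theorem exec_assign {e : Term} : (Cmd.assign x e).exec s = s.setVar x (e.eval s) := rfl

theorem exec_store {e f : Term} : (Cmd.store b e f).exec s = s.setArr b (e.eval s) (f.eval s) := rfl

/-- Induction over the rounds of a loop. -/
theorem exec_upto_induct (hN : s.arr 1 b = N) (I : ℕ → State → Prop) (h0 : I 0 s)
    (hstep : ∀ i t, i < N → (∀ y, p.writesVar y = false → y ≠ x → t.var y = s.var y) →
      (∀ a, p.writesArr a = false → t.arr a = s.arr a) → I i t → I (i + 1) (p.exec (t.setVar x i)))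
    (hx : ∀ t v, I N t → I N (t.setVar x v)) : I N ((Cmd.upto x b p).exec s) := by
  rw [Cmd.exec, hN]
  refine hx _ _ ?_
  have : ∀ i ≤ N, I i (loopState p.exec x s i) := by
    intro i
    induction i with
    | zero => intro _; exact h0
    | succ i ih =>
      intro hi
      exact hstep i _ (by omega) (fun y hy hyx => loopState_var hy hyx i)
        (fun a ha => loopState_arr ha i) (ih (by omega))
  exact this N le_rfl

end Rules

/-! ### Degrees in contracted graphs -/

/-- When `vV` is a marked representative, this is its degree `cutIn M rep R {v}` in the contracted
graph on the marked representatives `R`; see `Contracted.degCmd_eq`. -/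
def degCmd : Cmd :=
  .assign vDeg (.const 0) ;;
  .upto vI 0 (.ite (.eqT (.read aRep (.var vI)) (.var vV))
    (.upto vJ 0 (.ite (.eqT (.read aRep (.var vJ)) (.var vV)) .skip
      (.ite (.read aRem (.read aRep (.var vJ)))
        (.assign vDeg (.add (.var vDeg) (.read aW (.idx (.var vI) (.var vJ))))) .skip)))
    .skip)

/-- The contribution of position `i * n + j` to the degree of `v`. -/
def degEntry (s : State) (v i j : ℕ) : ℕ :=
  if s.arr aRep j = v then 0 else
    if s.arr aRem (s.arr aRep j) ≠ 0 then s.arr aW (i * s.arr 1 0 + j) else 0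

/-- The contribution of row `i` to the degree of `v`. -/
def degRow (s : State) (v i : ℕ) : ℕ :=
  if s.arr aRep i = v then ∑ j ∈ range (s.arr 1 0), degEntry s v i j else 0

theorem degCmd_spec (s : State) :
    (degCmd.exec s).var vDeg = ∑ i ∈ range (s.arr 1 0), degRow s (s.var vV) i := by
  unfold degCmd
  rw [exec_seq, exec_assign]
  refine exec_upto_induct (N := s.arr 1 0) ?_
    (fun N t => t.var vDeg = ∑ i ∈ range N, degRow s (s.var vV) i) ?_ ?_ (fun _ _ h => h)
  · rfl
  · rfl
  intro i t hi hv ha hI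
  have hV : t.var vV = s.var vV := hv vV rfl (by decide)
  have h1 : t.arr 1 = s.arr 1 := ha 1 rfl
  have h2 : t.arr aRep = s.arr aRep := ha aRep rfl
  have h3 : t.arr aRem = s.arr aRem := ha aRem rfl
  have h4 : t.arr aW = s.arr aW := ha aW rfl
  rw [sum_range_succ, ← hI, exec_ite, degRow]
  simp only [Term.eqT_eval]
  simp only [Term.eval, setVar_arr, setVar_var, h2, hV]
  norm_num
  split_ifs with hc; swap
  · simp [exec_skip]
  refine exec_upto_induct (N := s.arr 1 0) ?_
    (fun N u => u.var vDeg = t.var vDeg + ∑ j ∈ range N, degEntry s (s.var vV) i j) ?_ ?_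
    (fun _ _ h => h)
  · simp [h1]
  · simp
  intro j u hj hv' ha' hI'
  have hV' : u.var vV = s.var vV := by rw [hv' vV rfl (by decide)]; simpa using hV
  have hi' : u.var vI = i := by rw [hv' vI rfl (by decide)]; simp
  rw [sum_range_succ, ← add_assoc, ← hI', exec_ite, degEntry]
  simp only [Term.eqT_eval, exec_ite, exec_skip, exec_assign]
  simp only [Term.eval, setVar_arr, setVar_var, Term.idx_eval, ha' aRep rfl, ha' 1 rfl,
    ha' aRem rfl, ha' aW rfl, h1, h2, h3, h4, hV', hi']
  norm_num
  split_ifs <;> simp_all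

end NetDesign

/-! ### The weight matrix of the residual cut function. -/

namespace NetDesign

open Finset

variable {n m : ℕ}

/-! ### Building the weight matrix -/

/-- The matrix in array `aW`. -/
def matrixOf (s : State) (n : ℕ) : Fin n → Fin n → ℕ := fun i j => s.arr aW (i * n + j)

def zeroCmd : Cmd := .upto vI 0 (.upto vJ 0 (.store aW (.idx (.var vI) (.var vJ)) (.const 0)))

theorem index_inj {i a : ℕ} {j b : Fin n} : i * n + j = a * n + b ↔ i = a ∧ j = b := by
  constructor
  · intro h
    have hn : 0 < n := j.pos
    have hj := j.2
    have hb := b.2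
    have h1 : (i * n + j) / n = i := by
      rw [add_comm, Nat.add_mul_div_right _ _ hn, Nat.div_eq_of_lt hj, zero_add]
    have h2 : (a * n + b) / n = a := by
      rw [add_comm, Nat.add_mul_div_right _ _ hn, Nat.div_eq_of_lt hb, zero_add]
    have h3 : i = a := by rw [← h1, h, h2]
    subst h3
    exact ⟨rfl, Fin.ext (by omega)⟩
  · rintro ⟨rfl, rfl⟩; rfl

theorem zeroCmd_spec {s : State} (hn : s.arr 1 0 = n) :
    ∀ i j, matrixOf (zeroCmd.exec s) n i j = 0 := by
  have key : ∀ i : ℕ, i < n → ∀ j : Fin n, (zeroCmd.exec s).arr aW (i * n + j) = 0 := by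
    unfold zeroCmd
    refine exec_upto_induct (N := n) ?_
      (fun N t => ∀ i : ℕ, i < N → ∀ j : Fin n, t.arr aW (i * n + j) = 0) ?_ ?_ (fun _ _ h => h)
    · exact hn
    · simp
    intro i t hi hv ha hI
    have := exec_upto_induct (x := vJ) (b := 0) (N := n) (s := t.setVar vI i)
      (p := .store aW (.idx (.var vI) (.var vJ)) (.const 0))
      (by rw [setVar_arr, ha 1 rfl, hn])
      (fun N u => ∀ i' : ℕ, ∀ j : Fin n, i' < i ∨ (i' = i ∧ (j : ℕ) < N) →
        u.arr aW (i' * n + j) = 0) (by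
        intro i' j h
        exact hI i' (by omega) j) (by
        intro j u hj hv' ha' hJ i' j' h
        have hi' : u.var vI = i := by rw [hv' vI rfl (by decide)]; simp
        rw [exec_store, setArr_arr, Term.idx_eval]
        simp only [Term.eval, setVar_var, setVar_arr, ha' 1 rfl, ha 1 rfl, hn, hi']
        norm_num
        intro hne
        refine hJ i' j' ?_
        rcases h with h | ⟨rfl, h⟩
        · exact Or.inl h
        · right
          refine ⟨rfl, lt_of_le_of_ne (by omega) fun h' => hne (by rw [h'])⟩) (fun _ _ h => h)
    intro i' hi' j
    exact this i' j (by have := j.2; omega)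
  intro i j
  exact key i i.2 j

/-- One ordered entry. An undirected edge is entered in both orders, and a set that the edge crosses
counts exactly one of them in `matrixCut`. -/
def addMatrix (M : Fin n → Fin n → ℕ) (a b : Fin n) (w : ℕ) : Fin n → Fin n → ℕ :=
  fun i j => M i j + if i = a ∧ j = b then w else 0

theorem matrixCut_addMatrix (M : Fin n → Fin n → ℕ) (a b : Fin n) (w : ℕ) (S : Finset (Fin n)) :
    matrixCut (addMatrix M a b w) S = matrixCut M S + if a ∈ S ∧ b ∉ S then w else 0 := by
  have h1 : ∀ i j, (if i ∈ S ∧ j ∉ S then addMatrix M a b w i j else 0) =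
      (if i ∈ S ∧ j ∉ S then M i j else 0) +
        if i = a then (if j = b then (if a ∈ S ∧ b ∉ S then w else 0) else 0) else 0 := by
    intro i j
    unfold addMatrix
    by_cases hi : i = a <;> by_cases hj : j = b
    · subst hi; subst hj; split_ifs <;> simp_all
    all_goals simp [hi, hj]
  simp only [matrixCut, h1, sum_add_distrib]
  congr 1
  rw [sum_eq_single a, sum_eq_single b]
  · simp
  · intro j _ hj; simp [hj]
  · simp
  · intro i _ hi; simp [hi]
  · simp

theorem matrixOf_store (s : State) (a b : Fin n) (w : ℕ) :
    matrixOf (s.setArr aW (a * n + b) (s.arr aW (a * n + b) + w)) n =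
      addMatrix (matrixOf s n) a b w := by
  funext i j
  simp only [matrixOf, setArr_arr, addMatrix, if_true]
  by_cases h : i = a ∧ j = b
  · obtain ⟨rfl, rfl⟩ := h; simp
  · have : ¬ ((i : ℕ) * n + j = a * n + b) := by
      rw [index_inj, Fin.val_inj]; exact h
    rw [if_neg this, if_neg h, add_zero]

/-- For a loop both stores hit the same diagonal entry, which belongs to no cut. -/
def addBody (a b : ℕ) (cond w : Term) : Cmd :=
  .ite cond
    (.store aW (.idx (.read a (.var vE)) (.read b (.var vE)))
        (.add (.read aW (.idx (.read a (.var vE)) (.read b (.var vE)))) w) ;;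
      .store aW (.idx (.read b (.var vE)) (.read a (.var vE)))
        (.add (.read aW (.idx (.read b (.var vE)) (.read a (.var vE)))) w)) .skip

/-- Add the weights `w` of the edges that satisfy `cond` to the matrix in `aW`. -/
def addCmd (a b c : ℕ) (cond w : Term) : Cmd := .upto vE c (addBody a b cond w)

/-- The values of `cond` and `w` are required in every state that differs from `s` only in `vE` and
`aW`, because `w` is evaluated a second time after the first store. -/
theorem addCmd_spec {E : EdgeList n m} {a b c : ℕ} {cond w : Term} {s : State}
    (hn : s.arr 1 0 = n) (hc : s.arr 1 c = m) (ha : a ≠ aW) (hb : b ≠ aW)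
    (h1 : ∀ e : Fin m, s.arr a e = (E e).1) (h2 : ∀ e : Fin m, s.arr b e = (E e).2) {f g : Fin m → ℕ}
    (hcond : ∀ (e : Fin m) (t : State), t.var vE = (e : ℕ) → (∀ y, y ≠ vE → t.var y = s.var y) →
      (∀ d, d ≠ aW → t.arr d = s.arr d) → cond.eval t = f e)
    (hw : ∀ (e : Fin m) (t : State), t.var vE = (e : ℕ) → (∀ y, y ≠ vE → t.var y = s.var y) →
      (∀ d, d ≠ aW → t.arr d = s.arr d) → w.eval t = g e)
    (hsym : ∀ i j, matrixOf s n i j = matrixOf s n j i) :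
    (∀ i j, matrixOf ((addCmd a b c cond w).exec s) n i j =
      matrixOf ((addCmd a b c cond w).exec s) n j i) ∧
    ∀ S, matrixCut (matrixOf ((addCmd a b c cond w).exec s) n) S =
      matrixCut (matrixOf s n) S + cutWeight E (fun e => if f e ≠ 0 then g e else 0) S := by
  have := exec_upto_induct (x := vE) (b := c) (N := m) (s := s) (p := addBody a b cond w) hc
    (fun N t => (∀ i j, matrixOf t n i j = matrixOf t n j i) ∧
      ∀ S, matrixCut (matrixOf t n) S = matrixCut (matrixOf s n) S +
        ∑ e ∈ range N, if h : e < m then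
          (if ((E ⟨e, h⟩).1 ∈ S ↔ (E ⟨e, h⟩).2 ∈ S) then 0 else
            if f ⟨e, h⟩ ≠ 0 then g ⟨e, h⟩ else 0) else 0)
    ⟨hsym, by simp⟩ (by
      rintro i t hi hv hr ⟨hs, hI⟩
      have har : ∀ d, d ≠ aW → t.arr d = s.arr d := fun d hd =>
        hr d (by simp [addBody, Cmd.writesArr, hd])
      have hvr : ∀ y, y ≠ vE → (t.setVar vE i).var y = s.var y := fun y hy => by
        rw [setVar_var, if_neg hy]
        exact hv y (by simp [addBody, Cmd.writesVar]) hy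
      have hce := hcond ⟨i, hi⟩ (t.setVar vE i) (by simp) hvr har
      have hwe := hw ⟨i, hi⟩ (t.setVar vE i) (by simp) hvr har
      have e1 : t.arr a i = (E ⟨i, hi⟩).1 := by rw [har a ha]; exact h1 ⟨i, hi⟩
      have e2 : t.arr b i = (E ⟨i, hi⟩).2 := by rw [har b hb]; exact h2 ⟨i, hi⟩
      have e3 : t.arr 1 = s.arr 1 := har 1 (by decide)
      rw [addBody, exec_ite, hce]
      by_cases hf : f ⟨i, hi⟩ = 0
      · rw [if_neg (by simpa using hf)]
        refine ⟨hs, fun S => ?_⟩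
        rw [sum_range_succ, ← add_assoc, ← hI S, dif_pos hi, hf]
        simp only [ne_eq, not_true_eq_false, if_false, ite_self, add_zero]; rfl
      · rw [if_pos hf, exec_seq, exec_store, exec_store]
        set u := (t.setVar vE i).setArr aW
          ((Term.idx (.read a (.var vE)) (.read b (.var vE))).eval (t.setVar vE i))
          ((Term.add (.read aW (.idx (.read a (.var vE)) (.read b (.var vE)))) w).eval
            (t.setVar vE i)) with hu
        have hu' : u = (t.setVar vE i).setArr aW ((E ⟨i, hi⟩).1 * n + (E ⟨i, hi⟩).2)
            ((t.setVar vE i).arr aW ((E ⟨i, hi⟩).1 * n + (E ⟨i, hi⟩).2) + g ⟨i, hi⟩) := by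
          rw [hu]
          simp only [Term.eval, Term.idx_eval, hwe]
          simp [e1, e2, e3, hn]
        have hwu := hw ⟨i, hi⟩ u (by simp [hu']) (fun y hy => by rw [hu']; exact hvr y hy)
          (fun d hd => by
            rw [hu']; funext j; rw [setArr_arr, if_neg hd, setVar_arr, har d hd])
        have e4 : u.arr a i = (E ⟨i, hi⟩).1 := by rw [hu', setArr_arr, if_neg ha]; exact e1
        have e5 : u.arr b i = (E ⟨i, hi⟩).2 := by rw [hu', setArr_arr, if_neg hb]; exact e2
        have e6 : u.arr 1 0 = n := by rw [hu', setArr_arr, if_neg (by decide)]; rw [← hn, ← e3]; rfl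
        have e7 : u.var vE = i := by rw [hu']; simp
        have hfin : matrixOf (u.setArr aW
            ((Term.idx (.read b (.var vE)) (.read a (.var vE))).eval u)
            ((Term.add (.read aW (.idx (.read b (.var vE)) (.read a (.var vE)))) w).eval u)) n =
            addMatrix (addMatrix (matrixOf t n) (E ⟨i, hi⟩).1 (E ⟨i, hi⟩).2 (g ⟨i, hi⟩))
              (E ⟨i, hi⟩).2 (E ⟨i, hi⟩).1 (g ⟨i, hi⟩) := by
          have : matrixOf u n =
              addMatrix (matrixOf t n) (E ⟨i, hi⟩).1 (E ⟨i, hi⟩).2 (g ⟨i, hi⟩) := by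
            rw [hu', matrixOf_store]; rfl
          rw [← this, ← matrixOf_store]
          simp only [Term.eval, Term.idx_eval, hwu, e4, e5, e6, e7]
        rw [hfin]
        refine ⟨fun x y => ?_, fun S => ?_⟩
        · simp only [addMatrix, hs x y]
          have := hs
          rw [add_assoc, add_assoc]
          congr 1
          rw [add_comm]
          congr 1 <;> simp only [and_comm]
        · rw [matrixCut_addMatrix, matrixCut_addMatrix, hI, sum_range_succ, dif_pos hi,
            if_pos hf]
          by_cases p1 : (E ⟨i, hi⟩).1 ∈ S <;> by_cases p2 : (E ⟨i, hi⟩).2 ∈ S <;>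
            simp [p1, p2, add_assoc]) (fun _ _ h => h)
  refine ⟨this.1, fun S => ?_⟩
  rw [addCmd, this.2 S, cutWeight_eq_sum, sum_range]
  congr 1
  refine sum_congr rfl fun e _ => ?_
  rw [dif_pos e.2]

/-- Selected edges enter with the threshold as their weight, so that the cuts of the matrix are the
values of `residual`. -/
def buildCmd (mi : ℕ) : Cmd :=
  zeroCmd ;; addCmd 3 4 1 (.const 1) (.read aBase (.var vE)) ;;
    addCmd aEnd1 aEnd2 mi (.read aSel (.var vE)) (.var vThr)

/-- The input of the computation of the cores: the base edges with their weights, the edges that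
can be selected, and the threshold. -/
structure Layout (s : State) {n m₀ m : ℕ} (mi : ℕ) (E₀ : EdgeList n m₀) (w : Fin m₀ → ℕ)
    (E : EdgeList n m) (k : ℕ) : Prop where
  hn : s.arr 1 0 = n
  hm₀ : s.arr 1 1 = m₀
  hm : s.arr 1 mi = m
  fst₀ : ∀ e : Fin m₀, s.arr 3 e = (E₀ e).1
  snd₀ : ∀ e : Fin m₀, s.arr 4 e = (E₀ e).2
  base : ∀ e : Fin m₀, s.arr aBase e = w e
  fst : ∀ e : Fin m, s.arr aEnd1 e = (E e).1
  snd : ∀ e : Fin m, s.arr aEnd2 e = (E e).2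
  thr : s.var vThr = k

/-- The positions with nonzero entries. -/
def supportOf (f : ℕ → ℕ) (m : ℕ) : Finset (Fin m) := univ.filter fun e => f e ≠ 0

theorem mem_supportOf {f : ℕ → ℕ} {e : Fin m} : e ∈ supportOf f m ↔ f e ≠ 0 := by
  simp [supportOf]

section Layout

variable {m₀ mi k : ℕ} {E₀ : EdgeList n m₀} {w : Fin m₀ → ℕ} {E : EdgeList n m} {s t : State}

theorem Layout.congr (h : Layout s mi E₀ w E k) (h1 : t.arr 1 = s.arr 1) (h3 : t.arr 3 = s.arr 3)
    (h4 : t.arr 4 = s.arr 4) (hb : t.arr aBase = s.arr aBase) (he1 : t.arr aEnd1 = s.arr aEnd1)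
    (he2 : t.arr aEnd2 = s.arr aEnd2) (hv : t.var vThr = s.var vThr) :
    Layout t mi E₀ w E k :=
  ⟨h1 ▸ h.hn, h1 ▸ h.hm₀, h1 ▸ h.hm, h3 ▸ h.fst₀, h4 ▸ h.snd₀, hb ▸ h.base, he1 ▸ h.fst,
    he2 ▸ h.snd, hv ▸ h.thr⟩

theorem buildCmd_spec (h : Layout s mi E₀ w E k) :
    (∀ i j, matrixOf ((buildCmd mi).exec s) n i j = matrixOf ((buildCmd mi).exec s) n j i) ∧
    matrixCut (matrixOf ((buildCmd mi).exec s) n) =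
      residual (cutWeight E₀ w) k E (supportOf (s.arr aSel) m) := by
  rw [buildCmd, exec_seq, exec_seq]
  have z := zeroCmd_spec h.hn
  have zv : ∀ y, zeroCmd.writesVar y = false → (zeroCmd.exec s).var y = s.var y :=
    fun y hy => zeroCmd.exec_var s hy
  have za : ∀ d, d ≠ aW → (zeroCmd.exec s).arr d = s.arr d :=
    fun d hd => zeroCmd.exec_arr s (by simp [zeroCmd, Cmd.writesArr, hd])
  set s₁ := zeroCmd.exec s with hs₁
  have z2 := addCmd_spec (E := E₀) (a := 3) (b := 4) (c := 1) (cond := .const 1)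
    (w := .read aBase (.var vE)) (s := s₁) (f := fun _ => 1) (g := w)
    (by rw [za 1 (by decide), h.hn]) (by rw [za 1 (by decide), h.hm₀]) (by decide) (by decide)
    (by rw [za 3 (by decide)]; exact h.fst₀) (by rw [za 4 (by decide)]; exact h.snd₀)
    (fun _ _ _ _ _ => rfl)
    (fun e t ht _ hta => by
      rw [Term.eval, Term.eval, ht, hta aBase (by decide), za aBase (by decide), h.base])
    (by intro i j; rw [z, z])
  have ya : ∀ d, d ≠ aW →
      ((addCmd 3 4 1 (.const 1) (.read aBase (.var vE))).exec s₁).arr d = s.arr d :=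
    fun d hd => by
      rw [Cmd.exec_arr _ _ (by simp [addCmd, addBody, Cmd.writesArr, hd]), za d hd]
  have yv : ((addCmd 3 4 1 (.const 1) (.read aBase (.var vE))).exec s₁).var vThr = s.var vThr := by
    rw [Cmd.exec_var _ _ (by rfl), zv vThr (by rfl)]
  set s₂ := (addCmd 3 4 1 (.const 1) (.read aBase (.var vE))).exec s₁ with hs₂
  have z3 := addCmd_spec (E := E) (a := aEnd1) (b := aEnd2) (c := mi)
    (cond := .read aSel (.var vE)) (w := .var vThr) (s := s₂) (f := fun e => s.arr aSel e)
    (g := fun _ => k)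
    (by rw [ya 1 (by decide), h.hn]) (by rw [ya 1 (by decide), h.hm]) (by decide) (by decide)
    (by rw [ya aEnd1 (by decide)]; exact h.fst) (by rw [ya aEnd2 (by decide)]; exact h.snd)
    (fun e t ht _ hta => by
      rw [Term.eval, Term.eval, ht, hta aSel (by decide), ya aSel (by decide)])
    (fun e t _ htv _ => by rw [Term.eval, htv vThr (by decide), yv, h.thr]) z2.1
  refine ⟨z3.1, funext fun S => ?_⟩
  rw [z3.2, z2.2]
  have z0 : matrixCut (matrixOf s₁ n) S = 0 := by simp [matrixCut, z]
  rw [z0, residual, card_cut_eq_cutWeight]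
  simp only [cutWeight, mul_sum, supportOf, mem_filter, mem_univ, true_and]
  simp

end Layout

end NetDesign

/-! ### Minimum degree orderings and contractions as programs. -/

namespace NetDesign

open Finset

variable {n m : ℕ}

/-! ### Computing a flat pair -/

/-- The memory holds the weight matrix `M` and the representatives `rep`. -/
structure Contracted (s : State) (M : Fin n → Fin n → ℕ) (rep : Fin n → Fin n) : Prop where
  hn : s.arr 1 0 = n
  rep_eq : ∀ u : Fin n, s.arr aRep u = rep u
  mat : matrixOf s n = M

/-- Array `aRem` marks the set `R`. -/
def Marks (s : State) (R : Finset (Fin n)) : Prop := ∀ v : Fin n, s.arr aRem v ≠ 0 ↔ v ∈ R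

section Contracted

variable {s t : State} {M : Fin n → Fin n → ℕ} {rep : Fin n → Fin n} {R : Finset (Fin n)}

theorem Contracted.congr (h : Contracted s M rep) (h1 : t.arr 1 = s.arr 1)
    (h2 : t.arr aRep = s.arr aRep) (h3 : t.arr aW = s.arr aW) : Contracted t M rep :=
  ⟨h1 ▸ h.hn, h2 ▸ h.rep_eq, by rw [← h.mat]; unfold matrixOf; rw [h3]⟩

theorem Marks.congr (h : Marks s R) (h1 : t.arr aRem = s.arr aRem) : Marks t R := fun v => by
  rw [h1]; exact h v

theorem Contracted.degCmd_eq (h : Contracted s M rep) (hR : Marks s R) {v : Fin n} (hv : v ∈ R)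
    (hs : s.var vV = v) : (degCmd.exec s).var vDeg = cutIn M rep R {v} := by
  rw [degCmd_spec, h.hn, hs, sum_range, cutIn]
  refine sum_congr rfl fun i _ => ?_
  simp only [degRow, h.hn, h.rep_eq, Fin.val_inj]
  split_ifs with hi
  · rw [sum_range]
    refine sum_congr rfl fun j _ => ?_
    have hM : s.arr aW (i * n + j) = M i j := by rw [← h.mat]; rfl
    simp only [degEntry, h.hn, h.rep_eq, Fin.val_inj, hM]
    have hj := hR (rep j)
    simp only [mem_singleton, hi, hv, true_and]
    by_cases h1 : rep j = v
    · simp [h1]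
    · by_cases h2 : rep j ∈ R
      · simp [h1, h2, hj.2 h2]
      · have : s.arr aRem (rep j) = 0 := by
          by_contra h3; exact h2 (hj.1 h3)
        simp [h1, h2, this]
  · refine (sum_eq_zero fun j _ => ?_).symm
    simp [hi]

/-- Store in `vBest` one plus a marked vertex of minimum degree. -/
def minDegCmd : Cmd :=
  .assign vBest (.const 0) ;; .assign vMin (.const 0) ;;
  .upto vV 0 (.ite (.read aRem (.var vV)) (degCmd ;;
    .ite (.add (.sub (.const 1) (.var vBest)) (.sub (.var vMin) (.var vDeg)))
      (.assign vBest (.add (.var vV) (.const 1)) ;; .assign vMin (.var vDeg)) .skip) .skip)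

theorem minDegCmd_spec (h : Contracted s M rep) (hR : Marks s R) (hne : R.Nonempty) :
    ∃ v ∈ R, (minDegCmd.exec s).var vBest = v + 1 ∧
      ∀ x ∈ R, cutIn M rep R {v} ≤ cutIn M rep R {x} := by
  -- This is the loop invariant at the last round: `vBest = 0` stands for no marked vertex seen so
  -- far, which is why vertices are stored shifted by one.
  have key : ((minDegCmd.exec s).var vBest = 0 ∧ ∀ x ∈ R, n ≤ (x : ℕ)) ∨
      ∃ v ∈ R, (minDegCmd.exec s).var vBest = v + 1 ∧
        (minDegCmd.exec s).var vMin = cutIn M rep R {v} ∧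
        ∀ x ∈ R, (x : ℕ) < n → cutIn M rep R {v} ≤ cutIn M rep R {x} := by
    unfold minDegCmd
    rw [exec_seq, exec_seq, exec_assign, exec_assign]
    refine exec_upto_induct (N := n) ?_ (fun N t => (t.var vBest = 0 ∧ ∀ x ∈ R, N ≤ (x : ℕ)) ∨
      ∃ v ∈ R, t.var vBest = v + 1 ∧ t.var vMin = cutIn M rep R {v} ∧
        ∀ x ∈ R, (x : ℕ) < N → cutIn M rep R {v} ≤ cutIn M rep R {x}) ?_ ?_ (fun _ _ h => h)
    · exact h.hn
    · left
      refine ⟨?_, fun x _ => Nat.zero_le _⟩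
      simp [Term.eval]
    intro i t hi hv ha hI
    have hct : Contracted (t.setVar vV i) M rep := h.congr (ha 1 rfl) (ha aRep rfl) (ha aW rfl)
    have hmt : Marks (t.setVar vV i) R := hR.congr (ha aRem rfl)
    have hrem : (t.setVar vV i).arr aRem i = s.arr aRem i := by rw [setVar_arr, ha aRem rfl]; rfl
    have hcond : (Term.read aRem (.var vV)).eval (t.setVar vV i) = s.arr aRem i := by
      rw [Term.eval, Term.eval, setVar_var, if_pos rfl, hrem]
    rw [exec_ite, hcond]
    have hRi := hR ⟨i, hi⟩
    by_cases hiR : (⟨i, hi⟩ : Fin n) ∈ R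
    · rw [if_pos (hRi.2 hiR), exec_seq]
      have hdeg := hct.degCmd_eq hmt hiR (by simp)
      have d1 := degCmd.exec_var (t.setVar vV i) (x := vBest) rfl
      have d2 := degCmd.exec_var (t.setVar vV i) (x := vMin) rfl
      have d3 := degCmd.exec_var (t.setVar vV i) (x := vV) rfl
      rw [exec_ite]
      simp only [exec_seq, exec_assign, Term.eval, exec_skip, hdeg, d1, d2, d3]
      norm_num
      rcases hI with ⟨hb, hx⟩ | ⟨v, hvR, hb, hm, hx⟩
      · right
        simp only [hb]
        norm_num
        refine ⟨⟨i, hi⟩, hiR, by simp, by rw [hdeg], fun x hxR hxi => ?_⟩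
        have h1 := hx x hxR
        have : x = ⟨i, hi⟩ := Fin.ext (by simp; omega)
        rw [this]
      · right
        simp only [hb, hm]
        split_ifs with hc
        · have hc' := hc (by omega)
          refine ⟨⟨i, hi⟩, hiR, by simp, by simp [hdeg], fun x hxR hxi => ?_⟩
          by_cases hxi' : (x : ℕ) < i
          · have := hx x hxR hxi'
            omega
          · have : x = ⟨i, hi⟩ := Fin.ext (by simp; omega)
            rw [this]
        · refine ⟨v, hvR, by rw [d1]; simpa using hb, by rw [d2]; simpa using hm,
            fun x hxR hxi => ?_⟩
          by_cases hxi' : (x : ℕ) < i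
          · exact hx x hxR hxi'
          · have : x = ⟨i, hi⟩ := Fin.ext (by simp; omega)
            rw [this]
            by_contra hlt
            exact hc fun _ => by omega
    · rw [if_neg (fun h' => hiR (hRi.1 h')), exec_skip]
      have hxi' : ∀ x ∈ R, (x : ℕ) ≠ i := fun x hx hxi => hiR (by
        have : x = ⟨i, hi⟩ := Fin.ext hxi
        rwa [← this])
      rcases hI with ⟨hb, hx⟩ | ⟨v, hvR, hb, hm, hx⟩
      · left
        refine ⟨by simpa using hb, fun x hxR => ?_⟩
        have := hx x hxR
        have := hxi' x hxR
        omega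
      · right
        refine ⟨v, hvR, by simpa using hb, by simpa using hm, fun x hxR hxi => hx x hxR ?_⟩
        have := hxi' x hxR
        omega
  rcases key with ⟨-, hx⟩ | ⟨v, hv, hb, -, hx⟩
  · obtain ⟨x, hxR⟩ := hne
    have := hx x hxR
    have := x.2
    omega
  · exact ⟨v, hv, hb, fun x hxR => hx x hxR x.2⟩

/-- Count the marked vertices. -/
def countCmd : Cmd :=
  .assign vCnt (.const 0) ;;
  .upto vV 0 (.ite (.read aRem (.var vV)) (.assign vCnt (.add (.var vCnt) (.const 1))) .skip)

theorem countCmd_spec (hn : s.arr 1 0 = n) (hR : Marks s R) :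
    (countCmd.exec s).var vCnt = R.card := by
  have key : (countCmd.exec s).var vCnt = ∑ v ∈ range n, if s.arr aRem v ≠ 0 then 1 else 0 := by
    unfold countCmd
    rw [exec_seq, exec_assign]
    refine exec_upto_induct (N := n) ?_
      (fun N t => t.var vCnt = ∑ v ∈ range N, if s.arr aRem v ≠ 0 then 1 else 0) ?_ ?_
      (fun _ _ h => h)
    · exact hn
    · simp [Term.eval]
    intro i t hi hv ha hI
    have h3 : t.arr aRem = s.arr aRem := ha aRem rfl
    rw [sum_range_succ, ← hI, exec_ite]
    simp only [Term.eval, exec_assign, exec_skip, setVar_arr, h3, setVar_var]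
    norm_num
    split_ifs <;> simp_all
  rw [key, sum_range, ← card_filter]
  congr 1
  ext v
  simpa using hR v

/-- Unmark vertices of minimum degree until two marked vertices are left. -/
def peelCmd : Cmd :=
  .upto vX 0 (countCmd ;; .ite (.sub (.var vCnt) (.const 2))
    (minDegCmd ;; .store aRem (.sub (.var vBest) (.const 1)) (.const 0)) .skip)

/-- Each round unmarks a vertex of minimum degree while more than two are left, so `n` rounds
suffice. Flatness passes back from the last two vertices to `R` by `Flat.of_erase`. -/
theorem peelCmd_spec (hM : ∀ i j, M i j = M j i) (h : Contracted s M rep) (hR : Marks s R)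
    (hcard : 2 ≤ R.card) :
    ∃ R' ⊆ R, Marks (peelCmd.exec s) R' ∧ R'.card = 2 ∧
      ∀ x y, Flat M rep R' x y → Flat M rep R x y := by
  -- The term `n - n` is the invariant `max 2 (n - N)` at `N = n`.
  have key : ∃ R' ⊆ R, Marks (peelCmd.exec s) R' ∧ 2 ≤ R'.card ∧ R'.card ≤ max 2 (n - n) ∧
      ∀ x y, Flat M rep R' x y → Flat M rep R x y := by
    unfold peelCmd
    refine exec_upto_induct (N := n) ?_ (fun N t => ∃ R' ⊆ R, Marks t R' ∧ 2 ≤ R'.card ∧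
      R'.card ≤ max 2 (n - N) ∧ ∀ x y, Flat M rep R' x y → Flat M rep R x y) ?_ ?_ (fun _ _ h => h)
    · exact h.hn
    · refine ⟨R, Subset.rfl, hR, hcard, ?_, fun _ _ h => h⟩
      have := card_le_univ R
      rw [Fintype.card_fin] at this
      omega
    rintro i t hi hv ha ⟨R', hsub, hR', h2, hle, hfl⟩
    have hct : Contracted (t.setVar vX i) M rep := h.congr (ha 1 rfl) (ha aRep rfl) (ha aW rfl)
    have hmt : Marks (t.setVar vX i) R' := hR'
    have hcnt := countCmd_spec hct.hn hmt
    set u := countCmd.exec (t.setVar vX i) with hu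
    have hcu : Contracted u M rep := hct.congr (countCmd.exec_arr _ rfl) (countCmd.exec_arr _ rfl)
      (countCmd.exec_arr _ rfl)
    have hmu : Marks u R' := hmt.congr (countCmd.exec_arr _ rfl)
    rw [exec_seq, ← hu, exec_ite]
    simp only [Term.eval, hcnt]
    split_ifs with hc
    · obtain ⟨v, hvR, hb, hmin⟩ := minDegCmd_spec hcu hmu (card_pos.1 (by omega))
      refine ⟨R'.erase v, (erase_subset _ _).trans hsub, fun x => ?_, ?_, ?_, fun x y hxy =>
        hfl x y (Flat.of_erase hM hvR hmin hxy)⟩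
      · rw [exec_seq, exec_store, setArr_arr, if_pos rfl]
        simp only [Term.eval, hb, Nat.add_sub_cancel]
        rw [minDegCmd.exec_arr _ rfl]
        by_cases hxv : x = v
        · simp [hxv]
        · rw [if_neg (fun h' => hxv (Fin.ext h')), hmu x, mem_erase]
          simp [hxv]
      · rw [card_erase_of_mem hvR]; omega
      · rw [card_erase_of_mem hvR]; omega
    · exact ⟨R', hsub, hmu, h2, by omega, hfl⟩
  obtain ⟨R', hsub, h1, h2, h3, h4⟩ := key
  exact ⟨R', hsub, h1, by omega, h4⟩

/-- Store the two marked vertices in `vS` and `vT`. -/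
def pairCmd : Cmd :=
  .upto vV 0 (.ite (.read aRem (.var vV))
    (.assign vT (.var vS) ;; .assign vS (.var vV)) .skip)

theorem pairCmd_spec (hn : s.arr 1 0 = n) (hR : Marks s R) (hcard : R.card = 2) :
    ∃ x y : Fin n, x ≠ y ∧ R = {x, y} ∧ (pairCmd.exec s).var vS = x ∧
      (pairCmd.exec s).var vT = y := by
  have key : (R.filter (fun v : Fin n => (v : ℕ) < n) = ∅) ∨
      (∃ x : Fin n, R.filter (fun v : Fin n => (v : ℕ) < n) = {x} ∧ (pairCmd.exec s).var vS = x) ∨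
      ∃ x y : Fin n, x ≠ y ∧ R.filter (fun v : Fin n => (v : ℕ) < n) = {x, y} ∧
        (pairCmd.exec s).var vS = x ∧ (pairCmd.exec s).var vT = y := by
    unfold pairCmd
    refine exec_upto_induct (N := n) ?_
      (fun N t => (R.filter (fun v : Fin n => (v : ℕ) < N) = ∅) ∨
      (∃ x : Fin n, R.filter (fun v : Fin n => (v : ℕ) < N) = {x} ∧ t.var vS = x) ∨
      ∃ x y : Fin n, x ≠ y ∧ R.filter (fun v : Fin n => (v : ℕ) < N) = {x, y} ∧
        t.var vS = x ∧ t.var vT = y) ?_ ?_ (fun _ _ h => h)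
    · exact hn
    · left; simp
    intro i t hi hv ha hI
    have h3 : t.arr aRem = s.arr aRem := ha aRem rfl
    rw [exec_ite]
    simp only [Term.eval, setVar_arr, h3, setVar_var, if_true, exec_seq, exec_assign, exec_skip]
    have hRi := hR ⟨i, hi⟩
    by_cases hiR : (⟨i, hi⟩ : Fin n) ∈ R
    · have hins : R.filter (fun v : Fin n => (v : ℕ) < i + 1) =
          insert ⟨i, hi⟩ (R.filter (fun v : Fin n => (v : ℕ) < i)) := by
        ext v
        simp only [mem_filter, mem_insert]
        constructor
        · rintro ⟨h1, h2⟩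
          by_cases hvi : (v : ℕ) = i
          · exact Or.inl (Fin.ext hvi)
          · exact Or.inr ⟨h1, by omega⟩
        · rintro (rfl | ⟨h1, h2⟩)
          · exact ⟨hiR, by simp⟩
          · exact ⟨h1, by omega⟩
      have hnot : (⟨i, hi⟩ : Fin n) ∉ R.filter (fun v : Fin n => (v : ℕ) < i) := by simp
      rw [if_pos (hRi.2 hiR), hins]
      rcases hI with hI | ⟨x, hI, hx⟩ | ⟨x, y, hxy, hI, -⟩
      · right; left
        exact ⟨⟨i, hi⟩, by rw [hI]; rfl, by simp⟩
      · right; right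
        rw [hI, mem_singleton] at hnot
        exact ⟨⟨i, hi⟩, x, hnot, by rw [hI], by simp, by simp [hx]⟩
      · exfalso
        rw [hI] at hnot hins
        have h1 := card_le_card (filter_subset (fun v : Fin n => (v : ℕ) < i + 1) R)
        rw [hins, card_insert_of_notMem hnot, card_pair hxy] at h1
        omega
    · have hins : R.filter (fun v : Fin n => (v : ℕ) < i + 1) =
          R.filter (fun v : Fin n => (v : ℕ) < i) := by
        ext v
        simp only [mem_filter]
        refine and_congr_right fun h1 => ?_
        have : (v : ℕ) ≠ i := fun hvi => hiR (by
          have : v = ⟨i, hi⟩ := Fin.ext hvi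
          rwa [← this])
        omega
      rw [if_neg (fun h' => hiR (hRi.1 h')), hins]
      simpa using hI
  have hall : R.filter (fun v : Fin n => (v : ℕ) < n) = R := filter_true_of_mem fun v _ => v.2
  rw [hall] at key
  rcases key with h | ⟨x, h, -⟩ | h
  · simp [h] at hcard
  · simp [h] at hcard
  · exact h

/-- Mark the representatives. -/
def imageCmd : Cmd :=
  .upto vV 0 (.store aRem (.var vV) (.const 0)) ;;
  .upto vV 0 (.store aRem (.read aRep (.var vV)) (.const 1))

theorem imageCmd_spec (h : Contracted s M rep) : Marks (imageCmd.exec s) (univ.image rep) := by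
  unfold imageCmd
  rw [exec_seq]
  have h0 : ∀ v : Fin n, (v : ℕ) < n →
      ((Cmd.upto vV 0 (.store aRem (.var vV) (.const 0))).exec s).arr aRem v = 0 := by
    refine exec_upto_induct (N := n) ?_ (fun N t => ∀ v : Fin n, (v : ℕ) < N → t.arr aRem v = 0)
      ?_ ?_ (fun _ _ h => h)
    · exact h.hn
    · simp
    intro i t hi hv ha hI v hvi
    simp only [exec_store, Term.eval, setArr_arr, setVar_var, setVar_arr, if_true]
    split_ifs with hc
    · rfl
    · exact hI v (by omega)
  have f1 := (Cmd.upto vV 0 (.store aRem (.var vV) (.const 0))).exec_arr s (a := 1) rfl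
  have f2 := (Cmd.upto vV 0 (.store aRem (.var vV) (.const 0))).exec_arr s (a := aRep) rfl
  set u := (Cmd.upto vV 0 (.store aRem (.var vV) (.const 0))).exec s with hu
  have h1 : ∀ x : Fin n, ((Cmd.upto vV 0 (.store aRem (.read aRep (.var vV)) (.const 1))).exec
      u).arr aRem x ≠ 0 ↔ ∃ v : Fin n, (v : ℕ) < n ∧ rep v = x := by
    refine exec_upto_induct (N := n) ?_ (fun N t => ∀ x : Fin n, t.arr aRem x ≠ 0 ↔
      ∃ v : Fin n, (v : ℕ) < N ∧ rep v = x) ?_ ?_ (fun _ _ h => h)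
    · rw [f1]; exact h.hn
    · intro x; simp [h0 x x.2]
    intro i t hi hv ha hI x
    have f3 : t.arr aRep i = rep ⟨i, hi⟩ := by
      rw [ha aRep rfl, f2]; exact h.rep_eq ⟨i, hi⟩
    simp only [exec_store, Term.eval, setArr_arr, setVar_var, setVar_arr, if_true, f3, Fin.val_inj]
    split_ifs with hc
    · simp only [ne_eq, one_ne_zero, not_false_eq_true, true_iff]
      exact ⟨⟨i, hi⟩, by simp, hc.symm⟩
    · rw [hI]
      constructor
      · rintro ⟨v, h1, h2⟩; exact ⟨v, by omega, h2⟩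
      · rintro ⟨v, h1, h2⟩
        refine ⟨v, ?_, h2⟩
        have : (v : ℕ) ≠ i := fun hvi => hc (by
          have : v = ⟨i, hi⟩ := Fin.ext hvi
          rw [← this, h2])
        omega
  intro x
  rw [h1, mem_image]
  simp

/-- Merge the vertices represented by `vT` into those represented by `vS`. -/
def mergeCmd : Cmd :=
  .upto vV 0 (.ite (.eqT (.read aRep (.var vV)) (.var vT)) (.store aRep (.var vV) (.var vS)) .skip)

theorem mergeCmd_spec (h : Contracted s M rep) {x y : Fin n} (hx : s.var vS = x)
    (hy : s.var vT = y) : Contracted (mergeCmd.exec s) M (mergeRep rep x y) := by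
  refine ⟨?_, ?_, ?_⟩
  · rw [mergeCmd.exec_arr s (a := 1) rfl]; exact h.hn
  · have key : ∀ u : Fin n, (mergeCmd.exec s).arr aRep u =
        if (u : ℕ) < n then mergeRep rep x y u else rep u := by
      unfold mergeCmd
      refine exec_upto_induct (N := n) ?_ (fun N t => ∀ u : Fin n, t.arr aRep u =
        if (u : ℕ) < N then mergeRep rep x y u else rep u) ?_ ?_ (fun _ _ h => h)
      · exact h.hn
      · intro u; simp [h.rep_eq]
      intro i t hi hv ha hI u
      have h1 : t.var vS = x := by rw [hv vS rfl (by decide), hx]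
      have h2 : t.var vT = y := by rw [hv vT rfl (by decide), hy]
      have hIi := hI ⟨i, hi⟩
      simp only [lt_irrefl, if_false] at hIi
      have hcond : (Term.eqT (.read aRep (.var vV)) (.var vT)).eval (t.setVar vV i) ≠ 0 ↔
          rep ⟨i, hi⟩ = y := by
        rw [Term.eqT_eval, ← Fin.val_inj, ← hIi, ← h2]
        simp [Term.eval]
      have hlt : u ≠ ⟨i, hi⟩ → (u : ℕ) ≠ i ∧ ((u : ℕ) < i + 1 ↔ (u : ℕ) < i) := fun h' => by
        have : (u : ℕ) ≠ i := fun h'' => h' (Fin.ext h'')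
        omega
      rw [exec_ite]
      by_cases hc : rep ⟨i, hi⟩ = y
      · rw [if_pos (hcond.2 hc), exec_store, setArr_arr, if_pos rfl]
        by_cases hui : u = ⟨i, hi⟩
        · subst hui
          simp [Term.eval, mergeRep, hc, h1]
        · rw [if_neg (by simpa [Term.eval] using (hlt hui).1), setVar_arr, hI u]
          simp only [(hlt hui).2]
      · rw [if_neg (fun h' => hc (hcond.1 h')), exec_skip, setVar_arr]
        by_cases hui : u = ⟨i, hi⟩
        · subst hui
          simp [mergeRep, hc, hIi]
        · rw [hI u]
          simp only [(hlt hui).2]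
    intro u
    rw [key u, if_pos u.2]
  · rw [← h.mat]
    have : (mergeCmd.exec s).arr aW = s.arr aW := mergeCmd.exec_arr s rfl
    unfold matrixOf
    rw [this]

end Contracted

end NetDesign

/-! ### Computing all cores by labelling and merging. -/

namespace NetDesign

open Finset

variable {n m : ℕ}

/-! ### Computing the cores -/

/-- Array `aLab` holds the labels `L`. -/
def Labels (s : State) (L : Fin n → ℕ) : Prop := ∀ u : Fin n, s.arr aLab u = L u

theorem Labels.congr {s t : State} {L : Fin n → ℕ} (h : Labels s L)
    (h1 : t.arr aLab = s.arr aLab) : Labels t L := fun u => by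
  rw [h1]; exact h u

/-- The labels mark some of the cores, and the other cores are unions of classes of `rep`. -/
structure Labelled (s : State) (d : Finset (Fin n) → ℕ) (k : ℕ) (rep : Fin n → Fin n)
    (L : Fin n → ℕ) : Prop where
  labels : Labels s L
  le : ∀ u, L u ≤ s.var vLbl
  sound : Sound d k L
  pending : Pending d k rep L

theorem Labelled.congr {s t : State} {d : Finset (Fin n) → ℕ} {k : ℕ} {rep : Fin n → Fin n}
    {L : Fin n → ℕ} (h : Labelled s d k rep L) (h1 : t.arr aLab = s.arr aLab)
    (h2 : t.var vLbl = s.var vLbl) : Labelled t d k rep L :=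
  ⟨h.labels.congr h1, by rw [h2]; exact h.le, h.sound, h.pending⟩

section Cores

variable {s : State} {M : Fin n → Fin n → ℕ} {rep : Fin n → Fin n} {L : Fin n → ℕ} {k : ℕ}

/-- Add the labels in the class of `vV`. -/
def sumLabelCmd : Cmd :=
  .assign vSum (.const 0) ;;
  .upto vU 0 (.ite (.eqT (.read aRep (.var vU)) (.var vV))
    (.assign vSum (.add (.var vSum) (.read aLab (.var vU)))) .skip)

theorem sumLabelCmd_spec (h : Contracted s M rep) (hL : Labels s L) {v : Fin n}
    (hv : s.var vV = v) :
    (sumLabelCmd.exec s).var vSum ≠ 0 ↔ ∃ u, rep u = v ∧ L u ≠ 0 := by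
  have key : (sumLabelCmd.exec s).var vSum ≠ 0 ↔ ∃ u : Fin n, (u : ℕ) < n ∧ rep u = v ∧ L u ≠ 0 := by
    unfold sumLabelCmd
    rw [exec_seq, exec_assign]
    refine exec_upto_induct (N := n) ?_
      (fun N t => t.var vSum ≠ 0 ↔ ∃ u : Fin n, (u : ℕ) < N ∧ rep u = v ∧ L u ≠ 0) ?_ ?_
      (fun _ _ h => h)
    · exact h.hn
    · simp [Term.eval]
    intro i t hi hvr ha hI
    have h1 : t.arr aRep i = rep ⟨i, hi⟩ := by rw [ha aRep rfl]; exact h.rep_eq ⟨i, hi⟩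
    have h2 : t.arr aLab i = L ⟨i, hi⟩ := by rw [ha aLab rfl]; exact hL ⟨i, hi⟩
    have h3 : t.var vV = v := by rw [hvr vV rfl (by decide)]; exact hv
    have hcond : (Term.eqT (.read aRep (.var vU)) (.var vV)).eval (t.setVar vU i) ≠ 0 ↔
        rep ⟨i, hi⟩ = v := by
      rw [Term.eqT_eval, ← Fin.val_inj, ← h1, ← h3]
      simp [Term.eval]
    have hstep : (∃ u : Fin n, (u : ℕ) < i + 1 ∧ rep u = v ∧ L u ≠ 0) ↔
        (∃ u : Fin n, (u : ℕ) < i ∧ rep u = v ∧ L u ≠ 0) ∨ rep ⟨i, hi⟩ = v ∧ L ⟨i, hi⟩ ≠ 0 := by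
      constructor
      · rintro ⟨u, h4, h5⟩
        by_cases hui : (u : ℕ) = i
        · obtain rfl : u = ⟨i, hi⟩ := Fin.ext hui
          exact Or.inr h5
        · exact Or.inl ⟨u, by omega, h5⟩
      · rintro (⟨u, h4, h5⟩ | h5)
        · exact ⟨u, by omega, h5⟩
        · exact ⟨_, by simp, h5⟩
    rw [hstep, ← hI, exec_ite]
    by_cases hc : rep ⟨i, hi⟩ = v
    · rw [if_pos (hcond.2 hc), exec_assign]
      simp only [Term.eval, setVar_var, setVar_arr, if_true, h2, hc, true_and]
      norm_num
      tauto
    · rw [if_neg (fun h' => hc (hcond.1 h')), exec_skip]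
      simp [hc]
  rw [key]
  simp

/-- Label the class of `vV`. -/
def markCmd : Cmd :=
  .upto vU 0 (.ite (.eqT (.read aRep (.var vU)) (.var vV))
    (.store aLab (.var vU) (.var vLbl)) .skip)

theorem markCmd_spec (h : Contracted s M rep) (hL : Labels s L) {v : Fin n} (hv : s.var vV = v) :
    Labels (markCmd.exec s) (mark rep L v (s.var vLbl)) := by
  have key : ∀ u : Fin n, (markCmd.exec s).arr aLab u =
      if (u : ℕ) < n then mark rep L v (s.var vLbl) u else L u := by
    unfold markCmd
    refine exec_upto_induct (N := n) ?_ (fun N t => ∀ u : Fin n, t.arr aLab u =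
      if (u : ℕ) < N then mark rep L v (s.var vLbl) u else L u) ?_ ?_ (fun _ _ h => h)
    · exact h.hn
    · intro u; simpa using hL u
    intro i t hi hvr ha hI u
    have h1 : t.arr aRep i = rep ⟨i, hi⟩ := by rw [ha aRep rfl]; exact h.rep_eq ⟨i, hi⟩
    have h3 : t.var vV = v := by rw [hvr vV rfl (by decide), hv]
    have h4 : t.var vLbl = s.var vLbl := hvr vLbl rfl (by decide)
    have hcond : (Term.eqT (.read aRep (.var vU)) (.var vV)).eval (t.setVar vU i) ≠ 0 ↔
        rep ⟨i, hi⟩ = v := by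
      rw [Term.eqT_eval, ← Fin.val_inj, ← h1, ← h3]
      simp [Term.eval]
    have hlt : u ≠ ⟨i, hi⟩ → (u : ℕ) ≠ i ∧ ((u : ℕ) < i + 1 ↔ (u : ℕ) < i) := fun h' => by
      have : (u : ℕ) ≠ i := fun h'' => h' (Fin.ext h'')
      omega
    have hIi := hI ⟨i, hi⟩
    simp only [lt_irrefl, if_false] at hIi
    rw [exec_ite]
    by_cases hc : rep ⟨i, hi⟩ = v
    · rw [if_pos (hcond.2 hc), exec_store, setArr_arr, if_pos rfl]
      by_cases hui : u = ⟨i, hi⟩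
      · subst hui
        simp [Term.eval, mark, hc, h4]
      · rw [if_neg (by simpa [Term.eval] using (hlt hui).1), setVar_arr, hI u]
        simp only [(hlt hui).2]
    · rw [if_neg (fun h' => hc (hcond.1 h')), exec_skip, setVar_arr]
      by_cases hui : u = ⟨i, hi⟩
      · subst hui
        simp [mark, hc, hIi]
      · rw [hI u]
        simp only [(hlt hui).2]
  intro u
  rw [key u, if_pos u.2]

/-- Label the class of `vV` if it is small and has no labelled vertex. -/
def checkStepCmd : Cmd :=
  degCmd ;; sumLabelCmd ;; .ite (.var vSum) .skip
    (.ite (.sub (.var vThr) (.var vDeg))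
      (.assign vLbl (.add (.var vLbl) (.const 1)) ;; markCmd) .skip)

/-- A small class without labels is a core by `Pending.repClass_mem_cores`; it receives a label
larger than all earlier ones. A small class that already has a labelled vertex needs nothing, since
`Pending.merge` asks for no more. -/
theorem checkStepCmd_spec (h : Contracted s M rep) (hR : Marks s (univ.image rep))
    (hcard : 2 ≤ (univ.image rep).card) (hk : s.var vThr = k)
    (hL : Labelled s (matrixCut M) k rep L) {v : Fin n} (hv : v ∈ univ.image rep)
    (hsv : s.var vV = v) :
    ∃ L', Labelled (checkStepCmd.exec s) (matrixCut M) k rep L' ∧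
      (∀ u, L u ≠ 0 → L' u ≠ 0) ∧
      (matrixCut M (repClass rep v) < k → ∃ u, rep u = v ∧ L' u ≠ 0) := by
  have hdeg := h.degCmd_eq hR hv hsv
  rw [cutIn_image] at hdeg
  have hcls : (univ.filter fun i => rep i ∈ ({v} : Finset (Fin n))) = repClass rep v := by
    ext u; simp [repClass]
  rw [hcls] at hdeg
  set t := degCmd.exec s with ht
  have hct : Contracted t M rep :=
    h.congr (degCmd.exec_arr s rfl) (degCmd.exec_arr s rfl) (degCmd.exec_arr s rfl)
  have hLt : Labelled t (matrixCut M) k rep L := hL.congr (degCmd.exec_arr s rfl)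
    (degCmd.exec_var s rfl)
  have hvt : t.var vV = v := by rw [← hsv]; exact degCmd.exec_var s rfl
  have hkt : t.var vThr = k := by rw [← hk]; exact degCmd.exec_var s rfl
  have hsum := sumLabelCmd_spec hct hLt.labels hvt
  set u := sumLabelCmd.exec t with hu
  have hcu : Contracted u M rep := hct.congr (sumLabelCmd.exec_arr t rfl)
    (sumLabelCmd.exec_arr t rfl) (sumLabelCmd.exec_arr t rfl)
  have hLu : Labelled u (matrixCut M) k rep L := hLt.congr (sumLabelCmd.exec_arr t rfl)
    (sumLabelCmd.exec_var t rfl)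
  have hvu : u.var vV = v := by rw [← hvt]; exact sumLabelCmd.exec_var t rfl
  have hku : u.var vThr = k := by rw [← hkt]; exact sumLabelCmd.exec_var t rfl
  have hdu : u.var vDeg = matrixCut M (repClass rep v) := by
    rw [← hdeg]; exact sumLabelCmd.exec_var t rfl
  rw [checkStepCmd, exec_seq, exec_seq, ← ht, ← hu, exec_ite]
  by_cases hlab : ∃ u, rep u = v ∧ L u ≠ 0
  · rw [if_pos (by simpa [Term.eval] using hsum.2 hlab), exec_skip]
    exact ⟨L, hLu, fun _ h => h, fun _ => hlab⟩
  rw [if_neg (fun h' => hlab (hsum.1 (by simpa [Term.eval] using h'))), exec_ite]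
  simp only [Term.eval, hku, hdu]
  by_cases hlt : matrixCut M (repClass rep v) < k
  · rw [if_pos (by omega), exec_seq, exec_assign]
    have hL0 : ∀ u, rep u = v → L u = 0 := fun u hu => by
      by_contra h'; exact hlab ⟨u, hu, h'⟩
    set w := u.setVar vLbl ((Term.add (.var vLbl) (.const 1)).eval u) with hw
    have hwl : w.var vLbl = u.var vLbl + 1 := by simp [hw, Term.eval]
    have hlw : ∀ x, L x < w.var vLbl := fun x => by
      have := hLu.le x
      omega
    -- The class is a proper subset because at least two classes remain.
    have hsmall : Small (matrixCut M) k (repClass rep v) := by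
      refine ⟨?_, ?_, hlt⟩
      · obtain ⟨x, -, hx⟩ := mem_image.1 hv
        exact ⟨x, mem_repClass.2 hx⟩
      · intro huniv
        have : univ.image rep ⊆ {v} := fun y hy => by
          obtain ⟨x, -, rfl⟩ := mem_image.1 hy
          have : x ∈ repClass rep v := huniv ▸ mem_univ x
          rw [mem_singleton]
          exact mem_repClass.1 this
        have := card_le_card this
        rw [card_singleton] at this
        omega
    have hcore := hLu.pending.repClass_mem_cores hsmall hL0
    have hmk := markCmd_spec (s := w) (hcu.congr rfl rfl rfl) (hLu.labels.congr rfl) (v := v) (by simpa [hw] using hvu)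
    refine ⟨_, ⟨hmk, fun x => ?_, hLu.sound.mark hcore hL0 hlw, hLu.pending.mark hL0 hlw⟩,
      fun x hx => ?_, fun _ => ?_⟩
    · rw [markCmd.exec_var w (x := vLbl) rfl, mark]
      split_ifs
      · exact le_rfl
      · exact (hlw x).le
    · rw [mark]
      split_ifs
      · omega
      · exact hx
    · obtain ⟨x, -, hx⟩ := mem_image.1 hv
      refine ⟨x, hx, ?_⟩
      rw [mark, if_pos hx]
      omega
  · rw [if_neg (by omega), exec_skip]
    exact ⟨L, hLu, fun _ h => h, fun h' => absurd h' hlt⟩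

/-- Label the small classes. -/
def checkCmd : Cmd := .upto vV 0 (.ite (.read aRem (.var vV)) checkStepCmd .skip)

theorem checkCmd_spec (h : Contracted s M rep) (hR : Marks s (univ.image rep))
    (hcard : 2 ≤ (univ.image rep).card) (hk : s.var vThr = k)
    (hL : Labelled s (matrixCut M) k rep L) :
    ∃ L', Labelled (checkCmd.exec s) (matrixCut M) k rep L' ∧
      ∀ v ∈ univ.image rep, matrixCut M (repClass rep v) < k → ∃ u, rep u = v ∧ L' u ≠ 0 := by
  have key : ∃ L', Labelled (checkCmd.exec s) (matrixCut M) k rep L' ∧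
      ∀ v ∈ univ.image rep, (v : ℕ) < n → matrixCut M (repClass rep v) < k →
        ∃ u, rep u = v ∧ L' u ≠ 0 := by
    unfold checkCmd
    refine exec_upto_induct (N := n) ?_
      (fun N t => ∃ L', Labelled t (matrixCut M) k rep L' ∧
        ∀ v ∈ univ.image rep, (v : ℕ) < N → matrixCut M (repClass rep v) < k →
          ∃ u, rep u = v ∧ L' u ≠ 0) ?_ ?_
      (fun _ _ ⟨L', h1, h2⟩ => ⟨L', h1.congr rfl rfl, h2⟩)
    · exact h.hn
    · exact ⟨L, hL, by simp⟩
    rintro i t hi hvr ha ⟨L', hL', hI⟩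
    have hct : Contracted (t.setVar vV i) M rep := h.congr (ha 1 rfl) (ha aRep rfl) (ha aW rfl)
    have hmt : Marks (t.setVar vV i) (univ.image rep) := hR.congr (ha aRem rfl)
    have hkt : (t.setVar vV i).var vThr = k := by
      rw [setVar_var, if_neg (by decide), hvr vThr rfl (by decide), hk]
    have hcond : (Term.read aRem (.var vV)).eval (t.setVar vV i) ≠ 0 ↔
        (⟨i, hi⟩ : Fin n) ∈ univ.image rep := by
      rw [← hmt ⟨i, hi⟩]
      simp [Term.eval]
    have hsplit : ∀ v : Fin n, (v : ℕ) < i + 1 → (v : ℕ) < i ∨ v = ⟨i, hi⟩ := fun v hv => by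
      by_cases hvi : (v : ℕ) = i
      · exact Or.inr (Fin.ext hvi)
      · exact Or.inl (by omega)
    rw [exec_ite]
    by_cases hc : (⟨i, hi⟩ : Fin n) ∈ univ.image rep
    · rw [if_pos (hcond.2 hc)]
      obtain ⟨L'', h1, h2, h3⟩ := checkStepCmd_spec hct hmt hcard hkt (L := L')
        (hL'.congr rfl rfl) hc (by simp)
      refine ⟨L'', h1, fun v hv hvi hlt => ?_⟩
      rcases hsplit v hvi with h4 | rfl
      · obtain ⟨u, h5, h6⟩ := hI v hv h4 hlt
        exact ⟨u, h5, h2 u h6⟩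
      · exact h3 hlt
    · rw [if_neg (fun h' => hc (hcond.1 h')), exec_skip]
      refine ⟨L', hL'.congr rfl rfl, fun v hv hvi hlt => ?_⟩
      rcases hsplit v hvi with h4 | rfl
      · exact hI v hv h4 hlt
      · exact absurd hv hc
  obtain ⟨L', h1, h2⟩ := key
  exact ⟨L', h1, fun v hv => h2 v hv v.2⟩

/-- Label the small classes and merge a flat pair of classes. -/
def roundCmd : Cmd :=
  imageCmd ;; countCmd ;; .ite (.sub (.var vCnt) (.const 1))
    (checkCmd ;; peelCmd ;; pairCmd ;; mergeCmd) .skip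

/-- After `checkCmd` every small class has a labelled vertex, which is what merging the flat pair
requires. While two classes remain, a round reduces their number by at least one. -/
theorem roundCmd_spec (hM : ∀ i j, M i j = M j i) (hd : SymSubmodular (matrixCut M))
    (h : Contracted s M rep) (hk : s.var vThr = k) (hL : Labelled s (matrixCut M) k rep L) :
    ∃ rep' L', Contracted (roundCmd.exec s) M rep' ∧
      Labelled (roundCmd.exec s) (matrixCut M) k rep' L' ∧
      (univ.image rep').card ≤ max 1 ((univ.image rep).card - 1) := by
  have hR := imageCmd_spec h
  set t := imageCmd.exec s with ht
  have hct : Contracted t M rep := h.congr (imageCmd.exec_arr s rfl) (imageCmd.exec_arr s rfl)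
    (imageCmd.exec_arr s rfl)
  have hLt : Labelled t (matrixCut M) k rep L := hL.congr (imageCmd.exec_arr s rfl)
    (imageCmd.exec_var s rfl)
  have hkt : t.var vThr = k := by rw [← hk]; exact imageCmd.exec_var s rfl
  have hcnt := countCmd_spec hct.hn hR
  set u := countCmd.exec t with hu
  have hcu : Contracted u M rep := hct.congr (countCmd.exec_arr t rfl) (countCmd.exec_arr t rfl)
    (countCmd.exec_arr t rfl)
  have hLu : Labelled u (matrixCut M) k rep L := hLt.congr (countCmd.exec_arr t rfl)
    (countCmd.exec_var t rfl)
  have hku : u.var vThr = k := by rw [← hkt]; exact countCmd.exec_var t rfl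
  have hRu : Marks u (univ.image rep) := hR.congr (countCmd.exec_arr t rfl)
  rw [roundCmd, exec_seq, exec_seq, ← ht, ← hu, exec_ite]
  simp only [Term.eval, hcnt]
  by_cases hcard : 2 ≤ (univ.image rep).card; swap
  · rw [if_neg (by omega), exec_skip]
    exact ⟨rep, L, hcu, hLu, by omega⟩
  rw [if_pos (by omega), exec_seq, exec_seq, exec_seq]
  obtain ⟨L₁, hL₁, hchk⟩ := checkCmd_spec hcu hRu hcard hku hLu
  set v := checkCmd.exec u with hv
  have hcv : Contracted v M rep := hcu.congr (checkCmd.exec_arr u rfl) (checkCmd.exec_arr u rfl)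
    (checkCmd.exec_arr u rfl)
  have hRv : Marks v (univ.image rep) := hRu.congr (checkCmd.exec_arr u rfl)
  obtain ⟨R', hmem, hR', hR2, hflat⟩ := peelCmd_spec hM hcv hRv hcard
  set w := peelCmd.exec v with hw
  have hcw : Contracted w M rep := hcv.congr (peelCmd.exec_arr v rfl) (peelCmd.exec_arr v rfl)
    (peelCmd.exec_arr v rfl)
  have hLw : Labelled w (matrixCut M) k rep L₁ := hL₁.congr (peelCmd.exec_arr v rfl)
    (peelCmd.exec_var v rfl)
  obtain ⟨x, y, hxy, rfl, hx, hy⟩ := pairCmd_spec hcw.hn hR' hR2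
  set z := pairCmd.exec w with hz
  have hcz : Contracted z M rep := hcw.congr (pairCmd.exec_arr w rfl) (pairCmd.exec_arr w rfl)
    (pairCmd.exec_arr w rfl)
  have hLz : Labelled z (matrixCut M) k rep L₁ := hLw.congr (pairCmd.exec_arr w rfl)
    (pairCmd.exec_var w rfl)
  have hf : Flat M rep (univ.image rep) x y := hflat x y (flat_pair x y)
  refine ⟨mergeRep rep x y, L₁, mergeCmd_spec hcz hx hy,
    ⟨hLz.labels.congr (mergeCmd.exec_arr z rfl), ?_, hLz.sound,
      Pending.merge hd hLz.sound hLz.pending hchk hf⟩, ?_⟩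
  · rw [mergeCmd.exec_var z (x := vLbl) rfl]; exact hLz.le
  · have hsub : univ.image (mergeRep rep x y) ⊆ (univ.image rep).erase y := by
      intro a ha
      obtain ⟨b, -, rfl⟩ := mem_image.1 ha
      rw [mem_erase, mergeRep]
      split_ifs with hb
      · exact ⟨hxy, hmem (by simp)⟩
      · exact ⟨hb, mem_image_of_mem _ (mem_univ _)⟩
    have := card_le_card hsub
    rw [card_erase_of_mem (hmem (x := y) (by simp))] at this
    omega

/-- Start with singleton classes and no labels. -/
def initCmd : Cmd :=
  .upto vV 0 (.store aRep (.var vV) (.var vV) ;; .store aLab (.var vV) (.const 0)) ;;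
  .assign vLbl (.const 0)

theorem initCmd_spec (hn : s.arr 1 0 = n) :
    (∀ u : Fin n, (initCmd.exec s).arr aRep u = u) ∧ Labels (initCmd.exec s) (fun _ : Fin n => 0) := by
  have key : ∀ u : Fin n, (u : ℕ) < n → (initCmd.exec s).arr aRep u = u ∧
      (initCmd.exec s).arr aLab u = 0 := by
    unfold initCmd
    rw [exec_seq, exec_assign, setVar_arr]
    refine exec_upto_induct (N := n) ?_ (fun N t => ∀ u : Fin n, (u : ℕ) < N → t.arr aRep u = u ∧
      t.arr aLab u = 0) ?_ ?_ (fun _ _ h => h)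
    · exact hn
    · simp
    intro i t hi hvr ha hI u hui
    simp only [exec_seq, exec_store, Term.eval, setArr_arr, setArr_var, setVar_var, setVar_arr]
    norm_num
    by_cases h : (u : ℕ) = i
    · simp [h]
    · simpa [h] using hI u (by omega)
  exact ⟨fun u => (key u u.2).1, fun u => (key u u.2).2⟩

/-- Label the cores. -/
def coresCmd (mi : ℕ) : Cmd := buildCmd mi ;; initCmd ;; .upto vRound 0 roundCmd

theorem coresCmd_spec {m₀ mi : ℕ} {E₀ : EdgeList n m₀} {w : Fin m₀ → ℕ} {E : EdgeList n m}
    (h : Layout s mi E₀ w E k) :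
    ∃ L : Fin n → ℕ, Labels ((coresCmd mi).exec s) L ∧
      Sound (residual (cutWeight E₀ w) k E (supportOf (s.arr aSel) m)) k L ∧
      Complete (residual (cutWeight E₀ w) k E (supportOf (s.arr aSel) m)) k L := by
  obtain ⟨hM, hcut⟩ := buildCmd_spec h
  have hd : SymSubmodular (residual (cutWeight E₀ w) k E (supportOf (s.arr aSel) m)) :=
    (symSubmodular_cutWeight E₀ w).residual k E _
  rw [← hcut] at hd ⊢
  set M := matrixOf ((buildCmd mi).exec s) n with hMdef
  rw [coresCmd, exec_seq, exec_seq]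
  have hn1 : ((buildCmd mi).exec s).arr 1 0 = n := by
    rw [← h.hn, Cmd.exec_arr _ _ rfl]
  obtain ⟨hrep, hlab⟩ := initCmd_spec hn1
  set t := initCmd.exec ((buildCmd mi).exec s) with ht
  have hct : Contracted t M id := by
    refine ⟨?_, hrep, ?_⟩
    · rw [← hn1, ht, Cmd.exec_arr _ _ rfl]
    · rw [hMdef, ht]
      unfold matrixOf
      rw [Cmd.exec_arr initCmd _ rfl]
  have hkt : t.var vThr = k := by
    rw [ht, Cmd.exec_var _ _ rfl, Cmd.exec_var _ _ rfl, h.thr]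
  have key : ∃ rep L, Contracted ((Cmd.upto vRound 0 roundCmd).exec t) M rep ∧
      Labelled ((Cmd.upto vRound 0 roundCmd).exec t) (matrixCut M) k rep L ∧
      (univ.image rep).card ≤ max 1 (n - n) := by
    refine exec_upto_induct (N := n) ?_ (fun N u => ∃ rep L, Contracted u M rep ∧
      Labelled u (matrixCut M) k rep L ∧ (univ.image rep).card ≤ max 1 (n - N)) ?_ ?_ ?_
    · exact hct.hn
    -- Initially the classes are singletons, and every set is a union of singletons.
    · refine ⟨id, fun _ => 0, hct, ⟨hlab, fun _ => Nat.zero_le _, fun v hv => absurd rfl hv,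
        fun C _ => Or.inr fun u v huv hu => ?_⟩, ?_⟩
      · obtain rfl : u = v := huv
        exact hu
      · rw [image_id, card_fin]; omega
    · rintro i u hi hvr ha ⟨rep, L, hcu, hLu, hle⟩
      obtain ⟨rep', L', h1, h2, h3⟩ := roundCmd_spec hM hd (s := u.setVar vRound i) (k := k)
        (hcu.congr rfl rfl rfl)
        (by rw [setVar_var, if_neg (by decide), hvr vThr rfl (by decide), hkt])
        (hLu.congr rfl (by simp))
      exact ⟨rep', L', h1, h2, by omega⟩
    · rintro u v ⟨rep, L, hcu, hLu, hle⟩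
      exact ⟨rep, L, hcu.congr rfl rfl rfl, hLu.congr rfl (by simp), hle⟩
  obtain ⟨rep, L, h1, h2, h3⟩ := key
  exact ⟨L, h2.labels, h2.sound, h2.pending.complete (by omega)⟩

end Cores

end NetDesign

/-! ### The primal-dual program: selection, cost reduction, reverse deletion. -/

namespace NetDesign

open Finset

variable {n m : ℕ}

/-! ### Selecting an edge -/

/-- Programs that do not write the layout preserve it. -/
theorem Layout.exec {s : State} {m₀ mi k : ℕ} {E₀ : EdgeList n m₀} {w : Fin m₀ → ℕ}
    {E : EdgeList n m} (h : Layout s mi E₀ w E k) (p : Cmd) (h1 : p.writesArr 1 = false)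
    (h3 : p.writesArr 3 = false) (h4 : p.writesArr 4 = false) (hb : p.writesArr aBase = false)
    (he1 : p.writesArr aEnd1 = false) (he2 : p.writesArr aEnd2 = false)
    (hv : p.writesVar vThr = false) : Layout (p.exec s) mi E₀ w E k :=
  h.congr (p.exec_arr s h1) (p.exec_arr s h3) (p.exec_arr s h4) (p.exec_arr s hb)
    (p.exec_arr s he1) (p.exec_arr s he2) (p.exec_var s hv)

/-- The number of nonzero labels that an edge separates. -/
def labelCount (L : Fin n → ℕ) (E : EdgeList n m) (g : Fin m) : ℕ :=
  if L (E g).1 = L (E g).2 then 0 else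
    (if L (E g).1 = 0 then 0 else 1) + (if L (E g).2 = 0 then 0 else 1)

theorem labelCount_le (L : Fin n → ℕ) (E : EdgeList n m) (g : Fin m) : labelCount L E g ≤ 2 := by
  unfold labelCount
  split_ifs <;> omega

/-- The memory holds labels and the ends of the edges. -/
structure Labelling (s : State) (mi : ℕ) (E : EdgeList n m) (L : Fin n → ℕ) : Prop where
  hm : s.arr 1 mi = m
  fst : ∀ e : Fin m, s.arr aEnd1 e = (E e).1
  snd : ∀ e : Fin m, s.arr aEnd2 e = (E e).2
  labels : Labels s L

theorem Labelling.congr {s t : State} {mi : ℕ} {E : EdgeList n m} {L : Fin n → ℕ}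
    (h : Labelling s mi E L) (h1 : t.arr 1 = s.arr 1) (h2 : t.arr aEnd1 = s.arr aEnd1)
    (h3 : t.arr aEnd2 = s.arr aEnd2) (h4 : t.arr aLab = s.arr aLab) : Labelling t mi E L :=
  ⟨h1 ▸ h.hm, h2 ▸ h.fst, h3 ▸ h.snd, h.labels.congr h4⟩

section Select

variable {s : State} {mi : ℕ} {E : EdgeList n m} {L : Fin n → ℕ}

/-- Count the nonzero labels that the edge `vE` separates. -/
def crossCmd : Cmd :=
  .assign vCnt (.const 0) ;; .assign vP (.read aLab (.read aEnd1 (.var vE))) ;;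
  .assign vQ (.read aLab (.read aEnd2 (.var vE))) ;;
  .ite (.neT (.var vP) (.var vQ))
    (.ite (.var vP) (.assign vCnt (.add (.var vCnt) (.const 1))) .skip ;;
      .ite (.var vQ) (.assign vCnt (.add (.var vCnt) (.const 1))) .skip) .skip

theorem crossCmd_spec (h : Labelling s mi E L) {e : Fin m} (he : s.var vE = e) :
    (crossCmd.exec s).var vCnt = labelCount L E e := by
  have h1 := h.labels (E e).1
  have h2 := h.labels (E e).2
  rw [← h.fst e] at h1
  rw [← h.snd e] at h2
  simp only [crossCmd, exec_seq, exec_assign, exec_ite, exec_skip, Term.neT_eval]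
  simp only [Term.eval, setVar_var, setVar_arr, he]
  norm_num
  rw [h1, h2]
  unfold labelCount
  by_cases hne : L (E e).1 = L (E e).2
  · simp [hne]
  by_cases p1 : L (E e).1 = 0 <;> by_cases p2 : L (E e).2 = 0 <;> simp_all

/-- Store in `vBest` one plus a separating edge of minimum relative cost. -/
def bestCmd (mi : ℕ) : Cmd :=
  .assign vBest (.const 0) ;; .assign vMin (.const 0) ;;
  .upto vE mi (crossCmd ;; .ite (.var vCnt)
    (.assign vX (.div (.add (.read aRed (.var vE)) (.read aRed (.var vE))) (.var vCnt)) ;;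
      .ite (.add (.sub (.const 1) (.var vBest)) (.sub (.var vMin) (.var vX)))
        (.assign vBest (.add (.var vE) (.const 1)) ;; .assign vMin (.var vX)) .skip) .skip)

/-- The compared quantity is the dual increase at which the doubled cost of an edge becomes used up.
The numerator is even and the divisor is `1` or `2`, so the integer quotient is exact. -/
theorem bestCmd_spec (h : Labelling s mi E L) :
    (((bestCmd mi).exec s).var vBest = 0 ∧ ∀ g, labelCount L E g = 0) ∨
    ∃ e, 0 < labelCount L E e ∧ ((bestCmd mi).exec s).var vBest = e + 1 ∧
      ((bestCmd mi).exec s).var vMin = (s.arr aRed e + s.arr aRed e) / labelCount L E e ∧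
      ∀ g, 0 < labelCount L E g → ((bestCmd mi).exec s).var vMin ≤
        (s.arr aRed g + s.arr aRed g) / labelCount L E g := by
  have key : (((bestCmd mi).exec s).var vBest = 0 ∧
      ∀ g : Fin m, (g : ℕ) < m → labelCount L E g = 0) ∨
      ∃ e, 0 < labelCount L E e ∧ ((bestCmd mi).exec s).var vBest = e + 1 ∧
        ((bestCmd mi).exec s).var vMin = (s.arr aRed e + s.arr aRed e) / labelCount L E e ∧
        ∀ g : Fin m, (g : ℕ) < m → 0 < labelCount L E g → ((bestCmd mi).exec s).var vMin ≤
          (s.arr aRed g + s.arr aRed g) / labelCount L E g := by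
    unfold bestCmd
    rw [exec_seq, exec_seq, exec_assign, exec_assign]
    refine exec_upto_induct (N := m) ?_ (fun N t =>
      (t.var vBest = 0 ∧ ∀ g : Fin m, (g : ℕ) < N → labelCount L E g = 0) ∨
      ∃ e, 0 < labelCount L E e ∧ t.var vBest = e + 1 ∧
        t.var vMin = (s.arr aRed e + s.arr aRed e) / labelCount L E e ∧
        ∀ g : Fin m, (g : ℕ) < N → 0 < labelCount L E g → t.var vMin ≤
          (s.arr aRed g + s.arr aRed g) / labelCount L E g) ?_ ?_ (fun _ _ h => h)
    · exact h.hm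
    · left
      exact ⟨by simp [Term.eval], by simp⟩
    intro i t hi hv ha hI
    have hlt : Labelling (t.setVar vE i) mi E L :=
      h.congr (ha 1 rfl) (ha aEnd1 rfl) (ha aEnd2 rfl) (ha aLab rfl)
    have hx := crossCmd_spec hlt (e := ⟨i, hi⟩) (by simp)
    have d1 : (crossCmd.exec (t.setVar vE i)).var vBest = t.var vBest :=
      crossCmd.exec_var (t.setVar vE i) rfl
    have d2 : (crossCmd.exec (t.setVar vE i)).var vMin = t.var vMin :=
      crossCmd.exec_var (t.setVar vE i) rfl
    have d3 : (crossCmd.exec (t.setVar vE i)).var vE = i := by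
      rw [crossCmd.exec_var (t.setVar vE i) rfl]; simp
    have d4 : (crossCmd.exec (t.setVar vE i)).arr aRed = s.arr aRed := by
      rw [crossCmd.exec_arr (t.setVar vE i) rfl]; exact ha aRed rfl
    rw [exec_seq]
    set u := crossCmd.exec (t.setVar vE i) with hu
    have hsplit : ∀ g : Fin m, (g : ℕ) < i + 1 → (g : ℕ) < i ∨ g = ⟨i, hi⟩ := fun g hg => by
      by_cases hgi : (g : ℕ) = i
      · exact Or.inr (Fin.ext hgi)
      · exact Or.inl (by omega)
    rw [exec_ite]
    simp only [Term.eval, hx]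
    by_cases hc : labelCount L E ⟨i, hi⟩ = 0
    · rw [if_neg (by simpa using hc), exec_skip, d1, d2]
      rcases hI with ⟨hb, hg⟩ | ⟨e, he, hb, hmin, hg⟩
      · refine Or.inl ⟨hb, fun g hgi => ?_⟩
        rcases hsplit g hgi with h' | rfl
        · exact hg g h'
        · exact hc
      · refine Or.inr ⟨e, he, hb, hmin, fun g hgi hpos => ?_⟩
        rcases hsplit g hgi with h' | rfl
        · exact hg g h' hpos
        · omega
    rw [if_pos hc, exec_seq, exec_assign, exec_ite]
    simp only [exec_seq, exec_assign, exec_skip, Term.eval, setVar_var, d3, d4, hx, d1, d2]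
    norm_num
    set y := (s.arr aRed i + s.arr aRed i) / labelCount L E ⟨i, hi⟩ with hy
    rcases hI with ⟨hb, hg⟩ | ⟨e, he, hb, hmin, hg⟩
    · right
      simp only [hb]
      norm_num
      refine ⟨⟨i, hi⟩, Nat.pos_of_ne_zero hc, rfl, rfl, fun g hgi hpos => ?_⟩
      rcases hsplit g (by omega) with h' | rfl
      · have := hg g h'
        omega
      · exact le_rfl
    · right
      rw [hb]
      split_ifs with hcond
      · refine ⟨⟨i, hi⟩, Nat.pos_of_ne_zero hc, by simp, by simp [hy], fun g hgi hpos => ?_⟩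
        have := hcond (by omega)
        rcases hsplit g (by omega) with h' | rfl
        · have := hg g h' hpos
          simp
          omega
        · simp [hy]
      · refine ⟨e, he, by simp [d1, hb], by simpa [d2] using hmin, fun g hgi hpos => ?_⟩
        have hle : t.var vMin ≤ y := by
          by_contra h'
          exact hcond fun _ => by omega
        rcases hsplit g (by omega) with h' | rfl
        · simpa [d2] using hg g h' hpos
        · simpa [d2] using hle
  rcases key with ⟨hb, hg⟩ | ⟨e, he, hb, hmin, hg⟩
  · exact Or.inl ⟨hb, fun g => hg g g.2⟩
  · exact Or.inr ⟨e, he, hb, hmin, fun g => hg g g.2⟩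

/-- Double the costs and subtract `vMin` for each separated label. -/
def reduceCmd (mi : ℕ) : Cmd :=
  .upto vE mi (crossCmd ;; .ite (.var vCnt)
    (.ite (.sub (.var vCnt) (.const 1))
      (.store aRed (.var vE) (.sub (.add (.read aRed (.var vE)) (.read aRed (.var vE)))
        (.add (.var vMin) (.var vMin))))
      (.store aRed (.var vE) (.sub (.add (.read aRed (.var vE)) (.read aRed (.var vE)))
        (.var vMin))))
    (.store aRed (.var vE) (.add (.read aRed (.var vE)) (.read aRed (.var vE)))))

/-- The program distinguishes the counts `0`, `1`, `2` and adds `vMin` to itself, because a product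
of two computed numbers is not tame. The subtraction is truncated here; it is exact for the minimum
found by `bestCmd`. -/
theorem reduceCmd_spec (h : Labelling s mi E L) (g : Fin m) :
    ((reduceCmd mi).exec s).arr aRed g = 2 * s.arr aRed g - s.var vMin * labelCount L E g := by
  have key : ∀ g : Fin m, ((reduceCmd mi).exec s).arr aRed g =
      if (g : ℕ) < m then 2 * s.arr aRed g - s.var vMin * labelCount L E g else s.arr aRed g := by
    unfold reduceCmd
    refine exec_upto_induct (N := m) ?_ (fun N t => ∀ g : Fin m, t.arr aRed g =
      if (g : ℕ) < N then 2 * s.arr aRed g - s.var vMin * labelCount L E g else s.arr aRed g)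
      ?_ ?_ (fun _ _ h => h)
    · exact h.hm
    · simp
    intro i t hi hv ha hI g
    have hlt : Labelling (t.setVar vE i) mi E L :=
      h.congr (ha 1 rfl) (ha aEnd1 rfl) (ha aEnd2 rfl) (ha aLab rfl)
    have hx := crossCmd_spec hlt (e := ⟨i, hi⟩) (by simp)
    have d2 : (crossCmd.exec (t.setVar vE i)).var vMin = s.var vMin := by
      rw [crossCmd.exec_var (t.setVar vE i) rfl, setVar_var, if_neg (by decide),
        hv vMin rfl (by decide)]
    have d3 : (crossCmd.exec (t.setVar vE i)).var vE = i := by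
      rw [crossCmd.exec_var (t.setVar vE i) rfl]; simp
    have d4 : (crossCmd.exec (t.setVar vE i)).arr aRed = t.arr aRed :=
      crossCmd.exec_arr (t.setVar vE i) rfl
    rw [exec_seq]
    set u := crossCmd.exec (t.setVar vE i) with hu
    have hIi := hI ⟨i, hi⟩
    simp only [lt_irrefl, if_false] at hIi
    have hle := labelCount_le L E ⟨i, hi⟩
    have hval : (Cmd.ite (.var vCnt)
        (.ite (.sub (.var vCnt) (.const 1))
          (.store aRed (.var vE) (.sub (.add (.read aRed (.var vE)) (.read aRed (.var vE)))
            (.add (.var vMin) (.var vMin))))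
          (.store aRed (.var vE) (.sub (.add (.read aRed (.var vE)) (.read aRed (.var vE)))
            (.var vMin))))
        (.store aRed (.var vE) (.add (.read aRed (.var vE)) (.read aRed (.var vE))))).exec u =
        u.setArr aRed i (2 * s.arr aRed i - s.var vMin * labelCount L E ⟨i, hi⟩) := by
      simp only [exec_ite, exec_store, Term.eval, hx, d2, d3, d4, hIi]
      interval_cases hq : labelCount L E ⟨i, hi⟩ <;> norm_num <;> congr 1 <;> omega
    rw [hval, setArr_arr, if_pos rfl, d4]
    by_cases hgi : g = ⟨i, hi⟩
    · subst hgi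
      simp
    · have h1 : (g : ℕ) ≠ i := fun h' => hgi (Fin.ext h')
      have h2 : (g : ℕ) < i + 1 ↔ (g : ℕ) < i := by omega
      rw [if_neg h1, hI g]
      simp only [h2]
  rw [key g, if_pos g.2]

end Select

section Core

variable {s : State} {m₀ mi k : ℕ} {E₀ : EdgeList n m₀} {w : Fin m₀ → ℕ} {E : EdgeList n m}

/-- The edge with number `x`, where `0` stands for no edge. -/
def edgeOf (m x : ℕ) : Option (Fin m) := if h : x - 1 < m ∧ x ≠ 0 then some ⟨x - 1, h.1⟩ else none

theorem edgeOf_zero : edgeOf m 0 = none := by simp [edgeOf]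

theorem edgeOf_succ (e : Fin m) : edgeOf m (e + 1) = some e := by simp [edgeOf]

theorem edgeOf_cases {x : ℕ} (hx : x ≤ m) :
    x = 0 ∧ edgeOf m x = none ∨ ∃ e : Fin m, x = e + 1 ∧ edgeOf m x = some e := by
  cases x with
  | zero => exact Or.inl ⟨rfl, edgeOf_zero⟩
  | succ x => exact Or.inr ⟨⟨x, hx⟩, rfl, edgeOf_succ ⟨x, hx⟩⟩

/-- Select an edge and reduce the costs. -/
def selectCmd (mi : ℕ) : Cmd :=
  coresCmd mi ;; bestCmd mi ;; .store aOrd (.var vStep) (.var vBest) ;;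
  .ite (.var vBest) (reduceCmd mi ;; .store aSel (.sub (.var vBest) (.const 1)) (.const 1)) .skip

theorem supportOf_insert {f : ℕ → ℕ} {e : Fin m} {v : ℕ} (hv : v ≠ 0) :
    supportOf (Function.update f e v) m = insert e (supportOf f m) := by
  ext x
  rw [mem_supportOf, mem_insert, mem_supportOf]
  by_cases h : x = e
  · simp [h, hv]
  · rw [Function.update_of_ne (fun h' => h (Fin.ext h'))]; simp [h]

theorem supportOf_erase {f : ℕ → ℕ} {e : Fin m} :
    supportOf (Function.update f e 0) m = (supportOf f m).erase e := by
  ext x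
  rw [mem_supportOf, mem_erase, mem_supportOf]
  by_cases h : x = e
  · simp [h]
  · rw [Function.update_of_ne (fun h' => h (Fin.ext h'))]; simp [h]

theorem setArr_arr_self {a i v : ℕ} : (s.setArr a i v).arr a = Function.update (s.arr a) i v := by
  simp [State.setArr]

/-- Besides the step itself, the record of the selection order matters: only the entry of the
current step is written, so reverse deletion can read the whole order afterwards. -/
theorem selectCmd_spec (h : Layout s mi E₀ w E k) :
    SelectStep (cutWeight E₀ w) k E (supportOf (s.arr aSel) m)
      (supportOf (((selectCmd mi).exec s).arr aSel) m) (fun e => s.arr aRed e)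
      (fun e => ((selectCmd mi).exec s).arr aRed e)
      (edgeOf m (((selectCmd mi).exec s).arr aOrd (s.var vStep))) ∧
    ((selectCmd mi).exec s).arr aOrd (s.var vStep) ≤ m ∧
    ∀ i ≠ s.var vStep, ((selectCmd mi).exec s).arr aOrd i = s.arr aOrd i := by
  obtain ⟨L, hL, hs, hc⟩ := coresCmd_spec h
  have hcross : ∀ g, crossCount (cutWeight E₀ w) k E (supportOf (s.arr aSel) m) g =
      labelCount L E g := fun g => by
    rw [crossCount, card_cores_crossed hs hc, labelCount]
  set t := (coresCmd mi).exec s with ht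
  have hlt : Labelling t mi E L := by
    have := h.exec (coresCmd mi) rfl rfl rfl rfl rfl rfl rfl
    exact ⟨this.hm, this.fst, this.snd, hL⟩
  have hred : t.arr aRed = s.arr aRed := (coresCmd mi).exec_arr s rfl
  have hsel : t.arr aSel = s.arr aSel := (coresCmd mi).exec_arr s rfl
  have hord : t.arr aOrd = s.arr aOrd := (coresCmd mi).exec_arr s rfl
  have hstep : t.var vStep = s.var vStep := (coresCmd mi).exec_var s rfl
  have hbest := bestCmd_spec hlt
  set u := (bestCmd mi).exec t with hu
  have hlu : Labelling u mi E L := hlt.congr ((bestCmd mi).exec_arr t rfl)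
    ((bestCmd mi).exec_arr t rfl) ((bestCmd mi).exec_arr t rfl) ((bestCmd mi).exec_arr t rfl)
  have hredu : u.arr aRed = s.arr aRed := ((bestCmd mi).exec_arr t rfl).trans hred
  have hselu : u.arr aSel = s.arr aSel := ((bestCmd mi).exec_arr t rfl).trans hsel
  have hordu : u.arr aOrd = s.arr aOrd := ((bestCmd mi).exec_arr t rfl).trans hord
  have hstepu : u.var vStep = s.var vStep := ((bestCmd mi).exec_var t rfl).trans hstep
  set v := u.setArr aOrd (s.var vStep) (u.var vBest) with hv
  have hexec : (selectCmd mi).exec s = (Cmd.ite (.var vBest) (reduceCmd mi ;;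
      .store aSel (.sub (.var vBest) (.const 1)) (.const 1)) .skip).exec v := by
    rw [selectCmd, exec_seq, exec_seq, exec_seq, exec_store, ← ht, ← hu, Term.eval, Term.eval,
      hstepu]
  rw [hexec, exec_ite]
  have hvb : (Term.var vBest).eval v = u.var vBest := rfl
  rw [hvb]
  rcases hbest with ⟨hb, hg⟩ | ⟨e, he, hb, hmin, hg⟩
  · rw [if_neg (by simpa using hb), exec_skip]
    refine ⟨?_, by simp [hv, hb], fun i hi => ?_⟩
    · have h1 : v.arr aOrd (s.var vStep) = 0 := by simp [hv, hb]
      have h2 : v.arr aSel = s.arr aSel := by rw [← hselu]; funext i; simp [hv]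
      rw [h1, h2, edgeOf_zero]
      exact ⟨rfl, fun g => by rw [hcross, hg]⟩
    · simp [hv, hi, hordu]
  · rw [if_pos (by omega), exec_seq, exec_store]
    have hlv : Labelling v mi E L := hlu.congr (by funext i; simp [hv]) (by funext i; simp [hv])
      (by funext i; simp [hv]) (by funext i; simp [hv])
    have hrd := reduceCmd_spec hlv
    set z := (reduceCmd mi).exec v with hz
    have hzb : z.var vBest = e + 1 := by
      rw [← hb]
      exact (reduceCmd mi).exec_var v rfl
    have hzo : z.arr aOrd = v.arr aOrd := (reduceCmd mi).exec_arr v rfl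
    have hzs : z.arr aSel = s.arr aSel := by
      rw [← hselu, hz, (reduceCmd mi).exec_arr v rfl]; funext i; simp [hv]
    simp only [Term.eval, hzb, Nat.add_sub_cancel]
    have hvr : v.arr aRed = s.arr aRed := by rw [← hredu]; funext i; simp [hv]
    have hvm : v.var vMin = u.var vMin := rfl
    have hzr : ∀ g : Fin m, (z.setArr aSel e 1).arr aRed g =
        2 * s.arr aRed g - u.var vMin * labelCount L E g := fun g => by
      rw [setArr_arr, if_neg (by decide), hrd, hvr, hvm]
    -- By the choice of the minimum no reduced cost would be negative, so the truncated subtraction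
    -- loses nothing.
    have hle : ∀ g : Fin m, u.var vMin * labelCount L E g ≤ 2 * s.arr aRed g := fun g => by
      rcases Nat.eq_zero_or_pos (labelCount L E g) with h0 | h0
      · simp [h0]
      · have := (Nat.le_div_iff_mul_le h0).1 (hg g h0)
        rw [hred] at this
        omega
    have h1 : (z.setArr aSel e 1).arr aOrd (s.var vStep) = e + 1 := by
      rw [setArr_arr, if_neg (by decide), hzo]; simp [hv, hb]
    refine ⟨?_, by rw [h1]; exact e.2, fun i hi => ?_⟩
    · rw [h1, edgeOf_succ, setArr_arr_self, hzs, supportOf_insert one_ne_zero]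
      refine ⟨rfl, by rw [hcross]; exact he, ?_, u.var vMin, fun g => ?_⟩
      · simp only [hzr]
        rw [hmin, hred]
        -- With a divisor `1` or `2` of an even number there is no rounding, and the chosen edge
        -- ends up with reduced cost exactly `0`.
        have h2 := labelCount_le L E e
        interval_cases labelCount L E e <;> omega
      · simp only [hzr]
        rw [hcross]
        have := hle g
        omega
    · rw [setArr_arr, if_neg (by decide), hzo]
      simp [hv, hi, hordu]

/-- Add all labels. -/
def sumAllCmd : Cmd :=
  .assign vSum (.const 0) ;; .upto vU 0 (.assign vSum (.add (.var vSum) (.read aLab (.var vU))))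

theorem sumAllCmd_spec {L : Fin n → ℕ} (hn : s.arr 1 0 = n) (hL : Labels s L) :
    (sumAllCmd.exec s).var vSum = ∑ u, L u := by
  have key : (sumAllCmd.exec s).var vSum = ∑ u ∈ range n, s.arr aLab u := by
    unfold sumAllCmd
    rw [exec_seq, exec_assign]
    refine exec_upto_induct (N := n) ?_ (fun N t => t.var vSum = ∑ u ∈ range N, s.arr aLab u) ?_ ?_
      (fun _ _ h => h)
    · exact hn
    · simp [Term.eval]
    intro i t hi hv ha hI
    have h1 : t.arr aLab = s.arr aLab := ha aLab rfl
    rw [sum_range_succ, ← hI, exec_assign]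
    simp [Term.eval, h1]
  rw [key, sum_range]
  exact sum_congr rfl fun u _ => hL u

/-- The edge selected in the step that `vStep` reaches when counted from the end. -/
def lastTerm (mi : ℕ) : Term :=
  .read aOrd (.sub (.sub (.read 1 (.const mi)) (.const 1)) (.var vStep))

theorem lastTerm_eval (t : State) :
    (lastTerm mi).eval t = t.arr aOrd (t.arr 1 mi - 1 - t.var vStep) := rfl

/-- Remove an edge if the other edges are a cover. -/
def deleteCmd (mi : ℕ) : Cmd :=
  .ite (lastTerm mi) (.ite (.read aSel (.sub (lastTerm mi) (.const 1)))
    (.store aSel (.sub (lastTerm mi) (.const 1)) (.const 0) ;; coresCmd mi ;; sumAllCmd ;;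
      .ite (.var vSum) (.store aSel (.sub (lastTerm mi) (.const 1)) (.const 1)) .skip) .skip) .skip

theorem deleteCmd_spec (h : Layout s mi E₀ w E k) {e : Option (Fin m)}
    (he : (lastTerm mi).eval s = 0 ∧ e = none ∨ ∃ x : Fin m, (lastTerm mi).eval s = x + 1 ∧ e = some x) :
    DeleteStep (cutWeight E₀ w) k E (supportOf (s.arr aSel) m)
      (supportOf (((deleteCmd mi).exec s).arr aSel) m) e := by
  rw [deleteCmd, exec_ite]
  rcases he with ⟨h0, rfl⟩ | ⟨e, h0, rfl⟩
  · rw [if_neg (by simpa using h0), exec_skip]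
    rfl
  rw [if_pos (by omega), exec_ite]
  have hes : (Term.read aSel (.sub (lastTerm mi) (.const 1))).eval s = s.arr aSel e := by
    rw [Term.eval, Term.eval, h0]; rfl
  rw [hes]
  by_cases hsel : s.arr aSel e = 0
  · rw [if_neg (by simpa using hsel), exec_skip]
    have hmem : e ∉ supportOf (s.arr aSel) m := by rw [mem_supportOf]; simpa using hsel
    show _ ∨ _
    rw [erase_eq_of_notMem hmem]
    by_cases hcov : Covers E (supportOf (s.arr aSel) m) {S | Small (cutWeight E₀ w) k S}
    · exact Or.inl ⟨hcov, rfl⟩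
    · exact Or.inr ⟨hcov, rfl⟩
  have hmem : e ∈ supportOf (s.arr aSel) m := by rw [mem_supportOf]; exact hsel
  rw [if_pos hsel, exec_seq, exec_seq, exec_seq, exec_store]
  have hev : (Term.sub (lastTerm mi) (.const 1)).eval s = e := by rw [Term.eval, h0]; rfl
  rw [hev]
  have hc0 : (Term.const 0).eval s = 0 := rfl
  rw [hc0]
  -- The edge is removed tentatively and the cores are recomputed. A nonzero sum of labels reveals
  -- an uncovered small set, and the edge is put back.
  set t := s.setArr aSel e 0 with ht
  have hLt : Layout t mi E₀ w E k := h.congr (by funext i; simp [ht]) (by funext i; simp [ht])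
    (by funext i; simp [ht]) (by funext i; simp [ht]) (by funext i; simp [ht])
    (by funext i; simp [ht]) rfl
  have hts : supportOf (t.arr aSel) m = (supportOf (s.arr aSel) m).erase e := by
    rw [ht, setArr_arr_self, supportOf_erase]
  obtain ⟨L, hL, hso, hco⟩ := coresCmd_spec hLt
  set u := (coresCmd mi).exec t with hu
  have hLu : Layout u mi E₀ w E k := hLt.exec (coresCmd mi) rfl rfl rfl rfl rfl rfl rfl
  have hsum := sumAllCmd_spec hLu.hn hL
  set z := sumAllCmd.exec u with hz
  have hzs : z.arr aSel = t.arr aSel :=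
    (sumAllCmd.exec_arr u rfl).trans ((coresCmd mi).exec_arr t rfl)
  have hcov := cores_eq_empty_iff_of_labels hso hco
  rw [cores_residual_eq_empty_iff, hts] at hcov
  rw [exec_ite]
  simp only [Term.eval, hsum]
  by_cases hall : ∀ v, L v = 0
  · rw [if_neg (by simpa using hall), exec_skip, hzs, hts]
    exact Or.inl ⟨hcov.2 hall, rfl⟩
  · rw [if_pos (by simpa using hall), exec_store]
    have hze : (Term.sub (lastTerm mi) (.const 1)).eval z = e := by
      rw [← hev, Term.eval, Term.eval, Term.eval, Term.eval, lastTerm_eval, lastTerm_eval,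
        show z.arr aOrd = s.arr aOrd by
          rw [hz, sumAllCmd.exec_arr u rfl, hu, (coresCmd mi).exec_arr t rfl]; funext i; simp [ht],
        show z.arr 1 = s.arr 1 by
          rw [hz, sumAllCmd.exec_arr u rfl, hu, (coresCmd mi).exec_arr t rfl]; funext i; simp [ht],
        show z.var vStep = s.var vStep by
          rw [hz, sumAllCmd.exec_var u rfl, hu, (coresCmd mi).exec_var t rfl]; simp [ht]]
    rw [hze, setArr_arr_self, supportOf_insert (by simp [Term.eval]), hzs, hts, insert_erase hmem]
    exact Or.inr ⟨fun h' => hall (hcov.1 h'), rfl⟩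

/-- Start with no selected edges and the original costs. -/
def startCmd (mi : ℕ) : Cmd :=
  .upto vE mi (.store aSel (.var vE) (.const 0) ;;
    .store aRed (.var vE) (.read aCost (.var vE)))

theorem startCmd_spec (hm : s.arr 1 mi = m) (e : Fin m) :
    ((startCmd mi).exec s).arr aSel e = 0 ∧ ((startCmd mi).exec s).arr aRed e = s.arr aCost e := by
  have key : ∀ e : Fin m, (e : ℕ) < m → ((startCmd mi).exec s).arr aSel e = 0 ∧
      ((startCmd mi).exec s).arr aRed e = s.arr aCost e := by
    unfold startCmd
    refine exec_upto_induct (N := m) ?_ (fun N t => ∀ e : Fin m, (e : ℕ) < N →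
      t.arr aSel e = 0 ∧ t.arr aRed e = s.arr aCost e) ?_ ?_ (fun _ _ h => h)
    · exact hm
    · simp
    intro i t hi hv ha hI e hei
    have h1 : t.arr aCost = s.arr aCost := ha aCost rfl
    simp only [exec_seq, exec_store, Term.eval, setArr_arr, setArr_var, setVar_var, setVar_arr, h1]
    norm_num
    by_cases h : (e : ℕ) = i
    · simp [h]
    · simpa [h] using hI e (by omega)
  exact key e e.2

/-- Primal-dual selection and reverse deletion. -/
def coverCmd (mi : ℕ) : Cmd :=
  startCmd mi ;; .upto vStep mi (selectCmd mi) ;; .upto vStep mi (deleteCmd mi)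

theorem coverCmd_spec (h : Layout s mi E₀ w E k)
    (hfeas : Covers E univ {S | Small (cutWeight E₀ w) k S}) :
    Covers E (supportOf (((coverCmd mi).exec s).arr aSel) m) {S | Small (cutWeight E₀ w) k S} ∧
    ∀ Jst, Covers E Jst {S | Small (cutWeight E₀ w) k S} →
      ∑ e ∈ supportOf (((coverCmd mi).exec s).arr aSel) m, s.arr aCost e ≤
        10 * ∑ e ∈ Jst, s.arr aCost e := by
  have hst := startCmd_spec h.hm
  have hLs := h.exec (startCmd mi) rfl rfl rfl rfl rfl rfl rfl
  rw [coverCmd, exec_seq, exec_seq]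
  set t := (startCmd mi).exec s with ht
  set f := loopState (selectCmd mi).exec vStep t with hf
  have hLf : ∀ i, Layout (f i) mi E₀ w E k := fun i =>
    hLs.congr (loopState_arr rfl i) (loopState_arr rfl i) (loopState_arr rfl i)
      (loopState_arr rfl i) (loopState_arr rfl i) (loopState_arr rfl i)
      (loopState_var rfl (by decide) i)
  have hLf' : ∀ i, Layout ((f i).setVar vStep i) mi E₀ w E k := fun i =>
    (hLf i).congr rfl rfl rfl rfl rfl rfl rfl
  have hfs : ∀ i, f (i + 1) = (selectCmd mi).exec ((f i).setVar vStep i) := fun i => rfl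
  have hut : (Cmd.upto vStep mi (selectCmd mi)).exec t = (f m).setVar vStep m := by
    rw [Cmd.exec, hLs.hm]
  rw [hut]
  set u := (f m).setVar vStep m with hu
  have hLu : Layout u mi E₀ w E k := (hLf m).congr rfl rfl rfl rfl rfl rfl rfl
  set g := loopState (deleteCmd mi).exec vStep u with hg
  have hLg : ∀ i, Layout ((g i).setVar vStep i) mi E₀ w E k := fun i =>
    hLu.congr (loopState_arr rfl i) (loopState_arr rfl i) (loopState_arr rfl i)
      (loopState_arr rfl i) (loopState_arr rfl i) (loopState_arr rfl i)
      (loopState_var rfl (by decide) i)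
  have hgs : ∀ i, g (i + 1) = (deleteCmd mi).exec ((g i).setVar vStep i) := fun i => rfl
  -- Entry `i` of the order is written in round `i` and never again.
  have hord : ∀ i j, i < j → (f j).arr aOrd i = (f (i + 1)).arr aOrd i := by
    intro i j hij
    induction j with
    | zero => omega
    | succ j ih =>
      rcases Nat.lt_succ_iff_lt_or_eq.1 hij with h' | rfl
      · rw [← ih h', hfs j]
        have := (selectCmd_spec (hLf' j)).2.2 i (by simp; omega)
        rw [this]; rfl
      · rfl
  have hgo : ∀ i, (g i).arr aOrd = (f m).arr aOrd := fun i => loopState_arr rfl i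
  -- The deletion loop runs through the selections backwards, so the set called `Ks i` is present
  -- after `m - i` of its rounds.
  have hpd := primal_dual (symSubmodular_cutWeight E₀ w)
    (Js := fun i => supportOf ((f i).arr aSel) m)
    (Ks := fun i => supportOf ((g (m - i)).arr aSel) m) (c := fun i e => (f i).arr aRed e)
    (o := fun i => edgeOf m ((f m).arr aOrd i)) (k := k) (E := E) ?_ ?_ ?_ ?_ hfeas
  · have hfin : (Cmd.upto vStep mi (deleteCmd mi)).exec u = (g m).setVar vStep m := by
      rw [Cmd.exec, hLu.hm]
    rw [hfin]
    have hc : ∀ e : Fin m, (f 0).arr aRed e = s.arr aCost e := fun e => (hst e).2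
    simpa [hc] using hpd
  · refine eq_empty_of_forall_notMem fun e he => ?_
    rw [mem_supportOf] at he
    exact he (hst e).1
  · intro i hi
    have := (selectCmd_spec (hLf' i)).1
    rw [← hfs i] at this
    have hi' : ((f i).setVar vStep i).var vStep = i := by simp
    rw [hi', ← hord i m hi] at this
    exact this
  · simp only [Nat.sub_self]
    rfl
  · intro i hi
    have hmi : m - i = (m - (i + 1)) + 1 := by omega
    simp only [hmi, hgs]
    refine deleteCmd_spec (hLg _) ?_
    have hlast : (lastTerm mi).eval ((g (m - (i + 1))).setVar vStep (m - (i + 1))) =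
        (f m).arr aOrd i := by
      rw [lastTerm_eval, (hLg _).hm, setVar_arr, hgo, setVar_var, if_pos rfl]
      congr 1
      omega
    rw [hlast]
    refine edgeOf_cases ?_
    have := (selectCmd_spec (hLf' i)).2.1
    rw [← hfs i, setVar_var, if_pos rfl, ← hord i m hi] at this
    exact this

end Core

end NetDesign

/-! ### Integral costs, and the program for Near Min-Cuts Cover. -/

namespace NetDesign

open Finset

variable {n m : ℕ}

/-! ### Integral costs -/

/-- Store in array `c` the fractions given by arrays `a` and `b`, multiplied by all denominators. -/
def scaleCmd (mi a b c : ℕ) : Cmd :=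
  .upto vE mi (.assign vX (.read a (.var vE)) ;;
    .upto vI mi (.ite (.neT (.var vI) (.var vE)) (.assign vX (.mul (.var vX) (.read b (.var vI))))
      .skip) ;;
    .store c (.var vE) (.var vX))

theorem scaleCmd_spec {s : State} {mi a b c : ℕ} (h1 : c ≠ 1) (ha : c ≠ a) (hb : c ≠ b)
    (hm : s.arr 1 mi = m) (e : Fin m) :
    ((scaleCmd mi a b c).exec s).arr c e =
      s.arr a e * ∏ j : Fin m, if j = e then 1 else s.arr b j := by
  have key : ∀ e : Fin m, (e : ℕ) < m → ((scaleCmd mi a b c).exec s).arr c e =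
      s.arr a e * ∏ j ∈ range m, if j = (e : ℕ) then 1 else s.arr b j := by
    unfold scaleCmd
    refine exec_upto_induct (N := m) ?_ (fun N t => ∀ e : Fin m, (e : ℕ) < N → t.arr c e =
      s.arr a e * ∏ j ∈ range m, if j = (e : ℕ) then 1 else s.arr b j) ?_ ?_ (fun _ _ h => h)
    · exact hm
    · simp
    intro i t hi hv har hI e hei
    have t1 : t.arr 1 = s.arr 1 := har 1 (by simp [Cmd.writesArr, h1.symm])
    have ta : t.arr a = s.arr a := har a (by simp [Cmd.writesArr, ha.symm])
    have tb : t.arr b = s.arr b := har b (by simp [Cmd.writesArr, hb.symm])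
    rw [exec_seq, exec_seq, exec_assign, exec_store]
    set u := (t.setVar vE i).setVar vX ((Term.read a (.var vE)).eval (t.setVar vE i)) with hu
    set p : Cmd := .ite (.neT (.var vI) (.var vE))
      (.assign vX (.mul (.var vX) (.read b (.var vI)))) .skip with hp
    have hx : ((Cmd.upto vI mi p).exec u).var vX =
        s.arr a i * ∏ j ∈ range m, if j = i then 1 else s.arr b j := by
      refine exec_upto_induct (N := m) ?_
        (fun N z => z.var vX = s.arr a i * ∏ j ∈ range N, if j = i then 1 else s.arr b j) ?_ ?_
        (fun _ _ h => h)
      · rw [hu, setVar_arr, setVar_arr, t1, hm]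
      · simp [hu, Term.eval, ta]
      intro j z hj hv' har' hz
      have z1 : z.var vE = i := by rw [hv' vE rfl (by decide)]; simp [hu]
      have z2 : z.arr b = s.arr b := by rw [har' b rfl, hu, setVar_arr, setVar_arr, tb]
      rw [prod_range_succ, ← mul_assoc, ← hz, hp, exec_ite]
      simp only [Term.neT_eval, exec_assign, exec_skip]
      simp only [Term.eval, setVar_var, setVar_arr, z2, z1]
      norm_num
      split_ifs <;> simp_all
    have hy : ((Cmd.upto vI mi p).exec u).var vE = i := by
      rw [(Cmd.upto vI mi p).exec_var u rfl]; simp [hu]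
    have hc : ((Cmd.upto vI mi p).exec u).arr c = t.arr c := (Cmd.upto vI mi p).exec_arr u rfl
    simp only [Term.eval, hx, hy]
    rw [setArr_arr, if_pos rfl, hc]
    by_cases hei' : (e : ℕ) = i
    · rw [if_pos hei', hei']
    · rw [if_neg hei', hI e (by omega)]
  rw [key e e.2, prod_range]
  congr 1
  refine prod_congr rfl fun j _ => ?_
  simp only [Fin.val_inj]

/-- The common denominator. -/
def commonDen (c : Fin m → ℚ≥0) : ℕ := ∏ j, (c j).den

theorem commonDen_pos (c : Fin m → ℚ≥0) : 0 < commonDen c :=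
  prod_pos fun j _ => (c j).den_pos

/-- The denominator of `c e` cancels its own factor in the common denominator. Multiplying by the
other denominators thus clears fractions without any division. -/
theorem num_mul_prod (c : Fin m → ℚ≥0) (e : Fin m) :
    (((c e).num * ∏ j, if j = e then 1 else (c j).den : ℕ) : ℚ≥0) = c e * commonDen c := by
  have h1 : commonDen c = (c e).den * ∏ j, if j = e then 1 else (c j).den := by
    rw [commonDen, ← mul_prod_erase univ _ (mem_univ e)]
    congr 1
    rw [← mul_prod_erase univ _ (mem_univ e), if_pos rfl, one_mul]
    exact prod_congr rfl fun j hj => by rw [if_neg (ne_of_mem_erase hj)]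
  rw [h1, Nat.cast_mul, Nat.cast_mul, ← mul_assoc]
  congr 1
  have := NNRat.num_div_den (c e)
  have hd : ((c e).den : ℚ≥0) ≠ 0 := by exact_mod_cast (c e).den_ne_zero
  rw [div_eq_iff hd] at this
  exact this

theorem sum_le_of_scaled {c : Fin m → ℚ≥0} {a : Fin m → ℕ} {D r : ℕ} (hD : 0 < D)
    (ha : ∀ e, (a e : ℚ≥0) = c e * D) {J K : Finset (Fin m)}
    (h : ∑ e ∈ K, a e ≤ r * ∑ e ∈ J, a e) : ∑ e ∈ K, c e ≤ r * ∑ e ∈ J, c e := by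
  have h1 : ((∑ e ∈ K, a e : ℕ) : ℚ≥0) ≤ ((r * ∑ e ∈ J, a e : ℕ) : ℚ≥0) := by exact_mod_cast h
  push_cast at h1
  simp only [ha] at h1
  rw [← sum_mul, ← sum_mul, ← mul_assoc] at h1
  exact le_of_mul_le_mul_right h1 (by exact_mod_cast hD)

/-! ### The input -/

/-- Every entry contributes at least its separator. This is how the loop bounds, being lengths of
lists in the input, are bounded by the input length. -/
theorem length_le_inputLength {input : List (List ℕ)} {l : List ℕ} (h : l ∈ input) :
    l.length ≤ inputLength input := by
  have h1 : l.length ≤ (l.map fun x => Nat.size x + 1).sum := by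
    clear h
    induction l with
    | nil => simp
    | cons x l ih => simp; omega
  refine h1.trans ?_
  unfold inputLength
  exact List.single_le_sum (fun _ _ => Nat.zero_le _) _
    (List.mem_map_of_mem (f := fun l => (l.map fun x => Nat.size x + 1).sum) h)

theorem getD_ofFn (f : Fin m → ℕ) (e : Fin m) : (List.ofFn f).getD e 0 = f e := by
  simp [List.getD_eq_getElem?_getD]

/-- Copy the first entries of array `a` to array `b`. -/
def copyCmd (mi a b : ℕ) : Cmd := .upto vE mi (.store b (.var vE) (.read a (.var vE)))

theorem copyCmd_spec {s : State} {mi a b : ℕ} (hab : b ≠ a) (hm : s.arr 1 mi = m) (e : Fin m) :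
    ((copyCmd mi a b).exec s).arr b e = s.arr a e := by
  have key : ∀ e : Fin m, (e : ℕ) < m → ((copyCmd mi a b).exec s).arr b e = s.arr a e := by
    unfold copyCmd
    refine exec_upto_induct (N := m) ?_ (fun N t => ∀ e : Fin m, (e : ℕ) < N →
      t.arr b e = s.arr a e) ?_ ?_ (fun _ _ h => h)
    · exact hm
    · simp
    intro i t hi hv ha hI e hei
    have h1 : t.arr a = s.arr a := ha a (by simp [Cmd.writesArr, hab.symm])
    simp only [exec_store, Term.eval, setArr_arr, setVar_var, setVar_arr, h1, if_true]
    by_cases h : (e : ℕ) = i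
    · simp [h]
    · simpa [h] using hI e (by omega)
  exact key e e.2

/-! ### Near Min-Cuts Cover -/

/-- Store `1` in the first entries of `aBase`. -/
def onesCmd (mi : ℕ) : Cmd := .upto vE mi (.store aBase (.var vE) (.const 1))

theorem onesCmd_spec {s : State} {mi : ℕ} (hm : s.arr 1 mi = m) (e : Fin m) :
    ((onesCmd mi).exec s).arr aBase e = 1 := by
  have key : ∀ e : Fin m, (e : ℕ) < m → ((onesCmd mi).exec s).arr aBase e = 1 := by
    unfold onesCmd
    refine exec_upto_induct (N := m) ?_ (fun N t => ∀ e : Fin m, (e : ℕ) < N →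
      t.arr aBase e = 1) ?_ ?_ (fun _ _ h => h)
    · exact hm
    · simp
    intro i t hi hv ha hI e hei
    simp only [exec_store, Term.eval, setArr_arr, setVar_var, setVar_arr, if_true]
    by_cases h : (e : ℕ) = i
    · simp [h]
    · simpa [h] using hI e (by omega)
  exact key e e.2

/-- The program for Near Min-Cuts Cover. -/
def nearMinCutsCmd : Cmd :=
  onesCmd 1 ;; copyCmd 2 5 aEnd1 ;; copyCmd 2 6 aEnd2 ;; scaleCmd 2 7 8 aCost ;;
    .assign vThr (.read 1 (.const 3)) ;; coverCmd 2 ;; copyCmd 2 aSel 0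

theorem nearMinCutsCmd_spec (I : NearMinCutsInstance) :
    ∃ s, Layout s 2 I.E₀ (fun _ => 1) I.E I.k ∧
      (∀ e : Fin I.m, (s.arr aCost e : ℚ≥0) = I.cost e * commonDen I.cost) ∧
      outputSet I.m (nearMinCutsCmd.exec (initial (nearMinCutsCover.encode I))) =
        supportOf (((coverCmd 2).exec s).arr aSel) I.m := by
  set s₀ := initial (nearMinCutsCover.encode I) with hs₀
  have i0 : s₀.arr 1 0 = I.n := rfl
  have i1 : s₀.arr 1 1 = I.m₀ := rfl
  have i2 : s₀.arr 1 2 = I.m := rfl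
  have i3 : s₀.arr 1 3 = I.k := rfl
  have j3 : ∀ e : Fin I.m₀, s₀.arr 3 e = (I.E₀ e).1 := fun e => getD_ofFn _ e
  have j4 : ∀ e : Fin I.m₀, s₀.arr 4 e = (I.E₀ e).2 := fun e => getD_ofFn _ e
  have j5 : ∀ e : Fin I.m, s₀.arr 5 e = (I.E e).1 := fun e => getD_ofFn _ e
  have j6 : ∀ e : Fin I.m, s₀.arr 6 e = (I.E e).2 := fun e => getD_ofFn _ e
  have j7 : ∀ e : Fin I.m, s₀.arr 7 e = (I.cost e).num := fun e => getD_ofFn _ e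
  have j8 : ∀ e : Fin I.m, s₀.arr 8 e = (I.cost e).den := fun e => getD_ofFn _ e
  set s₁ := (onesCmd 1).exec s₀ with hs₁
  have a1 : ∀ a, a ≠ aBase → s₁.arr a = s₀.arr a := fun a ha =>
    (onesCmd 1).exec_arr s₀ (by simp [onesCmd, Cmd.writesArr, ha])
  have b1 := onesCmd_spec i1
  set s₂ := (copyCmd 2 5 aEnd1).exec s₁ with hs₂
  have a2 : ∀ a, a ≠ aEnd1 → s₂.arr a = s₁.arr a := fun a ha =>
    (copyCmd 2 5 aEnd1).exec_arr s₁ (by simp [copyCmd, Cmd.writesArr, ha])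
  have b2 := copyCmd_spec (s := s₁) (mi := 2) (a := 5) (b := aEnd1) (m := I.m) (by decide)
    (by rw [a1 1 (by decide), i2])
  set s₃ := (copyCmd 2 6 aEnd2).exec s₂ with hs₃
  have a3 : ∀ a, a ≠ aEnd2 → s₃.arr a = s₂.arr a := fun a ha =>
    (copyCmd 2 6 aEnd2).exec_arr s₂ (by simp [copyCmd, Cmd.writesArr, ha])
  have b3 := copyCmd_spec (s := s₂) (mi := 2) (a := 6) (b := aEnd2) (m := I.m) (by decide)
    (by rw [a2 1 (by decide), a1 1 (by decide), i2])
  set s₄ := (scaleCmd 2 7 8 aCost).exec s₃ with hs₄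
  have a4 : ∀ a, a ≠ aCost → s₄.arr a = s₃.arr a := fun a ha =>
    (scaleCmd 2 7 8 aCost).exec_arr s₃ (by simp [scaleCmd, Cmd.writesArr, ha])
  have b4 := scaleCmd_spec (s := s₃) (mi := 2) (a := 7) (b := 8) (c := aCost) (m := I.m)
    (by decide) (by decide) (by decide)
    (by rw [a3 1 (by decide), a2 1 (by decide), a1 1 (by decide), i2])
  rw [← hs₁] at b1
  rw [← hs₂] at b2
  rw [← hs₃] at b3
  rw [← hs₄] at b4
  set s₅ := s₄.setVar vThr ((Term.read 1 (.const 3)).eval s₄) with hs₅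
  have a5 : s₅.arr = s₄.arr := rfl
  have inp : ∀ a, a ≤ 8 → s₄.arr a = s₀.arr a := fun a ha => by
    rw [a4 a (by omega), a3 a (by omega), a2 a (by omega), a1 a (by omega)]
  have hL : Layout s₅ 2 I.E₀ (fun _ => 1) I.E I.k := by
    refine ⟨?_, ?_, ?_, fun e => ?_, fun e => ?_, fun e => ?_, fun e => ?_, fun e => ?_, ?_⟩
    · rw [a5, inp 1 (by decide), i0]
    · rw [a5, inp 1 (by decide), i1]
    · rw [a5, inp 1 (by decide), i2]
    · rw [a5, inp 3 (by decide), j3]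
    · rw [a5, inp 4 (by decide), j4]
    · rw [a5, a4 _ (by decide), a3 _ (by decide), a2 _ (by decide), b1]
    · rw [a5, a4 _ (by decide), a3 _ (by decide), b2, a1 5 (by decide), j5]
    · rw [a5, a4 _ (by decide), b3, a2 6 (by decide), a1 6 (by decide), j6]
    · rw [hs₅, setVar_var, if_pos rfl, Term.eval, Term.eval, inp 1 (by decide), i3]
  refine ⟨s₅, hL, fun e => ?_, ?_⟩
  · rw [a5, b4]
    have h7 : s₃.arr 7 = s₀.arr 7 := by rw [a3 7 (by decide), a2 7 (by decide), a1 7 (by decide)]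
    have h8 : s₃.arr 8 = s₀.arr 8 := by rw [a3 8 (by decide), a2 8 (by decide), a1 8 (by decide)]
    rw [h7, h8, j7]
    simp only [j8]
    exact num_mul_prod I.cost e
  · rw [nearMinCutsCmd, exec_seq, exec_seq, exec_seq, exec_seq, exec_seq, exec_seq, exec_assign,
      ← hs₁, ← hs₂, ← hs₃, ← hs₄, ← hs₅]
    ext e
    have hm : ((coverCmd 2).exec s₅).arr 1 2 = I.m := by
      rw [(coverCmd 2).exec_arr s₅ rfl]; exact hL.hm
    rw [mem_supportOf, outputSet, mem_filter, copyCmd_spec (by decide) hm]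
    simp

theorem family_eq_small (I : NearMinCutsInstance) :
    I.family = {S | Small (cutWeight I.E₀ fun _ => 1) I.k S} := by
  ext S
  simp [NearMinCutsInstance.family, Small, cutWeight]

theorem nearMinCutsCmd_correct (I : NearMinCutsInstance) {J₀ : Finset (Fin I.m)}
    (h : Covers I.E J₀ I.family) :
    Covers I.E (outputSet I.m (nearMinCutsCmd.exec (initial (nearMinCutsCover.encode I)))) I.family ∧
    ∀ J, Covers I.E J I.family →
      ∑ e ∈ outputSet I.m (nearMinCutsCmd.exec (initial (nearMinCutsCover.encode I))), I.cost e ≤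
        10 * ∑ e ∈ J, I.cost e := by
  obtain ⟨s, hL, hcost, hout⟩ := nearMinCutsCmd_spec I
  rw [family_eq_small] at h ⊢
  obtain ⟨hcov, hopt⟩ := coverCmd_spec hL (h.mono (subset_univ _))
  rw [hout]
  exact ⟨hcov, fun J hJ => sum_le_of_scaled (r := 10) (commonDen_pos I.cost) hcost (hopt J hJ)⟩

theorem admitsRatio_nearMinCutsCover : nearMinCutsCover.AdmitsRatio fun _ => 10 := by
  -- The three admissible loop bounds are `n`, `m₀` and `m`. The fourth entry `k`, written in
  -- binary, may be exponentially large and bounds no loop.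
  refine EdgeProblem.admitsRatio_of_cmd nearMinCutsCmd 3 rfl ?_ ?_
  · intro I b hb
    have h1 : List.range I.n ∈ nearMinCutsCover.encode I := by simp [nearMinCutsCover]
    have h2 : (List.ofFn fun e => ((I.E₀ e).1 : ℕ)) ∈ nearMinCutsCover.encode I := by
      simp [nearMinCutsCover, encodeEdges]
    have h3 : (List.ofFn fun e => ((I.E e).1 : ℕ)) ∈ nearMinCutsCover.encode I := by
      simp [nearMinCutsCover, encodeEdges]
    have h1' := length_le_inputLength h1
    have h2' := length_le_inputLength h2
    have h3' := length_le_inputLength h3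
    rw [List.length_range] at h1'
    rw [List.length_ofFn] at h2' h3'
    interval_cases b
    · exact h1'
    · exact h2'
    · exact h3'
  · rintro I ⟨J₀, hJ₀⟩
    have h := nearMinCutsCmd_correct I hJ₀
    generalize nearMinCutsCmd.exec (initial (nearMinCutsCover.encode I)) = s at h ⊢
    exact h

end NetDesign

/-! ### Cap-`k`-ECSS by repeated covering of deficient cuts. -/

namespace NetDesign

open Finset

variable {n m : ℕ}

/-! ### Covering deficient cuts repeatedly -/

/-- The edges in `F` become loops. -/
def hide (E : EdgeList n m) (F : Finset (Fin m)) : EdgeList n m := fun e =>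
  if e ∈ F then ((E e).1, (E e).1) else E e

theorem mem_cut_hide {E : EdgeList n m} {F J : Finset (Fin m)} {S : Finset (Fin n)} {e : Fin m} :
    e ∈ cut (hide E F) J S ↔ e ∉ F ∧ e ∈ cut E J S := by
  rw [mem_cut, mem_cut, hide]
  by_cases h : e ∈ F <;> simp [h]

namespace CapInstance

variable (I : CapInstance)

/-- The capacity of the edges of `J` that cross `S`. -/
def capCut (J : Finset (Fin I.m)) (S : Finset (Fin I.n)) : ℚ≥0 := ∑ e ∈ cut I.E J S, I.cap e

/-- The sets that `J` does not yet cover with capacity `k`. -/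
def deficient (J : Finset (Fin I.m)) : Set (Finset (Fin I.n)) :=
  {S | S.Nonempty ∧ S ≠ univ ∧ I.capCut J S < I.k}

/-- Each cut has capacity at least `k`. -/
def IsFeasible (J : Finset (Fin I.m)) : Prop :=
  ∀ S : Finset (Fin I.n), S.Nonempty → S ≠ univ → (I.k : ℚ≥0) ≤ I.capCut J S

variable {I} {F J K : Finset (Fin I.m)} {S : Finset (Fin I.n)}

theorem capCut_mono (h : J ⊆ K) (S : Finset (Fin I.n)) : I.capCut J S ≤ I.capCut K S :=
  sum_le_sum_of_subset (cut_mono h)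

theorem IsFeasible.mono (hJ : I.IsFeasible J) (h : J ⊆ K) : I.IsFeasible K := fun S h1 h2 =>
  (hJ S h1 h2).trans (capCut_mono h S)

/-- On a deficient cut `J` has capacity at least `k` and `F` has less, so some edge of `J` across
this cut lies outside `F`. Hence every feasible solution is a cover in every round. -/
theorem IsFeasible.covers_hide (hJ : I.IsFeasible J) (F : Finset (Fin I.m)) :
    Covers (hide I.E F) J (I.deficient F) := by
  rw [covers_iff]
  rintro S ⟨h1, h2, h3⟩
  by_contra hne
  rw [not_nonempty_iff_eq_empty] at hne
  refine (h3.trans_le (hJ S h1 h2)).not_ge (sum_le_sum_of_subset fun e he => ?_)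
  have : e ∈ F := by
    by_contra heF
    have := mem_cut_hide.2 ⟨heF, he⟩
    simp [hne] at this
  exact mem_cut.2 ⟨this, (mem_cut.1 he).2⟩

theorem uMin_le (e : Fin I.m) : I.uMin ≤ I.cap e := by
  have h : (univ : Finset (Fin I.m)).Nonempty := ⟨e, mem_univ e⟩
  rw [uMin, dif_pos h]
  exact inf'_le _ (mem_univ e)

theorem uMin_pos : 0 < I.uMin := by
  unfold uMin
  split_ifs with h
  · rw [lt_inf'_iff]
    exact fun e _ => I.cap_pos e
  · exact one_pos

theorem le_ceil_mul_uMin : (I.k : ℚ≥0) ≤ ⌈(I.k : ℚ≥0) / I.uMin⌉₊ * I.uMin :=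
  (div_le_iff₀ uMin_pos).1 (Nat.le_ceil _)

variable (I) in
/-- The state of the selection after `r` rounds. -/
structure Progress (r : ℕ) (F : Finset (Fin I.m)) : Prop where
  cap : ∀ S : Finset (Fin I.n), S.Nonempty → S ≠ univ →
    (I.k : ℚ≥0) ≤ I.capCut F S ∨ r * I.uMin ≤ I.capCut F S
  card : I.IsFeasible F ∨ r ≤ F.card
  cost : ∀ J, I.IsFeasible J → ∑ e ∈ F, I.cost e ≤
    (min r ⌈(I.k : ℚ≥0) / I.uMin⌉₊ : ℕ) * (10 * ∑ e ∈ J, I.cost e)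

theorem Progress.zero : I.Progress 0 ∅ :=
  ⟨fun S _ _ => Or.inr (by simp), Or.inr (Nat.zero_le _), fun J _ => by simp⟩

/-- Each deficient cut gains an edge outside `F`, hence capacity at least `uMin`; and if `F` is
infeasible, at least one new edge is bought. A round costs at most ten times any feasible solution,
since that solution is a cover of the deficient sets. -/
theorem Progress.succ {r : ℕ} (h : I.Progress r F) (hK : Covers (hide I.E F) K (I.deficient F))
    (hopt : ∀ J, Covers (hide I.E F) J (I.deficient F) →
      ∑ e ∈ K, I.cost e ≤ 10 * ∑ e ∈ J, I.cost e) : I.Progress (r + 1) (F ∪ K) := by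
  rw [covers_iff] at hK
  refine ⟨fun S h1 h2 => ?_, ?_, fun J hJ => ?_⟩
  · by_cases hS : (I.k : ℚ≥0) ≤ I.capCut F S
    · exact Or.inl (hS.trans (capCut_mono subset_union_left S))
    right
    obtain ⟨e, he⟩ := hK S ⟨h1, h2, not_le.1 hS⟩
    rw [mem_cut_hide] at he
    have hnot : e ∉ cut I.E F S := fun h' => he.1 (mem_cut.1 h').1
    have hsub : insert e (cut I.E F S) ⊆ cut I.E (F ∪ K) S :=
      insert_subset (cut_mono subset_union_right he.2) (cut_mono subset_union_left)
    have hle : ∑ x ∈ insert e (cut I.E F S), I.cap x ≤ I.capCut (F ∪ K) S :=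
      sum_le_sum_of_subset hsub
    rw [sum_insert hnot] at hle
    refine le_trans ?_ hle
    have h3 := (h.cap S h1 h2).resolve_left hS
    push_cast
    rw [add_mul, one_mul, add_comm]
    exact add_le_add (uMin_le e) h3
  · rcases h.card with hF | hF
    · exact Or.inl (hF.mono subset_union_left)
    by_cases hfeas : I.IsFeasible F
    · exact Or.inl (hfeas.mono subset_union_left)
    right
    unfold IsFeasible at hfeas
    push Not at hfeas
    obtain ⟨S, h1, h2, h3⟩ := hfeas
    obtain ⟨e, he⟩ := hK S ⟨h1, h2, h3⟩
    rw [mem_cut_hide] at he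
    have hsub : insert e F ⊆ F ∪ K :=
      insert_subset (mem_union_right _ (mem_cut.1 he.2).1) subset_union_left
    have := card_le_card hsub
    rw [card_insert_of_notMem he.1] at this
    omega
  · have hunion : ∑ e ∈ F ∪ K, I.cost e ≤ ∑ e ∈ F, I.cost e + ∑ e ∈ K, I.cost e := by
      rw [← sum_union_inter]
      exact le_self_add
    refine hunion.trans ?_
    by_cases hr : r < ⌈(I.k : ℚ≥0) / I.uMin⌉₊
    · rw [min_eq_left (by omega : r + 1 ≤ _)]
      have h1 := h.cost J hJ
      rw [min_eq_left hr.le] at h1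
      push_cast
      rw [add_mul, one_mul]
      exact add_le_add h1 (hopt J (hJ.covers_hide F))
    · rw [min_eq_right (by omega)]
      have h1 := h.cost J hJ
      rw [min_eq_right (by omega)] at h1
      -- After `⌈k / uMin⌉` rounds every cut has capacity at least `k`. Nothing is deficient, so the
      -- empty set is a cover and the round is free.
      have h2 : Covers (hide I.E F) ∅ (I.deficient F) := by
        rintro S ⟨h3, h4, h5⟩
        refine absurd ?_ h5.not_ge
        rcases h.cap S h3 h4 with h6 | h6
        · exact h6
        · refine le_ceil_mul_uMin.trans (le_trans ?_ h6)
          gcongr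
          omega
      have h3 := hopt ∅ h2
      rw [sum_empty, mul_zero] at h3
      calc ∑ e ∈ F, I.cost e + ∑ e ∈ K, I.cost e ≤ ∑ e ∈ F, I.cost e + 0 := by gcongr
        _ ≤ _ := by rwa [add_zero]

/-- Each round before feasibility buys a new edge, so `m` rounds suffice. The number `⌈k / uMin⌉`,
which need not be polynomial in the input length, enters only the cost and not the loop bound. -/
theorem Progress.isFeasible (h : I.Progress I.m F) (hJ : I.IsFeasible J) : I.IsFeasible F := by
  rcases h.card with hF | hF
  · exact hF
  · have : F = univ := eq_univ_of_card F (by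
      have := card_le_univ F
      rw [Fintype.card_fin] at this ⊢
      omega)
    rw [this]
    exact hJ.mono (subset_univ _)

theorem Progress.cost_le {r : ℕ} (h : I.Progress r F) (hJ : I.IsFeasible J) :
    ∑ e ∈ F, I.cost e ≤ 10 * (⌈(I.k : ℚ≥0) / I.uMin⌉₊ : ℚ≥0) * ∑ e ∈ J, I.cost e := by
  refine (h.cost J hJ).trans ?_
  rw [mul_comm (10 : ℚ≥0) (⌈_⌉₊ : ℚ≥0), mul_assoc]
  exact mul_le_mul_left (Nat.cast_le.2 (Nat.min_le_right _ _)) _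

end CapInstance

/-! ### The program for Cap-`k`-ECSS -/

/-- Give the selected edges their capacities and turn them into loops. -/
def maskCmd : Cmd :=
  .upto vE 1 (.store aEnd1 (.var vE) (.read 3 (.var vE)) ;; .ite (.read 0 (.var vE))
    (.store aBase (.var vE) (.read aCap (.var vE)) ;; .store aEnd2 (.var vE) (.read 3 (.var vE)))
    (.store aBase (.var vE) (.const 0) ;; .store aEnd2 (.var vE) (.read 4 (.var vE))))

theorem maskCmd_spec {s : State} (hm : s.arr 1 1 = m) (e : Fin m) :
    (maskCmd.exec s).arr aEnd1 e = s.arr 3 e ∧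
    (maskCmd.exec s).arr aEnd2 e = (if s.arr 0 e ≠ 0 then s.arr 3 e else s.arr 4 e) ∧
    (maskCmd.exec s).arr aBase e = if s.arr 0 e ≠ 0 then s.arr aCap e else 0 := by
  have key : ∀ e : Fin m, (e : ℕ) < m → (maskCmd.exec s).arr aEnd1 e = s.arr 3 e ∧
      (maskCmd.exec s).arr aEnd2 e = (if s.arr 0 e ≠ 0 then s.arr 3 e else s.arr 4 e) ∧
      (maskCmd.exec s).arr aBase e = if s.arr 0 e ≠ 0 then s.arr aCap e else 0 := by
    unfold maskCmd
    refine exec_upto_induct (N := m) ?_ (fun N t => ∀ e : Fin m, (e : ℕ) < N →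
      t.arr aEnd1 e = s.arr 3 e ∧
      t.arr aEnd2 e = (if s.arr 0 e ≠ 0 then s.arr 3 e else s.arr 4 e) ∧
      t.arr aBase e = if s.arr 0 e ≠ 0 then s.arr aCap e else 0) ?_ ?_ (fun _ _ h => h)
    · exact hm
    · simp
    intro i t hi hv ha hI e hei
    have h0 : t.arr 0 = s.arr 0 := ha 0 rfl
    have h3 : t.arr 3 = s.arr 3 := ha 3 rfl
    have h4 : t.arr 4 = s.arr 4 := ha 4 rfl
    have h5 : t.arr aCap = s.arr aCap := ha aCap rfl
    simp only [exec_seq, exec_ite, exec_store, Term.eval, setArr_arr, setArr_var, setVar_var,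
      setVar_arr, h0, h3, h4, h5]
    norm_num
    by_cases h : (e : ℕ) = i
    · by_cases hs : s.arr 0 i = 0 <;> simp [h, hs]
    · by_cases hs : s.arr 0 i = 0 <;> simpa [h, hs] using hI e (by omega)
  exact key e e.2

/-- Add the selected edges to the output. -/
def unionCmd : Cmd :=
  .upto vE 1 (.store 0 (.var vE) (.add (.read 0 (.var vE)) (.read aSel (.var vE))))

theorem unionCmd_spec {s : State} (hm : s.arr 1 1 = m) :
    outputSet m (unionCmd.exec s) = outputSet m s ∪ supportOf (s.arr aSel) m := by
  have key : ∀ e : Fin m, (unionCmd.exec s).arr 0 e =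
      if (e : ℕ) < m then s.arr 0 e + s.arr aSel e else s.arr 0 e := by
    unfold unionCmd
    refine exec_upto_induct (N := m) ?_ (fun N t => ∀ e : Fin m, t.arr 0 e =
      if (e : ℕ) < N then s.arr 0 e + s.arr aSel e else s.arr 0 e) ?_ ?_ (fun _ _ h => h)
    · exact hm
    · simp
    intro i t hi hv ha hI e
    have h1 : t.arr aSel = s.arr aSel := ha aSel rfl
    have hIi := hI ⟨i, hi⟩
    simp only [lt_irrefl, if_false] at hIi
    simp only [exec_store, Term.eval, setArr_arr, setVar_var, setVar_arr, h1, if_true, hIi]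
    by_cases h : (e : ℕ) = i
    · simp [h]
    · have h2 : (e : ℕ) < i + 1 ↔ (e : ℕ) < i := by omega
      rw [if_neg h, hI e]
      simp only [h2]
  ext e
  rw [mem_union, mem_supportOf, outputSet, outputSet, mem_filter, mem_filter, key e, if_pos e.2]
  simp only [mem_univ, true_and]
  omega

/-- Scale the threshold. -/
def thresholdCmd : Cmd :=
  .assign vThr (.read 1 (.const 2)) ;;
  .upto vI 1 (.assign vThr (.mul (.var vThr) (.read 8 (.var vI))))

theorem thresholdCmd_spec {s : State} (hm : s.arr 1 1 = m) :
    (thresholdCmd.exec s).var vThr = s.arr 1 2 * ∏ j : Fin m, s.arr 8 j := by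
  have key : (thresholdCmd.exec s).var vThr = s.arr 1 2 * ∏ j ∈ range m, s.arr 8 j := by
    unfold thresholdCmd
    rw [exec_seq, exec_assign]
    refine exec_upto_induct (N := m) ?_
      (fun N t => t.var vThr = s.arr 1 2 * ∏ j ∈ range N, s.arr 8 j) ?_ ?_ (fun _ _ h => h)
    · exact hm
    · simp [Term.eval]
    intro i t hi hv ha hI
    have h1 : t.arr 8 = s.arr 8 := ha 8 rfl
    rw [prod_range_succ, ← mul_assoc, ← hI, exec_assign]
    simp [Term.eval, h1]
  rw [key, prod_range]

/-- Cover the deficient cuts once more. -/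
def augmentCmd : Cmd := maskCmd ;; coverCmd 1 ;; unionCmd

/-- The program for Cap-`k`-ECSS. -/
def capCmd : Cmd :=
  scaleCmd 1 5 6 aCost ;; scaleCmd 1 7 8 aCap ;; thresholdCmd ;; .upto vOuter 1 augmentCmd

/-- The memory holds the scaled instance. -/
structure Prepared (s : State) (I : CapInstance) : Prop where
  hn : s.arr 1 0 = I.n
  hm : s.arr 1 1 = I.m
  fst : ∀ e : Fin I.m, s.arr 3 e = (I.E e).1
  snd : ∀ e : Fin I.m, s.arr 4 e = (I.E e).2
  cost : ∀ e : Fin I.m, (s.arr aCost e : ℚ≥0) = I.cost e * commonDen I.cost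
  cap : ∀ e : Fin I.m, (s.arr aCap e : ℚ≥0) = I.cap e * commonDen I.cap
  thr : s.var vThr = I.k * commonDen I.cap

section Augment

variable {I : CapInstance} {s t : State}

theorem Prepared.congr (h : Prepared s I) (h1 : t.arr 1 = s.arr 1) (h3 : t.arr 3 = s.arr 3)
    (h4 : t.arr 4 = s.arr 4) (hc : t.arr aCost = s.arr aCost) (hu : t.arr aCap = s.arr aCap)
    (hv : t.var vThr = s.var vThr) : Prepared t I :=
  ⟨h1 ▸ h.hn, h1 ▸ h.hm, h3 ▸ h.fst, h4 ▸ h.snd, hc ▸ h.cost, hu ▸ h.cap, hv ▸ h.thr⟩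

/-- The base graph consists of all edges, with scaled capacities on `F` and weight `0` elsewhere.
Its cut weights are the capacities of `F` times the common denominator, so scaling the threshold by
the same factor makes the deficient sets small sets. -/
theorem deficient_eq_small {F : Finset (Fin I.m)} {w : Fin I.m → ℕ}
    (hw : ∀ e, (w e : ℚ≥0) = if e ∈ F then I.cap e * commonDen I.cap else 0) :
    I.deficient F = {S | Small (cutWeight I.E w) (I.k * commonDen I.cap) S} := by
  ext S
  have hD : (0 : ℚ≥0) < commonDen I.cap := by exact_mod_cast commonDen_pos I.cap
  have h1 : (cutWeight I.E w S : ℚ≥0) = I.capCut F S * commonDen I.cap := by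
    rw [cutWeight, Nat.cast_sum, CapInstance.capCut, sum_mul]
    simp only [hw]
    rw [← sum_filter]
    refine sum_congr ?_ fun _ _ => rfl
    ext e
    rw [mem_filter, mem_cut, mem_cut]
    simp only [mem_univ, true_and]
    tauto
  have h2 : I.capCut F S < I.k ↔ cutWeight I.E w S < I.k * commonDen I.cap := by
    rw [← Nat.cast_lt (α := ℚ≥0), h1, Nat.cast_mul, mul_lt_mul_iff_left₀ hD]
  simp only [CapInstance.deficient, Small, Set.mem_ofPred_eq, h2]

theorem augmentCmd_spec (h : Prepared s I) {r : ℕ} (hp : I.Progress r (outputSet I.m s))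
    {J₀ : Finset (Fin I.m)} (hJ₀ : I.IsFeasible J₀) :
    I.Progress (r + 1) (outputSet I.m (augmentCmd.exec s)) := by
  have hmask := maskCmd_spec h.hm
  have hpt : Prepared (maskCmd.exec s) I := h.congr (maskCmd.exec_arr s rfl)
    (maskCmd.exec_arr s rfl) (maskCmd.exec_arr s rfl) (maskCmd.exec_arr s rfl)
    (maskCmd.exec_arr s rfl) (maskCmd.exec_var s rfl)
  have hout : outputSet I.m (maskCmd.exec s) = outputSet I.m s := by
    rw [outputSet, outputSet, maskCmd.exec_arr s rfl]
  have hmem : ∀ e, e ∈ outputSet I.m s ↔ s.arr 0 e ≠ 0 := fun e => by simp [outputSet]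
  rw [augmentCmd, exec_seq, exec_seq]
  set t := maskCmd.exec s with ht
  set F := outputSet I.m s with hF
  have hL : Layout t 1 I.E (fun e => t.arr aBase e) (hide I.E F) (I.k * commonDen I.cap) := by
    refine ⟨hpt.hn, hpt.hm, hpt.hm, hpt.fst, hpt.snd, fun e => rfl, fun e => ?_, fun e => ?_,
      hpt.thr⟩
    · rw [(hmask e).1, h.fst, hide]
      split_ifs <;> rfl
    · rw [(hmask e).2.1, hide, h.fst, h.snd]
      by_cases he : e ∈ F
      · rw [if_pos he, if_pos ((hmem e).1 he)]
      · rw [if_neg he, if_neg fun h' => he ((hmem e).2 h')]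
  have hw : ∀ e : Fin I.m, (t.arr aBase e : ℚ≥0) =
      if e ∈ F then I.cap e * commonDen I.cap else 0 := fun e => by
    rw [(hmask e).2.2]
    by_cases he : e ∈ F
    · rw [if_pos he, if_pos ((hmem e).1 he), h.cap]
    · rw [if_neg he, if_neg fun h' => he ((hmem e).2 h'), Nat.cast_zero]
  have hdef := deficient_eq_small hw
  -- The covering problem of this round is solvable because the given feasible solution is itself a
  -- cover.
  obtain ⟨hcov, hopt⟩ := coverCmd_spec hL
    (by rw [← hdef]; exact (hJ₀.covers_hide F).mono (subset_univ _))
  rw [← hdef] at hcov hopt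
  have hm : ((coverCmd 1).exec t).arr 1 1 = I.m := by
    rw [(coverCmd 1).exec_arr t rfl]; exact hpt.hm
  have hout' : outputSet I.m ((coverCmd 1).exec t) = F := by
    rw [← hout, outputSet, outputSet, (coverCmd 1).exec_arr t rfl]
  rw [unionCmd_spec hm, hout']
  exact hp.succ hcov fun J hJ =>
    sum_le_of_scaled (r := 10) (commonDen_pos I.cost) hpt.cost (hopt J hJ)

theorem capCmd_prepared (I : CapInstance) : ∃ s, Prepared s I ∧ outputSet I.m s = ∅ ∧
    capCmd.exec (initial (capKECSS.encode I)) = (Cmd.upto vOuter 1 augmentCmd).exec s := by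
  set s₀ := initial (capKECSS.encode I) with hs₀
  have i0 : s₀.arr 1 0 = I.n := rfl
  have i1 : s₀.arr 1 1 = I.m := rfl
  have i2 : s₀.arr 1 2 = I.k := rfl
  have j0 : s₀.arr 0 = fun _ => 0 := rfl
  have j3 : ∀ e : Fin I.m, s₀.arr 3 e = (I.E e).1 := fun e => getD_ofFn _ e
  have j4 : ∀ e : Fin I.m, s₀.arr 4 e = (I.E e).2 := fun e => getD_ofFn _ e
  have j5 : ∀ e : Fin I.m, s₀.arr 5 e = (I.cost e).num := fun e => getD_ofFn _ e
  have j6 : ∀ e : Fin I.m, s₀.arr 6 e = (I.cost e).den := fun e => getD_ofFn _ e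
  have j7 : ∀ e : Fin I.m, s₀.arr 7 e = (I.cap e).num := fun e => getD_ofFn _ e
  have j8 : ∀ e : Fin I.m, s₀.arr 8 e = (I.cap e).den := fun e => getD_ofFn _ e
  set s₁ := (scaleCmd 1 5 6 aCost).exec s₀ with hs₁
  have a1 : ∀ a, a ≠ aCost → s₁.arr a = s₀.arr a := fun a ha =>
    (scaleCmd 1 5 6 aCost).exec_arr s₀ (by simp [scaleCmd, Cmd.writesArr, ha])
  have b1 := scaleCmd_spec (s := s₀) (mi := 1) (a := 5) (b := 6) (c := aCost) (m := I.m)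
    (by decide) (by decide) (by decide) i1
  set s₂ := (scaleCmd 1 7 8 aCap).exec s₁ with hs₂
  have a2 : ∀ a, a ≠ aCap → s₂.arr a = s₁.arr a := fun a ha =>
    (scaleCmd 1 7 8 aCap).exec_arr s₁ (by simp [scaleCmd, Cmd.writesArr, ha])
  have b2 := scaleCmd_spec (s := s₁) (mi := 1) (a := 7) (b := 8) (c := aCap) (m := I.m)
    (by decide) (by decide) (by decide) (by rw [a1 1 (by decide), i1])
  have b3 := thresholdCmd_spec (s := s₂) (m := I.m)
    (by rw [a2 1 (by decide), a1 1 (by decide), i1])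
  have a3 : ∀ a, (thresholdCmd.exec s₂).arr a = s₂.arr a := fun a => thresholdCmd.exec_arr s₂ rfl
  rw [← hs₁] at b1
  rw [← hs₂] at b2
  have inp : ∀ a, a ≤ 8 → (thresholdCmd.exec s₂).arr a = s₀.arr a := fun a ha => by
    rw [a3, a2 a (by omega), a1 a (by omega)]
  refine ⟨thresholdCmd.exec s₂, ⟨?_, ?_, fun e => ?_, fun e => ?_, fun e => ?_, fun e => ?_, ?_⟩,
    ?_, ?_⟩
  · rw [inp 1 (by decide), i0]
  · rw [inp 1 (by decide), i1]
  · rw [inp 3 (by decide), j3]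
  · rw [inp 4 (by decide), j4]
  · rw [a3, a2 _ (by decide), b1, j5]
    simp only [j6]
    exact num_mul_prod I.cost e
  · rw [a3, b2, a1 7 (by decide), a1 8 (by decide), j7]
    simp only [j8]
    exact num_mul_prod I.cap e
  · rw [b3, a2 1 (by decide), a1 1 (by decide), a2 8 (by decide), a1 8 (by decide), i2]
    simp only [j8]
    rfl
  · rw [outputSet, inp 0 (by decide), j0]
    simp
  · rfl

theorem capCmd_correct (I : CapInstance) {J₀ : Finset (Fin I.m)} (hJ₀ : I.IsFeasible J₀) :
    I.Progress I.m (outputSet I.m (capCmd.exec (initial (capKECSS.encode I)))) := by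
  obtain ⟨s, hs, hout, hexec⟩ := capCmd_prepared I
  rw [hexec]
  refine exec_upto_induct (N := I.m) hs.hm (fun N t => I.Progress N (outputSet I.m t)) ?_ ?_
    (fun _ _ h => h)
  · show I.Progress 0 (outputSet I.m s)
    rw [hout]
    exact CapInstance.Progress.zero
  · intro i t hi hv ha hI
    have ht : Prepared (t.setVar vOuter i) I := hs.congr (ha 1 rfl) (ha 3 rfl) (ha 4 rfl)
      (ha aCost rfl) (ha aCap rfl)
      (by rw [setVar_var, if_neg (by decide)]; exact hv vThr rfl (by decide))
    exact augmentCmd_spec ht hI hJ₀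

end Augment

theorem admitsRatio_capKECSS : capKECSS.AdmitsRatio
    (fun I : CapInstance => 10 * (⌈(I.k : ℚ≥0) / I.uMin⌉₊ : ℚ≥0)) := by
  -- Here only `n` and `m` bound loops.
  refine EdgeProblem.admitsRatio_of_cmd capCmd 2 rfl ?_ ?_
  · intro I b hb
    have h1 : List.range I.n ∈ capKECSS.encode I := by simp [capKECSS]
    have h2 : (List.ofFn fun e => ((I.E e).1 : ℕ)) ∈ capKECSS.encode I := by
      simp [capKECSS, encodeEdges]
    have h1' := length_le_inputLength h1
    have h2' := length_le_inputLength h2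
    rw [List.length_range] at h1'
    rw [List.length_ofFn] at h2'
    interval_cases b
    · exact h1'
    · exact h2'
  · rintro I ⟨J₀, hJ₀⟩
    have h := capCmd_correct I hJ₀
    generalize capCmd.exec (initial (capKECSS.encode I)) = s at h ⊢
    exact ⟨h.isFeasible hJ₀, fun J hJ => h.cost_le hJ⟩

end NetDesign

theorem mainTheorem4 :
    NetDesign.nearMinCutsCover.AdmitsRatio (fun _ => 10) ∧
    NetDesign.capKECSS.AdmitsRatio
      (fun I : NetDesign.CapInstance => 10 * (⌈(I.k : ℚ≥0) / I.uMin⌉₊ : ℚ≥0)) :=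
  ⟨NetDesign.admitsRatio_nearMinCutsCover, NetDesign.admitsRatio_capKECSS⟩
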